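/- **Setting.** Fix an integer $n\ge 0$. Let $Jac$ be the space of real tridiagonal $(n+1)\times(n+1)$ matrices $X$ (rows and columns indexed by $0,\dots,n$) with all sub-diagonal entries equal to $1$, arbitrary diagonal entries $a_0,\dots,a_n$ and non-zero super-diagonal entries $b_0,\dots,b_{n-1}$; it is an open subset of $\mathbb R^{2n+1}$ with coordinates $(a,b)$. For a matrix $A$ let $A_{\le 0}$ be its lower triangular part including the diagonal and $A_{>0}$ its strictly upper triangular part. For $X\in Jac$ let $P(\lambda)=(p_0,\dots,p_n)^T$ and $\tilde P(\lambda)=(\tilde p_0,\dots,\tilde p_n)^T$ be the unique vectors of polynomials with $p_0=\tilde p_0=1$, $XP=\lambda P-p_{n+1}e_n$ and $\tilde P^TX=\lambda\tilde P^T-\tilde p_{n+1}e_n^T$ for some polynomials $p_{n+1},\tilde p_{n+1}$. Let $\mathcal D$ and $\tilde{\mathcal D}$ be the unique matrices independent of $\lambda$ with $P'=\mathcal DP$ and $(\tilde P^T)'=\tilde P^T\tilde{\mathcal D}$. Put $H_j=\frac1j\,\mathrm{Tr}\,X^j$ for $j\in\mathbb Z\setminus\{0\}$ and $H_0=\ln|\det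 X|$, where for $j\le 0$ the function $H_j$ is considered at those $X$ with $\det X\ne 0$. Let $M(\lambda)=M(\lambda,X)=((\lambda-X)^{-1}e_0,e_0)$ be the Weyl function, a proper rational function of $\lambda$ whose denominator is the characteristic polynomial of $X$, and let $r_-$ denote the proper part of a rational function $r$ (that is, $r$ minus its polynomial part). For $l=1,2,\dots$ let $$B_l(X)=(X^{l+1}\tilde{\mathcal D})_{\le 0}-(\mathcal DX^{l+1})_{>0}-\sum_{\beta=1}^{l}\beta H_\beta\,(X^{l-\beta})_{\le 0}.$$ **Theorem 4.3.** For every $l\ge 1$ the equation $\dot X=X^{l+1}+[X,B_l(X)]$ defines a smooth vector field $Y_l$ on $Jac$ (its right-hand side is tangent to $Jac$). For each integer $k\ge 0$ there is exactly one smooth skew-symmetric bracket $\{\,,\}_k$ on $Jac$ (a derivation in each argument) such that, for all $X\in Jac$ and all real $\lambda\ne\mu$ outside the spectrum of $X$, $$\{M(\lambda),M(\mu)\}_k=\bigl((\lambda^kM(\lambda))_--(\mu^kM(\mu))_-\bigr)\Bigl(\frac{M(\lambda)-M(\mu)}{\lambda-\mu}+M(\lambda)M(\mu)\Bigr).$$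 The $Y_l$ are master symmetries: (i) for all $l\ge 1$ and $j\in\mathbb Z$, $H_j$ is differentiable (where $\det X\neq 0$, if $j\le 0$), and there $\mathfrak L_{Y_l}H_j=(l+j)H_{l+j}$ if $j\ne -l$, while $\mathfrak L_{Y_l}H_{-l}=n+1$; (ii) $\mathfrak L_{Y_l}\{\,,\}_k=(k-l-1)\{\,,\}_{k+l}$ for all $l\ge 1$ and $k\ge 0$; that is, for all $f,g$ of class $C^2$ near a point of $Jac$, at that point, $$Y_l\{f,g\}_k-\{Y_lf,g\}_k-\{f,Y_lg\}_k=(k-l-1)\{f,g\}_{k+l}.$$ -/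

import Mathlib

open scoped ContDiff

noncomputable section

namespace TodaJac

/-- Coordinates `(a, b)` for tridiagonal `(n+1) × (n+1)` matrices with unit sub-diagonal:
`a` is the diagonal and `b` the super-diagonal. -/
abbrev Coord (n : ℕ) : Type := (Fin (n + 1) → ℝ) × (Fin n → ℝ)

/-- The phase space `Jac`: the super-diagonal entries are non-zero (an open set of `Coord n`). -/
def Jac (n : ℕ) : Set (Coord n) := {x | ∀ i, x.2 i ≠ 0}

/-- The diagonal, as a sequence. -/
def diagSeq {n : ℕ} (x : Coord n) (i : ℕ) : ℝ := if h : i < n + 1 then x.1 ⟨i, h⟩ else 0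

/-- The super-diagonal, as a sequence, continued by `1`. -/
def superSeq {n : ℕ} (x : Coord n) (i : ℕ) : ℝ := if h : i < n then x.2 ⟨i, h⟩ else 1

/-- The tridiagonal matrix `X` with ones on the sub-diagonal, diagonal `a`, super-diagonal `b`. -/
def jacMatrix {n : ℕ} (x : Coord n) : Matrix (Fin (n + 1)) (Fin (n + 1)) ℝ :=
  Matrix.of fun i j =>
    if (i : ℕ) = j + 1 then 1
    else if i = j then diagSeq x i
    else if (j : ℕ) = i + 1 then superSeq x i
    else 0

/-- The matrix of a tangent vector of `Jac` (the derivative of `jacMatrix`): diagonal `v.1`,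
super-diagonal `v.2`, all other entries zero. -/
def tangentMatrix {n : ℕ} (v : Coord n) : Matrix (Fin (n + 1)) (Fin (n + 1)) ℝ :=
  Matrix.of fun i j =>
    if i = j then diagSeq v i
    else if (j : ℕ) = i + 1 then superSeq v i
    else 0

/-- `A_{≤ 0}`: the lower triangular part, with the diagonal. -/
def lowerPart {m : ℕ} (A : Matrix (Fin m) (Fin m) ℝ) : Matrix (Fin m) (Fin m) ℝ :=
  Matrix.of fun i j => if j ≤ i then A i j else 0

/-- `A_{> 0}`: the strictly upper triangular part. -/
def strictUpperPart {m : ℕ} (A : Matrix (Fin m) (Fin m) ℝ) : Matrix (Fin m) (Fin m) ℝ :=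
  Matrix.of fun i j => if i < j then A i j else 0

/-- The polynomials `p_i`: `p_0 = 1` and, row by row, `X P = λ P - p_{n+1} e_n` for the column
`P = (p_0, …, p_n)`. -/
def rightPoly {n : ℕ} (x : Coord n) : ℕ → Polynomial ℝ
  | 0 => 1
  | 1 => Polynomial.C (superSeq x 0)⁻¹ * (Polynomial.X - Polynomial.C (diagSeq x 0))
  | i + 2 => Polynomial.C (superSeq x (i + 1))⁻¹ *
      ((Polynomial.X - Polynomial.C (diagSeq x (i + 1))) * rightPoly x (i + 1) - rightPoly x i)

/-- The monic polynomials `p̃_i`: `p̃_0 = 1` and, column by column,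
`P̃ᵀ X = λ P̃ᵀ - p̃_{n+1} e_nᵀ` for the column `P̃ = (p̃_0, …, p̃_n)`. -/
def leftPoly {n : ℕ} (x : Coord n) : ℕ → Polynomial ℝ
  | 0 => 1
  | 1 => Polynomial.X - Polynomial.C (diagSeq x 0)
  | i + 2 => (Polynomial.X - Polynomial.C (diagSeq x (i + 1))) * leftPoly x (i + 1)
      - Polynomial.C (superSeq x i) * leftPoly x i

/-- The coefficient matrix of `p_0, …, p_m`: row `i` holds the coefficients of `p_i`. -/
def coeffMatrix (m : ℕ) (p : ℕ → Polynomial ℝ) : Matrix (Fin (m + 1)) (Fin (m + 1)) ℝ :=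
  Matrix.of fun i j => (p i).coeff j

/-- For polynomials `p_i` of exact degree `i` (so that their coefficient matrix is invertible),
the unique matrix `D` with `p_i' = ∑ j, D i j * p_j`; it is strictly lower triangular. -/
def derivMatrix (m : ℕ) (p : ℕ → Polynomial ℝ) : Matrix (Fin (m + 1)) (Fin (m + 1)) ℝ :=
  coeffMatrix m (fun i => Polynomial.derivative (p i)) * (coeffMatrix m p)⁻¹

/-- `𝒟`, given by `P' = 𝒟 P`. -/
def dMat {n : ℕ} (x : Coord n) : Matrix (Fin (n + 1)) (Fin (n + 1)) ℝ :=
  derivMatrix n (rightPoly x)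

/-- `𝒟̃`, given by `(P̃ᵀ)' = P̃ᵀ 𝒟̃`. -/
def dTildeMat {n : ℕ} (x : Coord n) : Matrix (Fin (n + 1)) (Fin (n + 1)) ℝ :=
  (derivMatrix n (leftPoly x)).transpose

/-- `H_j = (1/j) Tr X^j` for `j ≠ 0`, and `H_0 = ln |det X|` (`Real.log t = ln |t|`). For `j ≤ 0`
this is meaningful where `det X ≠ 0`. -/
def ham {n : ℕ} (j : ℤ) (x : Coord n) : ℝ :=
  if j = 0 then Real.log (jacMatrix x).det else (1 / (j : ℝ)) * (jacMatrix x ^ j).trace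

/-- `B_l(X) = (X^{l+1} 𝒟̃)_{≤0} - (𝒟 X^{l+1})_{>0} - ∑_{β=1}^{l} β H_β (X^{l-β})_{≤0}`. -/
def bMat {n : ℕ} (l : ℕ) (x : Coord n) : Matrix (Fin (n + 1)) (Fin (n + 1)) ℝ :=
  lowerPart (jacMatrix x ^ (l + 1) * dTildeMat x)
    - strictUpperPart (dMat x * jacMatrix x ^ (l + 1))
    - ∑ β ∈ Finset.Icc 1 l, ((β : ℝ) * ham (β : ℤ) x) • lowerPart (jacMatrix x ^ (l - β))

/-- The right-hand side `X^{l+1} + [X, B_l(X)]`. -/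
def masterRhs {n : ℕ} (l : ℕ) (x : Coord n) : Matrix (Fin (n + 1)) (Fin (n + 1)) ℝ :=
  jacMatrix x ^ (l + 1) + (jacMatrix x * bMat l x - bMat l x * jacMatrix x)

/-- The vector field `Y_l`, read off from the diagonal and the super-diagonal of the right-hand
side (that all its other entries vanish is part of what is to be proved). -/
def masterField {n : ℕ} (l : ℕ) (x : Coord n) : Coord n :=
  (fun i => masterRhs l x i i, fun i => masterRhs l x i.castSucc i.succ)

/-- The Lie derivative of a function. -/
def lieDeriv {n : ℕ} (Y : Coord n → Coord n) (f : Coord n → ℝ) (x : Coord n) : ℝ :=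
  fderiv ℝ f x (Y x)

/-- The Weyl function `M(z, X) = ((z - X)⁻¹ e_0, e_0)`. -/
def weyl {n : ℕ} (z : ℝ) (x : Coord n) : ℝ :=
  ((z • (1 : Matrix (Fin (n + 1)) (Fin (n + 1)) ℝ) - jacMatrix x)⁻¹) 0 0

/-- The numerator `q` of the Weyl function `M = q / p`, where `p` is the characteristic polynomial
of `X`. -/
def weylNum {n : ℕ} (x : Coord n) : Polynomial ℝ :=
  (jacMatrix x).charmatrix.adjugate 0 0

/-- `(z^k M(z))_-`, the proper part of the rational function `z^k M(z)`, that is, the rational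
function with denominator `p` whose numerator is the remainder of `z^k q` modulo `p`. -/
def weylProper {n : ℕ} (k : ℕ) (z : ℝ) (x : Coord n) : ℝ :=
  ((Polynomial.X ^ k * weylNum x) %ₘ (jacMatrix x).charpoly).eval z / (jacMatrix x).charpoly.eval z

/-- A field of bilinear forms on differentials. -/
abbrev BiField (n : ℕ) : Type :=
  Coord n → (Coord n →L[ℝ] ℝ) →ₗ[ℝ] (Coord n →L[ℝ] ℝ) →ₗ[ℝ] ℝ

/-- The bracket `{f, g}` of two functions that is given by a field of bilinear forms. -/
def brk {n : ℕ} (w : BiField n) (f g : Coord n → ℝ) (x : Coord n) : ℝ :=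
  w x (fderiv ℝ f x) (fderiv ℝ g x)

/-- `w` is the smooth skew-symmetric bracket on `Jac` obtained by pulling back the `k`-th bracket
on rational functions through the Weyl function: for `z ≠ z'` off the spectrum,
`{M(z), M(z')} = ((z^k M(z))_- - (z'^k M(z'))_-) ((M(z) - M(z')) / (z - z') + M(z) M(z'))`. -/
structure IsWeylBracket (n k : ℕ) (w : BiField n) : Prop where
  smooth : ∀ α β, ContDiffOn ℝ ∞ (fun x => w x α β) (Jac n)
  skew : ∀ x ∈ Jac n, ∀ α β, w x α β = -w x β α
  pullback : ∀ x ∈ Jac n, ∀ z z' : ℝ, z ≠ z' →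
    (jacMatrix x).charpoly.eval z ≠ 0 → (jacMatrix x).charpoly.eval z' ≠ 0 →
    brk w (weyl z) (weyl z') x =
      (weylProper k z x - weylProper k z' x) *
        ((weyl z x - weyl z' x) / (z - z') + weyl z x * weyl z' x)

end TodaJac

end

open scoped ContDiff

noncomputable section

namespace TodaJac

open Polynomial Matrix

section

/-! ### Derivative matrices of graded families of polynomials -/

section DerivMatrix

variable {m : ℕ} {p : ℕ → ℝ[X]}

/-! The Weyl function is encoded in the moments σ(f) = (f(X)e₀, e₀), f a real polynomial, and the
brackets are computed on these functions. Along Ẋ = X^{l+1} + [X, B] a polynomial in X moves by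
X^{l+1} f'(X) + [f(X), B]. The trace removes the commutator, so Y_l H_j = Tr X^{l+j}; negative
powers and ln|det X| behave alike. This is (i), see `ham_masterField`.

Tangency: differentiating the recursions gives [X, 𝒟] = 1 outside the last row and [𝒟̃, X] = 1
outside the last column. Up to a polynomial in X and a strictly upper triangular matrix, B_l is
X^{l+1}𝒟̃; up to a lower triangular matrix it is -𝒟X^{l+1}. The first form shows that the right-hand
side has the required zeros below the diagonal, the second that it has them above the
super-diagonal.

Brackets: the lower coefficients of p and q, where M = q/p, are local coordinates on Jac, because
the moments separate tangent vectors. In them the bracket has {p, p} = {q, q} = 0 and an explicit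
polynomial {p(z), q(z')}_k. It is unique because the differentials of the M(z) span. The passage
from M(z) to σ(f) rests on `linearMap_eq_zero_of_fractions`: a linear functional of f that sees f
only modulo p² is determined by the inverses of z - X modulo p². It yields `weylBracket_dSigma`,
where {σ(f), σ(g)}_k is σ ⊗ σ of x^k (f(y)g(x) - f(x)g(y))/(x - y) up to terms with a factor σ(f) or
σ(g), and `weylBracket_traceForm` for spectral differentials.

For (ii), the left-hand side depends only on df and dg at the point (`exists_lieDeriv_weylBracket`),
so f and g may be replaced by moments that vanish there. Only the first row and column of B_l enter
Y_l σ(f), and on σ ⊗ σ the field acts as x^{l+1}∂_x + y^{l+1}∂_y with corrections that carry factors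
Tr X^β. Those corrections cancel. Apart from what the two other brackets absorb, the derivation
leaves k x^{k+l} - x^k ∑ x^i y^{l-i} times the kernel, and the differentials of Tr X^β contribute
x^k ∑ x^i y^{l-i} - (l+1) x^{k+l}. The total is (k - l - 1) x^{k+l}. -/

/-- `p i` has exact degree `i` for every `i`. -/
def IsGraded (p : ℕ → ℝ[X]) : Prop :=
  (∀ i j, i < j → (p i).coeff j = 0) ∧ ∀ i, (p i).coeff i ≠ 0

theorem IsGraded.coeffMatrix_isLowerTriangular (hp : IsGraded p) :
    (coeffMatrix m p).BlockTriangular OrderDual.toDual := by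
  intro i j hij
  exact hp.1 i j hij

theorem IsGraded.det_coeffMatrix_ne_zero (hp : IsGraded p) : (coeffMatrix m p).det ≠ 0 := by
  rw [det_of_isLowerTriangular _ hp.coeffMatrix_isLowerTriangular]
  exact Finset.prod_ne_zero_iff.2 fun i _ => hp.2 i

theorem IsGraded.derivMatrix_mul_coeffMatrix (hp : IsGraded p) :
    derivMatrix m p * coeffMatrix m p = coeffMatrix m (fun i => derivative (p i)) := by
  rw [derivMatrix, Matrix.mul_assoc, nonsing_inv_mul _ hp.det_coeffMatrix_ne_zero.isUnit,
    Matrix.mul_one]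

theorem IsGraded.sum_derivMatrix (hp : IsGraded p) (i : Fin (m + 1)) :
    ∑ j : Fin (m + 1), C (derivMatrix m p i j) * p j = derivative (p i) := by
  ext k
  simp only [finsetSum_coeff, coeff_C_mul]
  by_cases hk : k < m + 1
  · have := congrFun (congrFun hp.derivMatrix_mul_coeffMatrix i) ⟨k, hk⟩
    simpa [Matrix.mul_apply, coeffMatrix] using this
  · rw [coeff_derivative, hp.1 i (k + 1) (by omega), zero_mul]
    exact Finset.sum_eq_zero fun j _ => by rw [hp.1 j k (by omega), mul_zero]

theorem IsGraded.eq_zero_of_sum_eq_zero (hp : IsGraded p) {c : Fin (m + 1) → ℝ}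
    (h : ∑ j : Fin (m + 1), C (c j) * p j = 0) : c = 0 := by
  refine eq_zero_of_vecMul_eq_zero hp.det_coeffMatrix_ne_zero ?_
  ext k
  have := congrArg (fun q => q.coeff (k : ℕ)) h
  simpa [finsetSum_coeff, vecMul, dotProduct, coeffMatrix] using this

/-- Differentiation lowers degrees, so the derivatives have a strictly lower triangular coefficient
matrix; the inverse of the other factor stays lower triangular. -/
theorem IsGraded.derivMatrix_eq_zero (hp : IsGraded p) {i j : Fin (m + 1)} (hij : i ≤ j) :
    derivMatrix m p i j = 0 := by
  have := invertibleOfIsUnitDet _ (hp.det_coeffMatrix_ne_zero (m := m)).isUnit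
  have hinv := blockTriangular_inv_of_blockTriangular
    (hp.coeffMatrix_isLowerTriangular (m := m))
  rw [derivMatrix, Matrix.mul_apply]
  refine Finset.sum_eq_zero fun k _ => ?_
  rcases lt_or_ge k j with hkj | hkj
  · rw [hinv (i := k) (j := j) hkj, mul_zero]
  · have : (i : ℕ) ≤ k := le_trans (Fin.le_def.1 hij) (Fin.le_def.1 hkj)
    simp [coeffMatrix, coeff_derivative, hp.1 i (k + 1) (by omega)]

/-- Differentiate Z P = λP in λ: Z𝒟P = P + λ𝒟P. The last row is left out because there the recursion
carries an extra polynomial of degree m + 1. -/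
theorem IsGraded.commutator_derivMatrix (hp : IsGraded p)
    {Z : Matrix (Fin (m + 1)) (Fin (m + 1)) ℝ}
    (hZ : ∀ i : Fin (m + 1), (i : ℕ) < m → ∑ j : Fin (m + 1), C (Z i j) * p j = X * p i)
    {i : Fin (m + 1)} (hi : (i : ℕ) < m) (j : Fin (m + 1)) :
    (Z * derivMatrix m p - derivMatrix m p * Z) i j =
      (1 : Matrix (Fin (m + 1)) (Fin (m + 1)) ℝ) i j := by
  have key : ∑ j : Fin (m + 1), C ((Z * derivMatrix m p - derivMatrix m p * Z) i j
      - (1 : Matrix (Fin (m + 1)) (Fin (m + 1)) ℝ) i j) * p j = 0 := by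
    have h1 : ∑ j : Fin (m + 1), C ((Z * derivMatrix m p) i j) * p j =
        p i + X * derivative (p i) := by
      calc ∑ j : Fin (m + 1), C ((Z * derivMatrix m p) i j) * p j
          = ∑ k : Fin (m + 1), C (Z i k) * ∑ j : Fin (m + 1), C (derivMatrix m p k j) * p j := by
            simp only [Matrix.mul_apply, map_sum, map_mul, Finset.sum_mul, Finset.mul_sum, mul_assoc]
            rw [Finset.sum_comm]
        _ = derivative (∑ k : Fin (m + 1), C (Z i k) * p k) := by
            simp [hp.sum_derivMatrix]
        _ = _ := by rw [hZ i hi, derivative_mul, derivative_X, one_mul]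
    have h2 : ∑ j : Fin (m + 1), C ((derivMatrix m p * Z) i j) * p j =
        X * derivative (p i) := by
      calc ∑ j : Fin (m + 1), C ((derivMatrix m p * Z) i j) * p j
          = ∑ k : Fin (m + 1), C (derivMatrix m p i k) * ∑ j : Fin (m + 1), C (Z k j) * p j := by
            simp only [Matrix.mul_apply, map_sum, map_mul, Finset.sum_mul, Finset.mul_sum, mul_assoc]
            rw [Finset.sum_comm]
        _ = ∑ k : Fin (m + 1), X * (C (derivMatrix m p i k) * p k) := by
            refine Finset.sum_congr rfl fun k _ => ?_
            -- Row `i` of the strictly lower triangular matrix meets only rows `k < i < m`, where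
            -- `hZ` is available.
            rcases lt_or_ge k i with hk | hk
            · rw [hZ k (lt_trans hk hi)]; ring
            · rw [hp.derivMatrix_eq_zero hk]; simp
        _ = _ := by rw [← Finset.mul_sum, hp.sum_derivMatrix]
    have h3 : ∑ j : Fin (m + 1), C ((1 : Matrix (Fin (m + 1)) (Fin (m + 1)) ℝ) i j) * p j = p i := by
      rw [Finset.sum_eq_single i]
      · simp
      · intro k _ hk
        rw [Matrix.one_apply_ne hk.symm]; simp
      · simp
    simp only [Matrix.sub_apply, map_sub, sub_mul, Finset.sum_sub_distrib] at h1 h2 h3 ⊢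
    rw [h1, h2, h3]; ring
  exact sub_eq_zero.1 (congrFun (hp.eq_zero_of_sum_eq_zero key) j)

end DerivMatrix

/-! ### The matrices `𝒟` and `𝒟̃` -/

variable {n : ℕ} {x : Coord n}

theorem superSeq_ne_zero (hx : x ∈ Jac n) (i : ℕ) : superSeq x i ≠ 0 := by
  unfold superSeq; split_ifs with h
  · exact hx _
  · exact one_ne_zero

theorem isGraded_rightPoly (hx : x ∈ Jac n) : IsGraded (rightPoly x) := by
  have key : ∀ i, ((∀ j, i < j → (rightPoly x i).coeff j = 0) ∧ (rightPoly x i).coeff i ≠ 0) ∧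
      ((∀ j, i + 1 < j → (rightPoly x (i + 1)).coeff j = 0) ∧
        (rightPoly x (i + 1)).coeff (i + 1) ≠ 0) := by
    intro i
    induction i with
    | zero =>
      refine ⟨⟨fun j hj => ?_, ?_⟩, fun j hj => ?_, ?_⟩
      · rw [rightPoly, coeff_one, if_neg (by omega)]
      · simp [rightPoly]
      · obtain ⟨j, rfl⟩ : ∃ k, j = k + 2 := ⟨j - 2, by omega⟩
        simp [rightPoly, coeff_X]
      · simp [rightPoly, coeff_X, superSeq_ne_zero hx]
    | succ i ih =>
      refine ⟨ih.2, fun j hj => ?_, ?_⟩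
      · obtain ⟨j, rfl⟩ : ∃ k, j = k + 1 := ⟨j - 1, by omega⟩
        rw [rightPoly, coeff_C_mul, coeff_sub, sub_mul, coeff_sub, coeff_X_mul, coeff_C_mul,
          ih.2.1 _ (by omega), ih.2.1 _ (by omega), ih.1.1 _ (by omega)]
        simp
      · rw [rightPoly, coeff_C_mul, coeff_sub, sub_mul, coeff_sub, coeff_X_mul, coeff_C_mul,
          ih.2.1 (i + 1 + 1) (by omega), ih.1.1 _ (by omega)]
        simpa using ⟨superSeq_ne_zero hx _, ih.2.2⟩
  exact ⟨fun i => (key i).1.1, fun i => (key i).1.2⟩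

theorem isGraded_leftPoly : IsGraded (leftPoly x) := by
  have key : ∀ i, ((∀ j, i < j → (leftPoly x i).coeff j = 0) ∧ (leftPoly x i).coeff i ≠ 0) ∧
      ((∀ j, i + 1 < j → (leftPoly x (i + 1)).coeff j = 0) ∧
        (leftPoly x (i + 1)).coeff (i + 1) ≠ 0) := by
    intro i
    induction i with
    | zero =>
      refine ⟨⟨fun j hj => ?_, ?_⟩, fun j hj => ?_, ?_⟩
      · rw [leftPoly, coeff_one, if_neg (by omega)]
      · simp [leftPoly]
      · obtain ⟨j, rfl⟩ : ∃ k, j = k + 2 := ⟨j - 2, by omega⟩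
        simp [leftPoly, coeff_X]
      · simp [leftPoly, coeff_X]
    | succ i ih =>
      refine ⟨ih.2, fun j hj => ?_, ?_⟩
      · obtain ⟨j, rfl⟩ : ∃ k, j = k + 1 := ⟨j - 1, by omega⟩
        rw [leftPoly, coeff_sub, sub_mul, coeff_sub, coeff_X_mul, coeff_C_mul, coeff_C_mul,
          ih.2.1 _ (by omega), ih.2.1 _ (by omega), ih.1.1 _ (by omega)]
        simp
      · rw [leftPoly, coeff_sub, sub_mul, coeff_sub, coeff_X_mul, coeff_C_mul, coeff_C_mul,
          ih.2.1 (i + 1 + 1) (by omega), ih.1.1 _ (by omega)]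
        simpa using ih.2.2
  exact ⟨fun i => (key i).1.1, fun i => (key i).1.2⟩

theorem jacMatrix_apply (i j : Fin (n + 1)) :
    jacMatrix x i j = (if (i : ℕ) = j + 1 then 1 else 0) + (if (i : ℕ) = j then diagSeq x i else 0)
      + (if (j : ℕ) = i + 1 then superSeq x i else 0) := by
  simp only [jacMatrix, Matrix.of_apply, Fin.ext_iff]
  split_ifs <;> first | omega | simp

theorem sum_jacMatrix_rightPoly (i : Fin (n + 1)) (hi : (i : ℕ) < n) (hx : x ∈ Jac n) :
    ∑ j : Fin (n + 1), C (jacMatrix x i j) * rightPoly x j = X * rightPoly x i := by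
  obtain ⟨i, hi'⟩ := i
  simp only at hi
  simp only [jacMatrix_apply]
  rw [Fin.sum_univ_eq_sum_range (fun j => C ((if i = j + 1 then 1 else 0) +
    (if i = j then diagSeq x i else 0) + (if j = i + 1 then superSeq x i else 0))
      * rightPoly x j)]
  simp only [map_add, add_mul, Finset.sum_add_distrib, apply_ite C, ite_mul, map_zero, zero_mul,
    Finset.sum_ite_eq, Finset.sum_ite_eq', Finset.mem_range, hi', map_one, one_mul, if_true,
    if_pos (show i + 1 < n + 1 by omega)]
  rcases i with _ | i
  · have h0 : C (superSeq x 0) * C (superSeq x 0)⁻¹ = 1 := by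
      rw [← C_mul, mul_inv_cancel₀ (superSeq_ne_zero hx 0), C_1]
    rw [Finset.sum_eq_zero (fun j _ => if_neg (by omega))]
    simp only [rightPoly]
    linear_combination (X - C (diagSeq x 0)) * h0
  · have h0 : C (superSeq x (i + 1)) * C (superSeq x (i + 1))⁻¹ = 1 := by
      rw [← C_mul, mul_inv_cancel₀ (superSeq_ne_zero hx _), C_1]
    simp only [Nat.add_right_cancel_iff, Finset.sum_ite_eq, Finset.mem_range,
      if_pos (show i < n + 1 by omega)]
    simp only [rightPoly]
    linear_combination
      ((X - C (diagSeq x (i + 1))) * rightPoly x (i + 1) - rightPoly x i) * h0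

theorem sum_jacMatrix_leftPoly (i : Fin (n + 1)) (hi : (i : ℕ) < n) :
    ∑ j : Fin (n + 1), C ((jacMatrix x)ᵀ i j) * leftPoly x j = X * leftPoly x i := by
  obtain ⟨i, hi'⟩ := i
  simp only at hi
  simp only [Matrix.transpose_apply, jacMatrix_apply]
  rw [Fin.sum_univ_eq_sum_range (fun j => C ((if j = i + 1 then 1 else 0) +
    (if j = i then diagSeq x j else 0) + (if i = j + 1 then superSeq x j else 0))
      * leftPoly x j)]
  simp only [map_add, add_mul, Finset.sum_add_distrib, apply_ite C, ite_mul, map_zero, zero_mul,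
    Finset.sum_ite_eq', Finset.mem_range, hi', map_one, one_mul, if_true,
    if_pos (show i + 1 < n + 1 by omega)]
  rcases i with _ | i
  · rw [Finset.sum_eq_zero (fun j _ => if_neg (by omega))]
    simp only [leftPoly]
    ring
  · simp only [Nat.add_right_cancel_iff, Finset.sum_ite_eq, Finset.mem_range,
      if_pos (show i < n + 1 by omega)]
    simp only [leftPoly]
    ring

theorem dMat_eq_zero (hx : x ∈ Jac n) {i j : Fin (n + 1)} (hij : i ≤ j) : dMat x i j = 0 :=
  (isGraded_rightPoly hx).derivMatrix_eq_zero hij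

theorem dTildeMat_eq_zero {i j : Fin (n + 1)} (hij : j ≤ i) : dTildeMat x i j = 0 :=
  isGraded_leftPoly.derivMatrix_eq_zero hij

theorem commutator_dMat (hx : x ∈ Jac n) {i : Fin (n + 1)} (hi : (i : ℕ) < n) (j : Fin (n + 1)) :
    (jacMatrix x * dMat x - dMat x * jacMatrix x) i j =
      (1 : Matrix (Fin (n + 1)) (Fin (n + 1)) ℝ) i j :=
  (isGraded_rightPoly hx).commutator_derivMatrix
    (fun i hi => sum_jacMatrix_rightPoly i hi hx) hi j

/-- Transposing the row relation reverses the commutator and moves the exceptional row to the last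
column. -/
theorem commutator_dTildeMat (i : Fin (n + 1)) {j : Fin (n + 1)} (hj : (j : ℕ) < n) :
    (dTildeMat x * jacMatrix x - jacMatrix x * dTildeMat x) i j =
      (1 : Matrix (Fin (n + 1)) (Fin (n + 1)) ℝ) i j := by
  have := (isGraded_leftPoly (x := x)).commutator_derivMatrix sum_jacMatrix_leftPoly hj i
  rw [← Matrix.transpose_transpose (jacMatrix x), dTildeMat, Matrix.one_apply,
    ← Matrix.transpose_mul, ← Matrix.transpose_mul, ← Matrix.transpose_sub,
    Matrix.transpose_apply, this, Matrix.one_apply]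
  simp only [eq_comm]

/-! ### Tangency -/

theorem lowerPart_add_strictUpperPart {m : ℕ} (A : Matrix (Fin m) (Fin m) ℝ) :
    lowerPart A + strictUpperPart A = A := by
  ext i j
  simp only [lowerPart, strictUpperPart, Matrix.add_apply, Matrix.of_apply]
  rcases le_or_gt j i with h | h
  · simp [h, not_lt.2 h]
  · simp [h, not_le.2 h]

/-- The commutator of `jacMatrix x` with a strictly upper triangular matrix is upper triangular. -/
theorem commutator_apply_eq_zero_of_strictUpper {U : Matrix (Fin (n + 1)) (Fin (n + 1)) ℝ}
    (hU : ∀ i j, j ≤ i → U i j = 0) {i j : Fin (n + 1)} (hij : j < i) :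
    (jacMatrix x * U - U * jacMatrix x) i j = 0 := by
  rw [Matrix.sub_apply, Matrix.mul_apply, Matrix.mul_apply, Finset.sum_eq_zero,
    Finset.sum_eq_zero, sub_zero]
  · intro k _
    rcases le_or_gt k i with h | h
    · rw [hU _ _ h, zero_mul]
    · rw [jacMatrix_apply, if_neg (by omega), if_neg (by omega), if_neg (by omega)]; simp
  · intro k _
    rcases le_or_gt j k with h | h
    · rw [hU _ _ h, mul_zero]
    · rw [jacMatrix_apply, if_neg (by omega), if_neg (by omega), if_neg (by omega)]; simp

/-- The commutator of `jacMatrix x` with a lower triangular matrix is lower Hessenberg. -/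
theorem commutator_apply_eq_zero_of_lower {L : Matrix (Fin (n + 1)) (Fin (n + 1)) ℝ}
    (hL : ∀ i j, i < j → L i j = 0) {i j : Fin (n + 1)} (hij : (i : ℕ) + 1 < j) :
    (jacMatrix x * L - L * jacMatrix x) i j = 0 := by
  rw [Matrix.sub_apply, Matrix.mul_apply, Matrix.mul_apply, Finset.sum_eq_zero,
    Finset.sum_eq_zero, sub_zero]
  · intro k _
    rcases lt_or_ge i k with h | h
    · rw [hL _ _ h, zero_mul]
    · rw [jacMatrix_apply, if_neg (by omega), if_neg (by omega), if_neg (by omega)]; simp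
  · intro k _
    rcases lt_or_ge k j with h | h
    · rw [hL _ _ h, mul_zero]
    · rw [jacMatrix_apply, if_neg (by omega), if_neg (by omega), if_neg (by omega)]; simp

theorem strictUpperPart_apply_of_le {m : ℕ} (A : Matrix (Fin m) (Fin m) ℝ) {i j : Fin m}
    (h : j ≤ i) : strictUpperPart A i j = 0 := by
  simp [strictUpperPart, not_lt.2 h]

theorem lowerPart_apply_of_lt {m : ℕ} (A : Matrix (Fin m) (Fin m) ℝ) {i j : Fin m}
    (h : i < j) : lowerPart A i j = 0 := by
  simp [lowerPart, not_le.2 h]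

theorem lowerPart_apply_of_le {m : ℕ} (A : Matrix (Fin m) (Fin m) ℝ) {i j : Fin m}
    (h : j ≤ i) : lowerPart A i j = A i j := by
  simp [lowerPart, h]

/-- The combination of powers of `X` that enters `bMat`. -/
def powerSum (l : ℕ) (x : Coord n) : Matrix (Fin (n + 1)) (Fin (n + 1)) ℝ :=
  ∑ β ∈ Finset.Icc 1 l, ((β : ℝ) * ham (β : ℤ) x) • jacMatrix x ^ (l - β)

theorem lowerPart_powerSum (l : ℕ) (x : Coord n) : lowerPart (powerSum l x) =
    ∑ β ∈ Finset.Icc 1 l, ((β : ℝ) * ham (β : ℤ) x) • lowerPart (jacMatrix x ^ (l - β)) := by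
  ext i j
  simp only [powerSum, lowerPart, Matrix.of_apply, Matrix.sum_apply, Matrix.smul_apply]
  split_ifs <;> simp

theorem bMat_eq (l : ℕ) (x : Coord n) : bMat l x = lowerPart (jacMatrix x ^ (l + 1) * dTildeMat x)
    - strictUpperPart (dMat x * jacMatrix x ^ (l + 1)) - lowerPart (powerSum l x) := by
  rw [bMat, lowerPart_powerSum]

theorem commute_powerSum (l : ℕ) (x : Coord n) : Commute (jacMatrix x) (powerSum l x) :=
  Commute.sum_right _ _ _ fun _ _ => ((Commute.refl _).pow_right _).smul_right _

/-- Write each lower part as the full matrix minus its strictly upper part. The polynomial in X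
commutes with X, the term X^{l+1}𝒟̃ cancels X^{l+1} outside the last column, and an entry below the
diagonal is never in that column. What remains is a commutator with a strictly upper triangular `U`.
-/
theorem masterRhs_eq_zero_of_lt (l : ℕ) {i j : Fin (n + 1)} (hij : j < i) :
    masterRhs l x i j = 0 := by
  set J := jacMatrix x with hJ
  set U := strictUpperPart (J ^ (l + 1) * dTildeMat x) + strictUpperPart (dMat x * J ^ (l + 1))
    - strictUpperPart (powerSum l x) with hU
  have hB : bMat l x = J ^ (l + 1) * dTildeMat x - U - powerSum l x := by
    rw [bMat_eq, hU, ← hJ]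
    nth_rewrite 2 [← lowerPart_add_strictUpperPart (J ^ (l + 1) * dTildeMat x)]
    nth_rewrite 3 [← lowerPart_add_strictUpperPart (powerSum l x)]
    abel
  have hR : masterRhs l x = J ^ (l + 1) * (1 - (dTildeMat x * J - J * dTildeMat x))
      - (J * U - U * J) := by
    have hc : J * powerSum l x = powerSum l x * J := commute_powerSum l x
    have hp : J * J ^ (l + 1) = J ^ (l + 1) * J := (Commute.refl J).pow_right _
    rw [masterRhs, hB, ← hJ]
    simp only [Matrix.mul_sub, Matrix.sub_mul, hc, Matrix.mul_one, ← Matrix.mul_assoc, hp]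
    abel
  rw [hR, Matrix.sub_apply, hJ, commutator_apply_eq_zero_of_strictUpper _ hij, sub_zero,
    Matrix.mul_apply]
  · refine Finset.sum_eq_zero fun k _ => ?_
    rw [Matrix.sub_apply, commutator_dTildeMat k (by omega), sub_self, mul_zero]
  · intro a b hab
    simp [hU, strictUpperPart_apply_of_le _ hab]

/-- The mirror argument: now the strictly upper part is completed to the full matrix, 𝒟X^{l+1}
cancels X^{l+1} outside the last row, and the remaining commutator is with a lower triangular `L`.
-/
theorem masterRhs_eq_zero_of_add_one_lt (hx : x ∈ Jac n) (l : ℕ) {i j : Fin (n + 1)}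
    (hij : (i : ℕ) + 1 < j) : masterRhs l x i j = 0 := by
  set J := jacMatrix x with hJ
  set L := lowerPart (J ^ (l + 1) * dTildeMat x) + lowerPart (dMat x * J ^ (l + 1))
    - lowerPart (powerSum l x) with hL
  have hB : bMat l x = L - dMat x * J ^ (l + 1) := by
    rw [bMat_eq, hL, ← hJ]
    nth_rewrite 3 [← lowerPart_add_strictUpperPart (dMat x * J ^ (l + 1))]
    abel
  have hR : masterRhs l x = (1 - (J * dMat x - dMat x * J)) * J ^ (l + 1)
      + (J * L - L * J) := by
    have hp : J * J ^ (l + 1) = J ^ (l + 1) * J := (Commute.refl J).pow_right _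
    rw [masterRhs, hB, ← hJ]
    simp only [Matrix.mul_sub, Matrix.sub_mul, Matrix.one_mul, Matrix.mul_assoc, hp]
    abel
  rw [hR, Matrix.add_apply, hJ, commutator_apply_eq_zero_of_lower _ hij, add_zero,
    Matrix.mul_apply]
  · refine Finset.sum_eq_zero fun k _ => ?_
    rw [Matrix.sub_apply, commutator_dMat hx (by omega), sub_self, zero_mul]
  · intro a b hab
    simp [hL, lowerPart_apply_of_lt _ hab]

theorem tangentMatrix_masterField (hx : x ∈ Jac n) (l : ℕ) :
    tangentMatrix (masterField l x) = masterRhs l x := by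
  ext i j
  simp only [tangentMatrix, Matrix.of_apply]
  split_ifs with h1 h2
  · subst h1
    simp [diagSeq, masterField, show (i : ℕ) < n + 1 from i.2]
  · have hi : (i : ℕ) < n := by omega
    simp only [superSeq, masterField, hi, dif_pos]
    congr 1
    exact Fin.ext (by simp [h2])
  · rcases lt_or_gt_of_ne h1 with h | h
    · exact (masterRhs_eq_zero_of_add_one_lt hx l (by omega)).symm
    · exact (masterRhs_eq_zero_of_lt l h).symm

/-- The first column of 𝒟̃ vanishes, and so does the first row of 𝒟 in the next lemma. Hence neither
matrix is seen by ([f(X), B_l]e₀, e₀), which becomes an expression in moments and traces. -/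
theorem bMat_apply_zero_right (l : ℕ) (i : Fin (n + 1)) :
    bMat l x i 0 = -powerSum l x i 0 := by
  rw [bMat_eq, Matrix.sub_apply, Matrix.sub_apply, lowerPart_apply_of_le _ (Fin.zero_le i),
    lowerPart_apply_of_le _ (Fin.zero_le i), strictUpperPart_apply_of_le _ (Fin.zero_le i),
    Matrix.mul_apply, Finset.sum_eq_zero]
  · ring
  · intro k _
    rw [dTildeMat_eq_zero (Fin.zero_le k), mul_zero]

theorem bMat_zero_apply (hx : x ∈ Jac n) (l : ℕ) (j : Fin (n + 1)) :
    bMat l x 0 j = if j = 0 then -powerSum l x 0 0 else 0 := by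
  split_ifs with h
  · rw [h, bMat_apply_zero_right]
  · have hj : 0 < j := Fin.pos_of_ne_zero h
    rw [bMat_eq, Matrix.sub_apply, Matrix.sub_apply, lowerPart_apply_of_lt _ hj,
      lowerPart_apply_of_lt _ hj, strictUpperPart, Matrix.of_apply, if_pos hj, Matrix.mul_apply,
      Finset.sum_eq_zero]
    · ring
    · intro k _
      rw [dMat_eq_zero hx (Fin.zero_le k), zero_mul]

end

section

/-! ### Matrix-valued smooth functions -/

section MatrixCalculus

variable {E ι : Type*} [NormedAddCommGroup E] [NormedSpace ℝ E] [Fintype ι] [DecidableEq ι]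
  {s : Set E} {F G : E → Matrix ι ι ℝ} {y v : E}

/-- All entries are smooth on `s`. -/
def SmoothMat (F : E → Matrix ι ι ℝ) (s : Set E) : Prop :=
  ∀ i j, ContDiffOn ℝ ∞ (fun y => F y i j) s

theorem SmoothMat.add (hF : SmoothMat F s) (hG : SmoothMat G s) :
    SmoothMat (fun y => F y + G y) s := fun i j => (hF i j).add (hG i j)

theorem SmoothMat.sub (hF : SmoothMat F s) (hG : SmoothMat G s) :
    SmoothMat (fun y => F y - G y) s := fun i j => (hF i j).sub (hG i j)

theorem SmoothMat.const (A : Matrix ι ι ℝ) : SmoothMat (fun _ => A) s :=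
  fun _ _ => contDiffOn_const

theorem SmoothMat.smul {a : E → ℝ} (ha : ContDiffOn ℝ ∞ a s) (hF : SmoothMat F s) :
    SmoothMat (fun y => a y • F y) s := fun i j => ha.smul (hF i j)

theorem SmoothMat.sum {κ : Type*} (t : Finset κ) {F : κ → E → Matrix ι ι ℝ}
    (hF : ∀ k ∈ t, SmoothMat (F k) s) : SmoothMat (fun y => ∑ k ∈ t, F k y) s := fun i j => by
  simp only [Matrix.sum_apply]
  exact ContDiffOn.sum fun k hk => hF k hk i j

theorem SmoothMat.mul (hF : SmoothMat F s) (hG : SmoothMat G s) :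
    SmoothMat (fun y => F y * G y) s := fun i j => by
  simp only [Matrix.mul_apply]
  exact ContDiffOn.sum fun k _ => (hF i k).mul (hG k j)

theorem SmoothMat.pow (hF : SmoothMat F s) (k : ℕ) : SmoothMat (fun y => F y ^ k) s := by
  induction k with
  | zero => simpa using SmoothMat.const 1
  | succ k ih => simpa [pow_succ] using ih.mul hF

theorem SmoothMat.trace (hF : SmoothMat F s) : ContDiffOn ℝ ∞ (fun y => (F y).trace) s :=
  ContDiffOn.sum fun i _ => hF i i

theorem SmoothMat.det (hF : SmoothMat F s) : ContDiffOn ℝ ∞ (fun y => (F y).det) s := by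
  simp only [det_apply']
  exact ContDiffOn.sum fun σ _ => contDiffOn_const.mul (contDiffOn_prod fun i _ => hF (σ i) i)

theorem SmoothMat.inv (hF : SmoothMat F s) (hs : ∀ y ∈ s, (F y).det ≠ 0) :
    SmoothMat (fun y => (F y)⁻¹) s := fun i j => by
  simp only [Matrix.inv_def, Ring.inverse_eq_inv', Matrix.smul_apply, smul_eq_mul, adjugate_apply]
  refine (hF.det.inv hs).mul (SmoothMat.det fun k l => ?_)
  simp only [Matrix.updateRow_apply]
  split_ifs
  · exact contDiffOn_const
  · exact hF k l

/-- The entrywise derivative in the direction `v`. -/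
def matDeriv (F : E → Matrix ι ι ℝ) (y v : E) : Matrix ι ι ℝ :=
  Matrix.of fun i j => fderiv ℝ (fun y => F y i j) y v

/-- All entries are differentiable at the point. -/
def DiffMatAt (F : E → Matrix ι ι ℝ) (y : E) : Prop :=
  ∀ i j, DifferentiableAt ℝ (fun y => F y i j) y

theorem SmoothMat.diffMatAt (hF : SmoothMat F s) (hy : s ∈ nhds y) : DiffMatAt F y :=
  fun i j => ((hF i j).contDiffAt hy).differentiableAt (by simp)

theorem matDeriv_add (hF : DiffMatAt F y) (hG : DiffMatAt G y) :
    matDeriv (fun y => F y + G y) y v = matDeriv F y v + matDeriv G y v := by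
  ext i j
  simp only [matDeriv, Matrix.of_apply, Matrix.add_apply]
  rw [fderiv_fun_add (hF i j) (hG i j)]
  rfl

theorem matDeriv_const (A : Matrix ι ι ℝ) : matDeriv (fun _ => A) y v = 0 := by
  ext i j
  simp [matDeriv]

theorem matDeriv_mul (hF : DiffMatAt F y) (hG : DiffMatAt G y) :
    matDeriv (fun y => F y * G y) y v = matDeriv F y v * G y + F y * matDeriv G y v := by
  ext i j
  simp only [matDeriv, Matrix.of_apply, Matrix.add_apply, Matrix.mul_apply]
  rw [fderiv_fun_sum fun k _ => (hF i k).fun_mul (hG k j), ← Finset.sum_add_distrib]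
  simp only [_root_.sum_apply]
  refine Finset.sum_congr rfl fun k _ => ?_
  rw [fderiv_fun_mul (hF i k) (hG k j)]
  simp only [_root_.add_apply, _root_.smul_apply, smul_eq_mul]
  ring

theorem fderiv_trace (hF : DiffMatAt F y) :
    fderiv ℝ (fun y => (F y).trace) y v = (matDeriv F y v).trace := by
  simp only [Matrix.trace, Matrix.diag]
  rw [fderiv_fun_sum fun k _ => hF k k]
  simp [matDeriv]

/-- Differentiate F⁻¹F = 1, which holds on the open set where the determinant is non-zero. -/
theorem matDeriv_inv (hF : SmoothMat F s) (hs : IsOpen s) (hy : y ∈ s) (h0 : (F y).det ≠ 0) :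
    DiffMatAt (fun y => (F y)⁻¹) y ∧
      matDeriv (fun y => (F y)⁻¹) y v = -((F y)⁻¹ * matDeriv F y v * (F y)⁻¹) := by
  have ho : IsOpen (s ∩ {y | (F y).det ≠ 0}) := by
    have := hF.det.continuousOn.isOpen_inter_preimage hs (isOpen_ne (x := (0 : ℝ)))
    exact this
  have hinv : SmoothMat (fun y => (F y)⁻¹) (s ∩ {y | (F y).det ≠ 0}) :=
    SmoothMat.inv (fun i j => (hF i j).mono Set.inter_subset_left) fun y hy => hy.2
  have hd := hinv.diffMatAt (ho.mem_nhds ⟨hy, h0⟩)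
  have hdF := hF.diffMatAt (hs.mem_nhds hy)
  refine ⟨hd, ?_⟩
  have h1 : matDeriv (fun y => (F y)⁻¹ * F y) y v = 0 := by
    ext i j
    simp only [matDeriv, Matrix.of_apply, Matrix.zero_apply]
    have : (fun y => ((F y)⁻¹ * F y) i j) =ᶠ[nhds y]
        fun _ => (1 : Matrix ι ι ℝ) i j := by
      filter_upwards [ho.mem_nhds ⟨hy, h0⟩] with w hw
      rw [nonsing_inv_mul _ (Ne.isUnit hw.2)]
    rw [this.fderiv_eq]
    simp
  rw [matDeriv_mul hd hdF] at h1
  have h2 := congrArg (· * (F y)⁻¹) h1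
  simp only [Matrix.add_mul, Matrix.mul_assoc, mul_nonsing_inv _ h0.isUnit, Matrix.mul_one,
    Matrix.zero_mul] at h2
  rw [eq_neg_of_add_eq_zero_left h2, Matrix.mul_assoc]

/-- Jacobi's formula for an affine family of matrices. -/
theorem fderiv_det {V : Matrix ι ι ℝ} (hd : DifferentiableAt ℝ (fun y => (F y).det) y)
    (hF : ∀ t : ℝ, F (y + t • v) = F y + t • V) (h0 : (F y).det ≠ 0) :
    fderiv ℝ (fun y => (F y).det) y v = (F y).det * ((F y)⁻¹ * V).trace := by
  set A := F y with hA
  have h1 : HasDerivAt (fun t : ℝ => (F (y + t • v)).det) (fderiv ℝ (fun y => (F y).det) y v) 0 := by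
    have hl : HasDerivAt (fun t : ℝ => y + t • v) v 0 := by
      have := ((hasDerivAt_id (0 : ℝ)).smul_const v).const_add y
      rw [one_smul] at this
      exact this
    have hd' : HasFDerivAt (fun y => (F y).det) (fderiv ℝ (fun y => (F y).det) y)
        (y + (0 : ℝ) • v) := by
      rw [zero_smul, add_zero]; exact hd.hasFDerivAt
    exact hd'.comp_hasDerivAt (0 : ℝ) hl
  have h2 : HasDerivAt (fun t : ℝ => (F (y + t • v)).det) (A.det * (A⁻¹ * V).trace) 0 := by
    -- The expansion det(1 + tN) = 1 + t tr N + t²(…) with a polynomial remainder, which has no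
    -- derivative at t = 0.
    have he : ∀ t : ℝ, (F (y + t • v)).det = A.det * (1 + (A⁻¹ * V).trace * t +
        (Matrix.det (1 + (X : ℝ[X]) • (A⁻¹ * V).map C)).divX.divX.eval t * t ^ 2) := by
      intro t
      rw [hF, ← det_one_add_smul, ← det_mul, Matrix.mul_add, Matrix.mul_one, Matrix.mul_smul,
        ← Matrix.mul_assoc, mul_nonsing_inv _ h0.isUnit, Matrix.one_mul]
    simp only [he]
    have hp := (Matrix.det (1 + (X : ℝ[X]) • (A⁻¹ * V).map C)).divX.divX.hasDerivAt (0 : ℝ)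
    convert! ((((hasDerivAt_id (0 : ℝ)).const_mul (A⁻¹ * V).trace).const_add 1).add
      (hp.mul (hasDerivAt_pow 2 (0 : ℝ)))).const_mul A.det using 1
    simp
  exact h1.unique h2

end MatrixCalculus

/-! ### Families of polynomials with smooth coefficients -/

section SmoothCoeffs

variable {E : Type*} [NormedAddCommGroup E] [NormedSpace ℝ E] {s : Set E}

/-- All coefficients of the polynomial are smooth functions of the parameter on `s`. -/
def SmoothCoeffs (P : E → ℝ[X]) (s : Set E) : Prop :=
  ∀ i, ContDiffOn ℝ ∞ (fun y => (P y).coeff i) s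

variable {P Q : E → ℝ[X]}

theorem SmoothCoeffs.const (r : ℝ[X]) : SmoothCoeffs (fun _ : E => r) s :=
  fun _ => contDiffOn_const

theorem SmoothCoeffs.of_C {a : E → ℝ} (ha : ContDiffOn ℝ ∞ a s) :
    SmoothCoeffs (fun y => C (a y)) s := by
  intro i
  rcases i with _ | i
  · simpa using ha
  · simpa [coeff_C] using contDiffOn_const

theorem SmoothCoeffs.sub (hP : SmoothCoeffs P s) (hQ : SmoothCoeffs Q s) :
    SmoothCoeffs (fun y => P y - Q y) s := fun i => by
  simpa using (hP i).sub (hQ i)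

theorem SmoothCoeffs.mul (hP : SmoothCoeffs P s) (hQ : SmoothCoeffs Q s) :
    SmoothCoeffs (fun y => P y * Q y) s := fun i => by
  simp only [coeff_mul]
  exact ContDiffOn.sum fun k _ => (hP k.1).mul (hQ k.2)

theorem SmoothCoeffs.sum {ι : Type*} (t : Finset ι) {P : ι → E → ℝ[X]}
    (hP : ∀ i ∈ t, SmoothCoeffs (P i) s) : SmoothCoeffs (fun y => ∑ i ∈ t, P i y) s := fun k => by
  simp only [finsetSum_coeff]
  exact ContDiffOn.sum fun i hi => hP i hi k

theorem SmoothCoeffs.prod {ι : Type*} (t : Finset ι) {P : ι → E → ℝ[X]}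
    (hP : ∀ i ∈ t, SmoothCoeffs (P i) s) : SmoothCoeffs (fun y => ∏ i ∈ t, P i y) s := by
  classical
  induction t using Finset.induction_on with
  | empty => simpa using SmoothCoeffs.const 1
  | insert a t ha ih =>
    simp only [Finset.prod_insert ha]
    exact (hP a (by simp)).mul (ih fun i hi => hP i (by simp [hi]))

theorem SmoothCoeffs.det {ι : Type*} [Fintype ι] [DecidableEq ι] {A : E → Matrix ι ι ℝ[X]}
    (hA : ∀ i j, SmoothCoeffs (fun y => A y i j) s) : SmoothCoeffs (fun y => (A y).det) s := by
  simp only [det_apply']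
  exact SmoothCoeffs.sum _ fun σ _ => (SmoothCoeffs.const _).mul
    (SmoothCoeffs.prod _ fun i _ => hA _ _)

theorem SmoothCoeffs.derivative (hP : SmoothCoeffs P s) :
    SmoothCoeffs (fun y => Polynomial.derivative (P y)) s := fun i => by
  simp only [coeff_derivative]
  exact (hP _).mul contDiffOn_const

end SmoothCoeffs

/-! ### The phase space and its functions -/

variable {n : ℕ} {x : Coord n}

theorem isOpen_jac (n : ℕ) : IsOpen (Jac n) := by
  have : Jac n = ⋂ i, {x : Coord n | x.2 i ≠ 0} := by ext; simp [Jac]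
  rw [this]
  exact isOpen_iInter_of_finite fun i => isOpen_ne_fun (by fun_prop) (by fun_prop)

theorem contDiff_diagSeq (i : ℕ) : ContDiff ℝ ∞ (fun y : Coord n => diagSeq y i) := by
  unfold diagSeq
  split_ifs <;> fun_prop

theorem contDiff_superSeq (i : ℕ) : ContDiff ℝ ∞ (fun y : Coord n => superSeq y i) := by
  unfold superSeq
  split_ifs <;> fun_prop

theorem jacMatrix_add_smul (x v : Coord n) (t : ℝ) :
    jacMatrix (x + t • v) = jacMatrix x + t • tangentMatrix v := by
  ext i j
  simp only [jacMatrix, tangentMatrix, Matrix.of_apply, Matrix.add_apply, Matrix.smul_apply,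
    Fin.ext_iff]
  split_ifs
  · omega
  · omega
  · simp
  · simp [diagSeq, show (i : ℕ) < n + 1 from i.2]
  · simp [superSeq, show (i : ℕ) < n by omega]
  · simp

theorem smoothMat_jacMatrix (s : Set (Coord n)) : SmoothMat jacMatrix s := by
  intro i j
  simp only [jacMatrix, Matrix.of_apply]
  split_ifs
  · exact contDiffOn_const
  · exact (contDiff_diagSeq _).contDiffOn
  · exact (contDiff_superSeq _).contDiffOn
  · exact contDiffOn_const

theorem matDeriv_jacMatrix (x v : Coord n) : matDeriv jacMatrix x v = tangentMatrix v := by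
  ext i j
  have hd := (smoothMat_jacMatrix (n := n) Set.univ).diffMatAt (y := x) Filter.univ_mem i j
  have h1 : HasDerivAt (fun t : ℝ => jacMatrix (x + t • v) i j)
      (fderiv ℝ (fun y => jacMatrix y i j) x v) 0 := by
    have hl : HasDerivAt (fun t : ℝ => x + t • v) v 0 := by
      have := ((hasDerivAt_id (0 : ℝ)).smul_const v).const_add x
      rw [one_smul] at this
      exact this
    have hd' : HasFDerivAt (fun y => jacMatrix y i j) (fderiv ℝ (fun y => jacMatrix y i j) x)
        (x + (0 : ℝ) • v) := by
      rw [zero_smul, add_zero]; exact hd.hasFDerivAt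
    exact hd'.comp_hasDerivAt (0 : ℝ) hl
  have h2 : HasDerivAt (fun t : ℝ => jacMatrix (x + t • v) i j) (tangentMatrix v i j) 0 := by
    simp only [jacMatrix_add_smul, Matrix.add_apply, Matrix.smul_apply, smul_eq_mul]
    simpa using ((hasDerivAt_id (0 : ℝ)).mul_const (tangentMatrix v i j)).const_add (jacMatrix x i j)
  exact h1.unique h2

theorem smoothMat_aeval_jacMatrix (f : ℝ[X]) (s : Set (Coord n)) :
    SmoothMat (fun y : Coord n => aeval (jacMatrix y) f) s := by
  induction f using Polynomial.induction_on' with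
  | add f g hf hg => simpa using hf.add hg
  | monomial k a =>
    simp only [aeval_monomial]
    exact (SmoothMat.const _).mul ((smoothMat_jacMatrix s).pow k)

theorem diffMatAt_aeval_jacMatrix (f : ℝ[X]) (x : Coord n) :
    DiffMatAt (fun y : Coord n => aeval (jacMatrix y) f) x :=
  (smoothMat_aeval_jacMatrix f Set.univ).diffMatAt Filter.univ_mem

/-- The derivative of `X ↦ f(X)` in the direction of a tangent vector. -/
def dAeval (x v : Coord n) (f : ℝ[X]) : Matrix (Fin (n + 1)) (Fin (n + 1)) ℝ :=
  matDeriv (fun y : Coord n => aeval (jacMatrix y) f) x v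

section dAeval

variable (x v : Coord n)

theorem dAeval_add (f g : ℝ[X]) : dAeval x v (f + g) = dAeval x v f + dAeval x v g := by
  simp only [dAeval, map_add]
  exact matDeriv_add (diffMatAt_aeval_jacMatrix f x) (diffMatAt_aeval_jacMatrix g x)

theorem dAeval_C (a : ℝ) : dAeval x v (C a) = 0 := by
  simp only [dAeval, aeval_C, matDeriv_const]

theorem dAeval_X : dAeval x v X = tangentMatrix v := by
  simp only [dAeval, aeval_X]
  exact matDeriv_jacMatrix x v

theorem dAeval_mul (f g : ℝ[X]) : dAeval x v (f * g) =
    dAeval x v f * aeval (jacMatrix x) g + aeval (jacMatrix x) f * dAeval x v g := by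
  simp only [dAeval, map_mul]
  exact matDeriv_mul (diffMatAt_aeval_jacMatrix f x) (diffMatAt_aeval_jacMatrix g x)

theorem dAeval_C_mul (a : ℝ) (f : ℝ[X]) : dAeval x v (C a * f) = a • dAeval x v f := by
  rw [dAeval_mul, dAeval_C, aeval_C, zero_mul, zero_add, ← Algebra.smul_def]

variable {x v}

/-- Along `Ẋ = X^{l+1} + [X, B]`, a polynomial in `X` moves by `X^{l+1} f'(X) + [f(X), B]`. -/
theorem dAeval_of_tangent {l : ℕ} {B : Matrix (Fin (n + 1)) (Fin (n + 1)) ℝ}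
    (hv : tangentMatrix v = jacMatrix x ^ (l + 1) + (jacMatrix x * B - B * jacMatrix x))
    (f : ℝ[X]) : dAeval x v f = aeval (jacMatrix x) (X ^ (l + 1) * derivative f)
      + (aeval (jacMatrix x) f * B - B * aeval (jacMatrix x) f) := by
  have hX : ∀ k : ℕ, dAeval x v (X ^ k) =
      aeval (jacMatrix x) (X ^ (l + 1) * derivative (X ^ k : ℝ[X]))
      + (aeval (jacMatrix x) (X ^ k : ℝ[X]) * B - B * aeval (jacMatrix x) (X ^ k : ℝ[X])) := by
    intro k
    induction k with
    | zero =>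
      rw [pow_zero, ← C_1, dAeval_C]; simp
    | succ k ih =>
      rw [pow_succ, dAeval_mul, ih, dAeval_X, hv, derivative_mul, derivative_X]
      simp only [map_mul, map_add, map_pow, aeval_X, mul_one]
      have hc : Commute (jacMatrix x ^ (l + 1)) (jacMatrix x ^ k) :=
        (Commute.refl (jacMatrix x)).pow_pow _ _
      have hc' := hc.eq
      simp only [mul_add, add_mul, mul_sub, sub_mul, ← mul_assoc, hc']
      abel
  induction f using Polynomial.induction_on' with
  | add f g hf hg =>
    simp only [dAeval_add, hf, hg, map_add, mul_add, add_mul]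
    abel
  | monomial k a =>
    rw [← C_mul_X_pow_eq_monomial, dAeval_C_mul, hX, derivative_C_mul]
    have : (X : ℝ[X]) ^ (l + 1) * (C a * derivative (X ^ k))
      = C a * (X ^ (l + 1) * derivative (X ^ k)) := by ring
    rw [this]
    simp only [map_mul (aeval (jacMatrix x)) (C a), aeval_C, ← Algebra.smul_def, smul_add, smul_sub,
      Matrix.smul_mul, Matrix.mul_smul]

/-- Under the trace dX can be moved cyclically past powers of X, so polynomials differentiate as in
the commutative case. The factor `g` absorbs the powers moved around during the induction. -/
theorem trace_mul_dAeval (g f : ℝ[X]) : (aeval (jacMatrix x) g * dAeval x v f).trace =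
    (aeval (jacMatrix x) (g * derivative f) * tangentMatrix v).trace := by
  have hX : ∀ (k : ℕ) (g : ℝ[X]), (aeval (jacMatrix x) g * dAeval x v (X ^ k)).trace =
      (aeval (jacMatrix x) (g * derivative (X ^ k)) * tangentMatrix v).trace := by
    intro k
    induction k with
    | zero =>
      intro g
      rw [pow_zero, ← C_1, dAeval_C]; simp
    | succ k ih =>
      intro g
      rw [pow_succ, dAeval_mul, dAeval_X, Matrix.mul_add, trace_add, ← Matrix.mul_assoc,
        aeval_X, Matrix.trace_mul_comm]
      have := ih (X * g)
      rw [map_mul, aeval_X, Matrix.mul_assoc] at this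
      rw [this, ← trace_add, ← Matrix.mul_assoc, ← Matrix.add_mul, ← map_mul, ← map_add,
        derivative_mul, derivative_X]
      congr 4
      ring
  induction f using Polynomial.induction_on' generalizing g with
  | add f₁ f₂ hf hg =>
    simp only [dAeval_add, trace_add, hf, hg, map_add, mul_add,
      Matrix.add_mul]
  | monomial k a =>
    rw [← C_mul_X_pow_eq_monomial, dAeval_C_mul, derivative_C_mul, Matrix.mul_smul, trace_smul, hX]
    have : g * (C a * derivative (X ^ k)) = C a * (g * derivative (X ^ k)) := by ring
    rw [this, map_mul (aeval (jacMatrix x)) (C a), aeval_C, ← Algebra.smul_def, Matrix.smul_mul,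
      trace_smul]

end dAeval

/-! ### Smoothness of `Y_l` -/

theorem contDiffOn_superSeq_inv (i : ℕ) :
    ContDiffOn ℝ ∞ (fun y : Coord n => (superSeq y i)⁻¹) (Jac n) :=
  (contDiff_superSeq i).contDiffOn.inv fun _ hy => superSeq_ne_zero hy i

theorem smoothCoeffs_rightPoly (i : ℕ) :
    SmoothCoeffs (fun y : Coord n => rightPoly y i) (Jac n) := by
  have hX (i : ℕ) : SmoothCoeffs (fun y : Coord n => X - C (diagSeq y i)) (Jac n) :=
    (SmoothCoeffs.const _).sub (.of_C (contDiff_diagSeq i).contDiffOn)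
  have key : ∀ i, SmoothCoeffs (fun y : Coord n => rightPoly y i) (Jac n) ∧
      SmoothCoeffs (fun y : Coord n => rightPoly y (i + 1)) (Jac n) := by
    intro i
    induction i with
    | zero => exact ⟨.const 1, (SmoothCoeffs.of_C (contDiffOn_superSeq_inv 0)).mul (hX 0)⟩
    | succ i ih =>
      exact ⟨ih.2, (SmoothCoeffs.of_C (contDiffOn_superSeq_inv (i + 1))).mul
        (((hX (i + 1)).mul ih.2).sub ih.1)⟩
  exact (key i).1

theorem smoothCoeffs_leftPoly (i : ℕ) :
    SmoothCoeffs (fun y : Coord n => leftPoly y i) (Jac n) := by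
  have hX (i : ℕ) : SmoothCoeffs (fun y : Coord n => X - C (diagSeq y i)) (Jac n) :=
    (SmoothCoeffs.const _).sub (.of_C (contDiff_diagSeq i).contDiffOn)
  have key : ∀ i, SmoothCoeffs (fun y : Coord n => leftPoly y i) (Jac n) ∧
      SmoothCoeffs (fun y : Coord n => leftPoly y (i + 1)) (Jac n) := by
    intro i
    induction i with
    | zero => exact ⟨.const 1, hX 0⟩
    | succ i ih =>
      exact ⟨ih.2, ((hX (i + 1)).mul ih.2).sub
        ((SmoothCoeffs.of_C (contDiff_superSeq i).contDiffOn).mul ih.1)⟩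
  exact (key i).1

theorem smoothMat_derivMatrix {m : ℕ} {p : Coord n → ℕ → ℝ[X]}
    (hs : ∀ i, SmoothCoeffs (fun y => p y i) (Jac n)) (hp : ∀ y ∈ Jac n, IsGraded (p y)) :
    SmoothMat (fun y => derivMatrix m (p y)) (Jac n) :=
  SmoothMat.mul (fun i j => (hs i).derivative j)
    (SmoothMat.inv (fun i j => hs i j) fun y hy => (hp y hy).det_coeffMatrix_ne_zero)

theorem SmoothMat.lowerPart {m : ℕ} {F : Coord n → Matrix (Fin m) (Fin m) ℝ}
    (hF : SmoothMat F (Jac n)) : SmoothMat (fun y => lowerPart (F y)) (Jac n) := fun i j => by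
  simp only [TodaJac.lowerPart, Matrix.of_apply]
  split_ifs
  · exact hF i j
  · exact contDiffOn_const

theorem SmoothMat.strictUpperPart {m : ℕ} {F : Coord n → Matrix (Fin m) (Fin m) ℝ}
    (hF : SmoothMat F (Jac n)) : SmoothMat (fun y => strictUpperPart (F y)) (Jac n) :=
    fun i j => by
  simp only [TodaJac.strictUpperPart, Matrix.of_apply]
  split_ifs
  · exact hF i j
  · exact contDiffOn_const

theorem natCast_mul_ham {β : ℕ} (hβ : 1 ≤ β) (x : Coord n) :
    (β : ℝ) * ham (β : ℤ) x = (jacMatrix x ^ β).trace := by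
  have : (β : ℝ) ≠ 0 := by positivity
  rw [ham, if_neg (by omega), zpow_natCast]
  push_cast
  field_simp

theorem smoothMat_masterRhs (l : ℕ) : SmoothMat (masterRhs (n := n) l) (Jac n) := by
  have hJ : SmoothMat (jacMatrix (n := n)) (Jac n) := smoothMat_jacMatrix _
  have hD : SmoothMat (dMat (n := n)) (Jac n) :=
    smoothMat_derivMatrix smoothCoeffs_rightPoly fun y hy => isGraded_rightPoly hy
  have hDt : SmoothMat (dTildeMat (n := n)) (Jac n) := fun i j =>
    smoothMat_derivMatrix smoothCoeffs_leftPoly (fun y _ => isGraded_leftPoly) j i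
  have hS : SmoothMat (powerSum (n := n) l) (Jac n) := by
    refine SmoothMat.sum _ fun β hβ => ?_
    simp only [natCast_mul_ham (Finset.mem_Icc.1 hβ).1]
    exact SmoothMat.smul (hJ.pow β).trace (hJ.pow _)
  have hB : SmoothMat (bMat (n := n) l) (Jac n) := by
    rw [show bMat (n := n) l = _ from funext fun x => bMat_eq l x]
    exact (((hJ.pow _).mul hDt).lowerPart.sub (hD.mul (hJ.pow _)).strictUpperPart).sub hS.lowerPart
  exact (hJ.pow _).add ((hJ.mul hB).sub (hB.mul hJ))

theorem contDiffOn_masterField (l : ℕ) : ContDiffOn ℝ ∞ (masterField (n := n) l) (Jac n) :=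
  ContDiffOn.prodMk (contDiffOn_pi.2 fun _ => smoothMat_masterRhs l _ _)
    (contDiffOn_pi.2 fun _ => smoothMat_masterRhs l _ _)

/-! ### The Hamiltonians along `Y_l` -/

theorem dAeval_masterField (hx : x ∈ Jac n) (l : ℕ) (f : ℝ[X]) :
    dAeval x (masterField l x) f = aeval (jacMatrix x) (X ^ (l + 1) * derivative f)
      + (aeval (jacMatrix x) f * bMat l x - bMat l x * aeval (jacMatrix x) f) :=
  dAeval_of_tangent (tangentMatrix_masterField hx l) f

theorem ham_of_ne_zero {j : ℤ} (hj : j ≠ 0) (x : Coord n) :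
    (j : ℝ) * ham j x = (jacMatrix x ^ j).trace := by
  have : (j : ℝ) ≠ 0 := by exact_mod_cast hj
  rw [ham, if_neg hj]
  field_simp

/-- One formula for all j. Its right-hand side is (l+j)H_{l+j}, or the trace of the identity when j
= -l. -/
theorem ham_masterField (hx : x ∈ Jac n) (l : ℕ) (j : ℤ)
    (hj : 0 < j ∨ (jacMatrix x).det ≠ 0) :
    DifferentiableAt ℝ (ham (n := n) j) x ∧
      lieDeriv (masterField l) (ham j) x = (jacMatrix x ^ ((l : ℤ) + j)).trace := by
  rcases lt_trichotomy j 0 with h | h | h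
  · obtain ⟨m, hm, rfl⟩ : ∃ m : ℕ, 0 < m ∧ j = -(m : ℤ) := ⟨j.natAbs, by omega, by omega⟩
    have hdet : (jacMatrix x).det ≠ 0 := hj.resolve_left (by omega)
    have hu : IsUnit (jacMatrix x).det := hdet.isUnit
    have hd : (aeval (jacMatrix x) (X ^ m : ℝ[X])).det ≠ 0 := by
      simpa using pow_ne_zero m hdet
    have hham : ham (n := n) (-(m : ℤ)) = fun y =>
        (-(m : ℝ))⁻¹ * ((aeval (jacMatrix y) (X ^ m : ℝ[X]))⁻¹).trace := by
      ext y
      rw [ham, if_neg (by omega), Matrix.zpow_neg_natCast]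
      simp
    obtain ⟨hdi, hinv⟩ := matDeriv_inv (v := masterField l x)
      (smoothMat_aeval_jacMatrix (X ^ m) Set.univ) isOpen_univ (Set.mem_univ x) hd
    have hdt : DifferentiableAt ℝ (fun y : Coord n => ((aeval (jacMatrix y) (X ^ m : ℝ[X]))⁻¹).trace)
        x := DifferentiableAt.fun_sum fun i _ => hdi i i
    refine ⟨hham ▸ hdt.const_mul _, ?_⟩
    rw [lieDeriv, hham, fderiv_const_mul hdt, _root_.smul_apply, fderiv_trace hdi, hinv]
    change _ • (-(_ * dAeval x (masterField l x) (X ^ m) * _)).trace = _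
    rw [dAeval_masterField hx l (X ^ m)]
    have hm' : (m : ℝ) ≠ 0 := by positivity
    set J := jacMatrix x with hJ
    have e1 : aeval J (X ^ m : ℝ[X]) = J ^ (m : ℤ) := by simp
    have e2 : (J ^ (m : ℤ))⁻¹ = J ^ (-(m : ℤ)) := (Matrix.zpow_neg hu _).symm
    have e3 : J ^ (m : ℤ) * J ^ (-(m : ℤ)) = 1 := by
      rw [← Matrix.zpow_add hu]; simp
    have e4 : J ^ (-(m : ℤ)) * J ^ (m : ℤ) = 1 := by
      rw [← Matrix.zpow_add hu]; simp
    have e5 : aeval J (X ^ (l + 1) * derivative (X ^ m : ℝ[X])) = (m : ℝ) • J ^ ((l : ℤ) + m) := by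
      rw [derivative_X_pow]
      simp only [map_mul, map_pow, aeval_X, aeval_C]
      rw [show ((l : ℤ) + m) = ((l + 1 + (m - 1) : ℕ) : ℤ) by omega, zpow_natCast,
        pow_add J (l + 1), Algebra.smul_def, ← mul_assoc, ← mul_assoc, Algebra.commutes]
    rw [e1, e2, e5]
    -- Multiplying [X^m, B] by X^{-m} on both sides gives [B, X^{-m}], again a commutator and so of
    -- trace zero.
    have e6 : J ^ (-(m : ℤ)) * ((m : ℝ) • J ^ ((l : ℤ) + m)
        + (J ^ (m : ℤ) * bMat l x - bMat l x * J ^ (m : ℤ))) * J ^ (-(m : ℤ)) =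
        (m : ℝ) • J ^ ((l : ℤ) + -m)
          + (bMat l x * J ^ (-(m : ℤ)) - J ^ (-(m : ℤ)) * bMat l x) := by
      have e7 : J ^ (-(m : ℤ)) * J ^ ((l : ℤ) + m) * J ^ (-(m : ℤ)) = J ^ ((l : ℤ) + -m) := by
        rw [← Matrix.zpow_add hu, ← Matrix.zpow_add hu]
        congr 1; ring
      rw [mul_add, add_mul, mul_sub, sub_mul, Matrix.mul_smul, Matrix.smul_mul, e7, ← mul_assoc, e4,
        one_mul, mul_assoc (J ^ (-(m : ℤ))), mul_assoc (bMat l x), e3, mul_one]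
    rw [e6, trace_neg, trace_add, trace_sub, trace_mul_comm (bMat l x), sub_self, add_zero,
      trace_smul]
    simp only [smul_eq_mul]
    field_simp
  · subst h
    have hdet : (jacMatrix x).det ≠ 0 := hj.resolve_left (by omega)
    have hham : ham (n := n) 0 = fun y => Real.log (jacMatrix y).det := by
      ext y; simp [ham]
    have hd : DifferentiableAt ℝ (fun y : Coord n => (jacMatrix y).det) x :=
      ((smoothMat_jacMatrix Set.univ).det.contDiffAt Filter.univ_mem).differentiableAt (by simp)
    refine ⟨hham ▸ hd.log hdet, ?_⟩
    rw [lieDeriv, hham, fderiv.log hd hdet, _root_.smul_apply,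
      fderiv_det hd (jacMatrix_add_smul x _) hdet, tangentMatrix_masterField hx]
    rw [smul_eq_mul, inv_mul_cancel_left₀ hdet, masterRhs, mul_add, mul_sub, trace_add, trace_sub,
      ← mul_assoc _ (bMat l x), trace_mul_comm (_ * bMat l x), ← mul_assoc, ← mul_assoc,
      mul_nonsing_inv _ hdet.isUnit, nonsing_inv_mul _ hdet.isUnit, sub_self, add_zero, pow_succ',
      ← mul_assoc, nonsing_inv_mul _ hdet.isUnit, one_mul, add_zero, zpow_natCast]
  · obtain ⟨m, rfl⟩ : ∃ m : ℕ, j = (m : ℤ) := ⟨j.natAbs, by omega⟩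
    have hm : (m : ℝ) ≠ 0 := by
      have : 0 < m := by omega
      positivity
    have hham : ham (n := n) (m : ℤ) = fun y =>
        (m : ℝ)⁻¹ * (aeval (jacMatrix y) (X ^ m : ℝ[X])).trace := by
      ext y
      rw [ham, if_neg (by omega)]
      simp
    have hda := diffMatAt_aeval_jacMatrix (X ^ m) x
    have hdt : DifferentiableAt ℝ (fun y : Coord n => (aeval (jacMatrix y) (X ^ m : ℝ[X])).trace)
        x := DifferentiableAt.fun_sum fun i _ => hda i i
    refine ⟨hham ▸ hdt.const_mul _, ?_⟩
    rw [lieDeriv, hham, fderiv_const_mul hdt, _root_.smul_apply, fderiv_trace hda]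
    change _ • (dAeval x (masterField l x) (X ^ m)).trace = _
    rw [dAeval_masterField hx l (X ^ m)]
    rw [trace_add, trace_sub, trace_mul_comm _ (bMat l x), sub_self, add_zero, derivative_X_pow]
    simp only [map_mul, map_pow, aeval_X, aeval_C]
    rw [show ((l : ℤ) + m) = ((l + 1 + (m - 1) : ℕ) : ℤ) by omega, zpow_natCast,
      pow_add _ (l + 1), ← mul_assoc, ← Algebra.commutes, mul_assoc, ← Algebra.smul_def, trace_smul]
    simp only [smul_eq_mul]
    field_simp

theorem lieDeriv_ham (hx : x ∈ Jac n) (l : ℕ) (j : ℤ)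
    (hj : 0 < j ∨ (jacMatrix x).det ≠ 0) :
    DifferentiableAt ℝ (ham (n := n) j) x ∧
      (j ≠ -(l : ℤ) →
        lieDeriv (masterField l) (ham j) x = ((l : ℝ) + (j : ℝ)) * ham ((l : ℤ) + j) x) ∧
      (j = -(l : ℤ) → lieDeriv (masterField l) (ham j) x = (n : ℝ) + 1) := by
  obtain ⟨h1, h2⟩ := ham_masterField hx l j hj
  refine ⟨h1, fun h => ?_, fun h => ?_⟩
  · rw [h2, ← ham_of_ne_zero (by omega)]
    push_cast; rfl
  · rw [h2, h]; simp

end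

section

/-! ### Functionals on polynomials that are determined by simple fractions -/

/-- A linear functional on `ℝ[X]` that kills the multiples of `p ^ 2` vanishes as soon as it kills
the inverses of `z - X` modulo `p ^ 2` for all but finitely many `z` with `p(z) ≠ 0`. -/
theorem linearMap_eq_zero_of_fractions {M : Type*} [AddCommGroup M] [Module ℝ M] {p : ℝ[X]}
    (hp : p.Monic) (T : Finset ℝ) (Λ : ℝ[X] →ₗ[ℝ] M) (h1 : ∀ h, Λ (p ^ 2 * h) = 0)
    (h2 : ∀ f z, z ∉ T → p.eval z ≠ 0 → p ^ 2 ∣ (C z - X) * f - 1 → Λ f = 0) (f : ℝ[X]) : Λ f = 0 := by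
  classical
  have hinf : {z : ℝ | z ∉ T ∧ p.eval z ≠ 0}.Infinite := by
    have : {z : ℝ | z ∉ T ∧ p.eval z ≠ 0} = (↑(T ∪ p.roots.toFinset) : Set ℝ)ᶜ := by
      ext z; simp [hp.ne_zero]
    rw [this]
    exact (Finset.finite_toSet _).infinite_compl
  -- Enough nodes for a remainder modulo p² to be determined by its values on `S`.
  obtain ⟨S, hS, hcard⟩ := hinf.exists_subset_card_eq ((p ^ 2).natDegree + 1)
  have hcop : ∀ z : ℝ, p.eval z ≠ 0 → IsCoprime (X - C z) (p ^ 2) := by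
    intro z hz
    refine ((irreducible_X_sub_C z).coprime_iff_not_dvd.2 ?_).pow_right
    rwa [dvd_iff_isRoot]
  have hex : ∀ z : ℝ, p.eval z ≠ 0 → ∃ g : ℝ[X], p ^ 2 ∣ (C z - X) * g - 1 := by
    intro z hz
    obtain ⟨a, b, hab⟩ := hcop z hz
    exact ⟨-a, -b, by linear_combination hab⟩
  choose! g hg using hex
  -- `W` is invertible modulo p². With r ≡ fW, the partial fractions of r/W write f as a combination
  -- of the inverses of z - X.
  set W := Lagrange.nodal S (id : ℝ → ℝ) with hW
  have hWcop : IsCoprime W (p ^ 2) := IsCoprime.prod_left fun z hz => hcop z (hS hz).2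
  set r := (f * W) %ₘ (p ^ 2) with hr
  have hp2 : (p ^ 2).Monic := hp.pow 2
  have hrdeg : r.degree < S.card := by
    refine (degree_modByMonic_lt _ hp2).trans_le ?_
    rw [degree_eq_natDegree hp2.ne_zero, hcard]
    exact_mod_cast Nat.le_succ _
  have hrint : r = ∑ z ∈ S, C (r.eval z) * Lagrange.basis S id z := by
    have := Lagrange.eq_interpolate (s := S) (v := id) (Function.injective_id.injOn) hrdeg
    rw [Lagrange.interpolate_apply] at this
    exact this
  -- The basis polynomial is the weight times W/(X - z), and `g z` is 1/(z - X) modulo p²; hence the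
  -- plus sign.
  have hbasis : ∀ z ∈ S, p ^ 2 ∣ Lagrange.basis S id z + C (Lagrange.nodalWeight S id z) * (W * g z) := by
    intro z hz
    rw [Lagrange.basis_eq_prod_sub_inv_mul_nodal_div hz, ← Lagrange.nodal_erase_eq_nodal_div hz, hW,
      Lagrange.nodal_eq_mul_nodal_erase hz]
    obtain ⟨h, hh⟩ := hg z (hS hz).2
    refine ⟨-(C (Lagrange.nodalWeight S id z) * Lagrange.nodal (S.erase z) id * h), ?_⟩
    simp only [id]
    linear_combination (-(C (Lagrange.nodalWeight S id z) * Lagrange.nodal (S.erase z) id)) * hh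
  have hdvd : p ^ 2 ∣ W * (f + ∑ z ∈ S, C (r.eval z * Lagrange.nodalWeight S id z) * g z) := by
    have e1 : p ^ 2 ∣ f * W - r := by
      refine ⟨(f * W) /ₘ (p ^ 2), ?_⟩
      rw [hr]
      linear_combination -(modByMonic_add_div (f * W) (p ^ 2))
    have e2 : p ^ 2 ∣ ∑ z ∈ S, C (r.eval z) *
        (Lagrange.basis S id z + C (Lagrange.nodalWeight S id z) * (W * g z)) :=
      Finset.dvd_sum fun z hz => (hbasis z hz).mul_left _
    have e3 := dvd_add e1 e2
    convert e3 using 1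
    simp only [mul_add, Finset.sum_add_distrib]
    rw [← hrint, Finset.mul_sum]
    have e4 : ∑ z ∈ S, W * (C (r.eval z * Lagrange.nodalWeight S id z) * g z) =
        ∑ z ∈ S, C (r.eval z) * (C (Lagrange.nodalWeight S id z) * (W * g z)) :=
      Finset.sum_congr rfl fun z _ => by rw [C_mul]; ring
    rw [e4]
    ring
  obtain ⟨h, hh⟩ := hWcop.symm.dvd_of_dvd_mul_left hdvd
  have := congrArg Λ hh
  rw [h1, map_add, map_sum, Finset.sum_eq_zero, add_zero] at this
  · exact this
  · intro z hz
    rw [← smul_eq_C_mul, map_smul, h2 _ z (hS hz).1 (hS hz).2 (hg z (hS hz).2), smul_zero]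

/-! ### Moments determine tangent vectors -/

variable {n : ℕ} {x : Coord n}

/-- Each factor X moves by at most one index, so row 0 of X^a ends at column a and column 0 of X^b
at row b. The extreme entries are products of super-diagonal entries, respectively of ones, hence
non-zero. -/
theorem pow_jacMatrix_zero_apply {a : ℕ} {i : Fin (n + 1)} (hi : a < i) :
    (jacMatrix x ^ a) 0 i = 0 := by
  induction a generalizing i with
  | zero =>
    rw [pow_zero, Matrix.one_apply_ne]
    exact (Fin.pos_iff_ne_zero.1 (Fin.lt_def.2 (by simpa using hi))).symm
  | succ a ih =>
    rw [pow_succ, Matrix.mul_apply]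
    refine Finset.sum_eq_zero fun k _ => ?_
    rcases lt_or_ge a k with h | h
    · rw [ih h, zero_mul]
    · rw [jacMatrix_apply, if_neg (by omega), if_neg (by omega), if_neg (by omega)]; simp

theorem pow_jacMatrix_zero_apply_ne_zero (hx : x ∈ Jac n) (a : Fin (n + 1)) :
    (jacMatrix x ^ (a : ℕ)) 0 a ≠ 0 := by
  obtain ⟨a, ha⟩ := a
  induction a with
  | zero => simp
  | succ a ih =>
    have ha' : a < n + 1 := by omega
    rw [pow_succ, Matrix.mul_apply, Finset.sum_eq_single ⟨a, ha'⟩]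
    · refine mul_ne_zero (ih ha') ?_
      rw [jacMatrix_apply]
      simpa [show a ≠ a + 1 + 1 by omega] using superSeq_ne_zero hx a
    · intro k _ hk
      have hk' : (k : ℕ) ≠ a := fun h => hk (Fin.ext h)
      rcases lt_or_ge a k with h | h
      · rw [pow_jacMatrix_zero_apply h, zero_mul]
      · rw [jacMatrix_apply]
        simp only
        rw [if_neg (by omega), if_neg (by omega), if_neg (by omega)]; simp
    · simp

theorem pow_jacMatrix_apply_zero {b : ℕ} {j : Fin (n + 1)} (hj : b < j) :
    (jacMatrix x ^ b) j 0 = 0 := by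
  induction b generalizing j with
  | zero =>
    rw [pow_zero, Matrix.one_apply_ne]
    exact (Fin.pos_iff_ne_zero.1 (Fin.lt_def.2 (by simpa using hj)))
  | succ b ih =>
    rw [pow_succ', Matrix.mul_apply]
    refine Finset.sum_eq_zero fun k _ => ?_
    rcases lt_or_ge b k with h | h
    · rw [ih h, mul_zero]
    · rw [jacMatrix_apply, if_neg (by omega), if_neg (by omega), if_neg (by omega)]; simp

theorem pow_jacMatrix_apply_zero_ne_zero (b : Fin (n + 1)) :
    (jacMatrix x ^ (b : ℕ)) b 0 ≠ 0 := by
  obtain ⟨b, hb⟩ := b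
  induction b with
  | zero => simp
  | succ b ih =>
    have hb' : b < n + 1 := by omega
    rw [pow_succ', Matrix.mul_apply, Finset.sum_eq_single ⟨b, hb'⟩]
    · refine mul_ne_zero ?_ (ih hb')
      rw [jacMatrix_apply]
      simp [show b ≠ b + 1 + 1 by omega]
    · intro k _ hk
      have hk' : (k : ℕ) ≠ b := fun h => hk (Fin.ext h)
      rcases lt_or_ge b k with h | h
      · rw [pow_jacMatrix_apply_zero h, mul_zero]
      · rw [jacMatrix_apply]
        simp only
        rw [if_neg (by omega), if_neg (by omega), if_neg (by omega)]; simp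
    · simp

theorem dAeval_X_pow (x v : Coord n) (m : ℕ) : dAeval x v (X ^ m) =
    ∑ a ∈ Finset.range m, jacMatrix x ^ a * tangentMatrix v * jacMatrix x ^ (m - 1 - a) := by
  induction m with
  | zero => rw [pow_zero, ← C_1, dAeval_C]; simp
  | succ m ih =>
    rw [pow_succ, dAeval_mul, ih, dAeval_X, Finset.sum_range_succ, Finset.sum_mul]
    congr 1
    · refine Finset.sum_congr rfl fun a ha => ?_
      have := Finset.mem_range.1 ha
      rw [aeval_X, Matrix.mul_assoc, ← pow_succ]
      congr 2; omega
    · simp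

/-- The system is triangular. The derivative of (X^{t+1})₀₀ involves only entries V_{ij} with i + j
≤ t, and on each antidiagonal i + j = t at most one position lies on the diagonal or super-diagonal.
Its coefficient is a product of two extreme entries of powers of X. -/
theorem eq_zero_of_dAeval_eq_zero (hx : x ∈ Jac n) {v : Coord n}
    (h : ∀ m : ℕ, dAeval x v (X ^ m) 0 0 = 0) : v = 0 := by
  have hband : ∀ i j : Fin (n + 1), i ≠ j → (j : ℕ) ≠ i + 1 → tangentMatrix v i j = 0 := by
    intro i j h1 h2
    simp [tangentMatrix, h1, h2]
  have key : ∀ t : ℕ, ∀ i j : Fin (n + 1), (i : ℕ) + j = t → tangentMatrix v i j = 0 := by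
    intro t
    induction t using Nat.strong_induction_on with
    | _ t ih =>
      intro i j hij
      by_cases hb : i ≠ j ∧ (j : ℕ) ≠ i + 1
      · exact hband i j hb.1 hb.2
      have hb' : (i : ℕ) = j ∨ (j : ℕ) = i + 1 := by
        by_contra hc
        push Not at hc
        exact hb ⟨fun h => hc.1 (congrArg _ h), hc.2⟩
      have ht := h (t + 1)
      rw [dAeval_X_pow, Matrix.sum_apply, Finset.sum_eq_single (i : ℕ)] at ht
      · rw [show t + 1 - 1 - (i : ℕ) = j by omega, Matrix.mul_apply,
          Finset.sum_eq_single j] at ht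
        · rw [Matrix.mul_apply, Finset.sum_eq_single i] at ht
          · simpa [pow_jacMatrix_zero_apply_ne_zero hx, pow_jacMatrix_apply_zero_ne_zero] using ht
          · intro k _ hk
            rcases lt_or_ge (i : ℕ) k with h' | h'
            · rw [pow_jacMatrix_zero_apply h', zero_mul]
            · rw [ih (k + j) (by omega) k j rfl, mul_zero]
          · simp
        · intro k _ hk
          rcases lt_or_ge (j : ℕ) k with h' | h'
          · rw [pow_jacMatrix_apply_zero h', mul_zero]
          · rw [Matrix.mul_apply, Finset.sum_eq_zero, zero_mul]
            intro k' _
            rcases lt_or_ge (i : ℕ) k' with h'' | h''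
            · rw [pow_jacMatrix_zero_apply h'', zero_mul]
            · rw [ih (k' + k) (by omega) k' k rfl, mul_zero]
        · simp
      · intro a ha hai
        have ha' := Finset.mem_range.1 ha
        rw [Matrix.mul_apply]
        refine Finset.sum_eq_zero fun k _ => ?_
        rcases lt_or_ge (t + 1 - 1 - a) k with h' | h'
        · rw [pow_jacMatrix_apply_zero h', mul_zero]
        · rw [Matrix.mul_apply, Finset.sum_eq_zero, zero_mul]
          intro k' _
          rcases lt_or_ge a k' with h'' | h''
          · rw [pow_jacMatrix_zero_apply h'', zero_mul]
          · rcases lt_or_ge ((k' : ℕ) + k) t with h3 | h3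
            · rw [ih _ h3 k' k rfl, mul_zero]
            · rw [hband k' k (fun h => by have := congrArg Fin.val h; omega) (by omega), mul_zero]
      · intro hi
        exact absurd (Finset.mem_range.2 (by omega)) hi
  refine Prod.ext (funext fun i => ?_) (funext fun i => ?_)
  · simpa [tangentMatrix, diagSeq, show (i : ℕ) ≤ n from Nat.lt_succ_iff.1 i.2] using key _ i i rfl
  · have := key _ i.castSucc i.succ rfl
    simpa [tangentMatrix, superSeq, Fin.ext_iff] using this

/-! ### The functions `σ(f) = (f(X) e₀, e₀)` -/

/-- `σ(f) = (f(X) e₀, e₀)`. -/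
def sigma (f : ℝ[X]) (x : Coord n) : ℝ := aeval (jacMatrix x) f 0 0

theorem fderiv_sigma (f : ℝ[X]) (x v : Coord n) : fderiv ℝ (sigma f) x v = dAeval x v f 0 0 := rfl

theorem contDiff_sigma (f : ℝ[X]) : ContDiff ℝ ∞ (sigma (n := n) f) :=
  contDiffOn_univ.1 (smoothMat_aeval_jacMatrix f Set.univ 0 0)

theorem differentiableAt_sigma (f : ℝ[X]) (x : Coord n) : DifferentiableAt ℝ (sigma f) x :=
  diffMatAt_aeval_jacMatrix f x 0 0

/-- `σ` at a point, as a linear functional of the polynomial. -/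
def sigmaLin (x : Coord n) : ℝ[X] →ₗ[ℝ] ℝ where
  toFun f := sigma f x
  map_add' f g := by simp [sigma]
  map_smul' c f := by simp [sigma]

@[simp] theorem sigmaLin_apply (f : ℝ[X]) (x : Coord n) : sigmaLin x f = sigma f x := rfl

/-- The differential of `σ(f)` at a point, as a linear function of `f`. -/
def dSigma (x : Coord n) : ℝ[X] →ₗ[ℝ] (Coord n →L[ℝ] ℝ) where
  toFun f := fderiv ℝ (sigma f) x
  map_add' f g := by
    refine ContinuousLinearMap.ext fun v => ?_
    simp only [_root_.add_apply, fderiv_sigma, dAeval_add, Matrix.add_apply]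
  map_smul' c f := by
    refine ContinuousLinearMap.ext fun v => ?_
    simp only [RingHom.id_apply, _root_.smul_apply, fderiv_sigma, smul_eq_C_mul, dAeval_C_mul,
      Matrix.smul_apply]

theorem dSigma_apply (f : ℝ[X]) (x v : Coord n) : dSigma x f v = dAeval x v f 0 0 := rfl

theorem dSigma_eq_fderiv (f : ℝ[X]) (x : Coord n) : dSigma x f = fderiv ℝ (sigma f) x := rfl

theorem dSigma_one (x : Coord n) : dSigma x 1 = 0 := by
  refine ContinuousLinearMap.ext fun v => ?_
  rw [dSigma_apply, ← C_1, dAeval_C]; rfl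

/-- A subspace of the dual of a finite-dimensional space with trivial common kernel is everything. -/
theorem submodule_dual_eq_top {E : Type*} [NormedAddCommGroup E] [NormedSpace ℝ E]
    [FiniteDimensional ℝ E] {S : Submodule ℝ (E →L[ℝ] ℝ)}
    (h : ∀ v : E, (∀ α ∈ S, α v = 0) → v = 0) : S = ⊤ := by
  by_contra hS
  obtain ⟨φ, hφ, hle⟩ := Submodule.exists_le_ker_of_lt_top S (lt_top_iff_ne_top.2 hS)
  let e : (E →ₗ[ℝ] ℝ) ≃ₗ[ℝ] (E →L[ℝ] ℝ) := LinearMap.toContinuousLinearMap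
  let ψ : Module.Dual ℝ (Module.Dual ℝ E) := φ.comp e.toLinearMap
  -- Reflexivity: the functional that kills `S` is evaluation at a vector `v`, which the hypothesis
  -- forces to be zero.
  obtain ⟨v, hv⟩ := (Module.evalEquiv ℝ E).surjective ψ
  have hval : ∀ α : E →L[ℝ] ℝ, φ α = α v := by
    intro α
    have := LinearMap.congr_fun hv (e.symm α)
    simp only [Module.evalEquiv_apply, Module.Dual.eval_apply] at this
    have h2 : ψ (e.symm α) = φ α := by
      change φ (e (e.symm α)) = _
      rw [LinearEquiv.apply_symm_apply]
    rw [← h2, ← this]; rfl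
  have hv0 : v = 0 := h v fun α hα => by rw [← hval]; exact hle hα
  apply hφ
  ext α
  rw [hval, hv0]; simp

theorem dSigma_surjective (hx : x ∈ Jac n) (α : Coord n →L[ℝ] ℝ) : ∃ f, dSigma x f = α := by
  have : LinearMap.range (dSigma x) = ⊤ := submodule_dual_eq_top fun v hv =>
    eq_zero_of_dAeval_eq_zero hx fun m => hv _ ⟨X ^ m, rfl⟩
  exact LinearMap.range_eq_top.1 this α

/-! ### Resolvents and simple fractions -/

/-- The resolvent `(z - X)⁻¹`. -/
def resolvent (z : ℝ) (x : Coord n) : Matrix (Fin (n + 1)) (Fin (n + 1)) ℝ :=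
  (z • (1 : Matrix (Fin (n + 1)) (Fin (n + 1)) ℝ) - jacMatrix x)⁻¹

theorem eval_charpoly_jacMatrix (z : ℝ) (x : Coord n) : (jacMatrix x).charpoly.eval z =
    (z • (1 : Matrix (Fin (n + 1)) (Fin (n + 1)) ℝ) - jacMatrix x).det := by
  rw [Matrix.eval_charpoly, smul_one_eq_diagonal, Matrix.scalar_apply]

theorem smoothMat_shift (z : ℝ) (s : Set (Coord n)) : SmoothMat (fun y : Coord n =>
    z • (1 : Matrix (Fin (n + 1)) (Fin (n + 1)) ℝ) - jacMatrix y) s :=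
  (SmoothMat.const _).sub (smoothMat_jacMatrix s)

theorem matDeriv_shift (z : ℝ) (x v : Coord n) : matDeriv (fun y : Coord n =>
    z • (1 : Matrix (Fin (n + 1)) (Fin (n + 1)) ℝ) - jacMatrix y) x v = -tangentMatrix v := by
  rw [← matDeriv_jacMatrix x v]
  ext i j
  simp only [matDeriv, Matrix.of_apply, Matrix.sub_apply, Matrix.neg_apply]
  rw [fderiv_const_sub]; rfl

theorem weyl_differentiableAt {z : ℝ} (hz : (jacMatrix x).charpoly.eval z ≠ 0) :
    DifferentiableAt ℝ (weyl (n := n) z) x :=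
  (matDeriv_inv (v := 0) (smoothMat_shift z Set.univ) isOpen_univ (Set.mem_univ x)
    (by rwa [← eval_charpoly_jacMatrix])).1 0 0

theorem fderiv_weyl {z : ℝ} (hz : (jacMatrix x).charpoly.eval z ≠ 0) (v : Coord n) :
    fderiv ℝ (weyl z) x v = (resolvent z x * tangentMatrix v * resolvent z x) 0 0 := by
  have := (matDeriv_inv (v := v) (smoothMat_shift z Set.univ) isOpen_univ (Set.mem_univ x)
    (by rwa [← eval_charpoly_jacMatrix])).2
  rw [matDeriv_shift, Matrix.mul_neg, Matrix.neg_mul, neg_neg] at this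
  exact congrFun (congrFun this 0) 0

theorem fderiv_eval_charpoly {z : ℝ} (hz : (jacMatrix x).charpoly.eval z ≠ 0) (v : Coord n) :
    fderiv ℝ (fun y => (jacMatrix y).charpoly.eval z) x v =
      -((jacMatrix x).charpoly.eval z * (resolvent z x * tangentMatrix v).trace) := by
  simp only [eval_charpoly_jacMatrix] at hz ⊢
  have hd := ((smoothMat_shift (n := n) z Set.univ).det.contDiffAt (x := x)
    Filter.univ_mem).differentiableAt (by simp)
  rw [fderiv_det (V := -tangentMatrix v) hd ?_ hz, Matrix.mul_neg, trace_neg, mul_neg, resolvent]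
  intro t
  rw [jacMatrix_add_smul, smul_neg]
  abel

/-- `f` is an inverse of `z - X` modulo the square of the characteristic polynomial. -/
def IsFraction (x : Coord n) (z : ℝ) (f : ℝ[X]) : Prop :=
  (jacMatrix x).charpoly ^ 2 ∣ (C z - X) * f - 1

theorem aeval_sq_charpoly_mul (x : Coord n) (h : ℝ[X]) :
    aeval (jacMatrix x) ((jacMatrix x).charpoly ^ 2 * h) = 0 := by
  rw [map_mul, map_pow, Matrix.aeval_self_charpoly, zero_pow two_ne_zero, zero_mul]

/-- After the Leibniz rule every term still has a factor p(X), zero by Cayley–Hamilton. One factor p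
would not suffice, which is why fractions are taken modulo p². -/
theorem dAeval_sq_charpoly_mul (x v : Coord n) (h : ℝ[X]) :
    dAeval x v ((jacMatrix x).charpoly ^ 2 * h) = 0 := by
  rw [pow_two, mul_assoc, dAeval_mul, map_mul, Matrix.aeval_self_charpoly, zero_mul, zero_mul,
    mul_zero, add_zero]

theorem IsFraction.mul_aeval {z : ℝ} {f : ℝ[X]} (hf : IsFraction x z f) :
    (z • (1 : Matrix (Fin (n + 1)) (Fin (n + 1)) ℝ) - jacMatrix x) * aeval (jacMatrix x) f = 1 := by
  obtain ⟨h, hh⟩ := hf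
  have := congrArg (aeval (jacMatrix x)) hh
  rw [aeval_sq_charpoly_mul, map_sub, map_mul, map_sub, aeval_C, aeval_X, map_one,
    Algebra.algebraMap_eq_smul_one] at this
  exact sub_eq_zero.1 this

theorem IsFraction.aeval_eq {z : ℝ} {f : ℝ[X]} (hf : IsFraction x z f) :
    aeval (jacMatrix x) f = resolvent z x :=
  (Matrix.inv_eq_right_inv hf.mul_aeval).symm

theorem IsFraction.eval_charpoly_ne_zero {z : ℝ} {f : ℝ[X]} (hf : IsFraction x z f) :
    (jacMatrix x).charpoly.eval z ≠ 0 := by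
  rw [eval_charpoly_jacMatrix]
  intro h0
  have := congrArg Matrix.det hf.mul_aeval
  rw [det_mul, h0, zero_mul, det_one] at this
  exact zero_ne_one this

theorem IsFraction.dAeval_eq {z : ℝ} {f : ℝ[X]} (hf : IsFraction x z f) (v : Coord n) :
    dAeval x v f = resolvent z x * tangentMatrix v * resolvent z x := by
  have hm := hf.mul_aeval
  have hi := hf.aeval_eq
  obtain ⟨h, hh⟩ := hf
  have hd := congrArg (dAeval x v) (eq_add_of_sub_eq hh)
  have hneg : dAeval x v (C z - X) = -tangentMatrix v := by
    have := dAeval_add x v (C z - X) X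
    rw [sub_add_cancel, dAeval_C, dAeval_X] at this
    exact (neg_eq_of_add_eq_zero_left this.symm).symm
  rw [dAeval_mul, hneg, dAeval_add, dAeval_sq_charpoly_mul, ← C_1, dAeval_C, add_zero, map_sub,
    aeval_C, aeval_X, Algebra.algebraMap_eq_smul_one, hi, Matrix.neg_mul] at hd
  rw [hi] at hm
  have hd' := congrArg (resolvent z x * ·) (neg_add_eq_zero.1 hd)
  simp only [← Matrix.mul_assoc] at hd'
  rw [mul_eq_one_comm.1 hm, Matrix.one_mul] at hd'
  exact hd'.symm

theorem IsFraction.sigma_eq {z : ℝ} {f : ℝ[X]} (hf : IsFraction x z f) : sigma f x = weyl z x := by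
  rw [sigma, hf.aeval_eq]; rfl

theorem IsFraction.dSigma_eq {z : ℝ} {f : ℝ[X]} (hf : IsFraction x z f) :
    dSigma x f = fderiv ℝ (weyl z) x := by
  refine ContinuousLinearMap.ext fun v => ?_
  rw [dSigma_apply, hf.dAeval_eq, fderiv_weyl hf.eval_charpoly_ne_zero]

theorem charpoly_jacMatrix_monic (x : Coord n) : (jacMatrix x).charpoly.Monic :=
  Matrix.charpoly_monic _

theorem dSigma_sq_charpoly_mul (x : Coord n) (h : ℝ[X]) :
    dSigma x ((jacMatrix x).charpoly ^ 2 * h) = 0 := by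
  refine ContinuousLinearMap.ext fun v => ?_
  rw [dSigma_apply, dAeval_sq_charpoly_mul]; rfl

/-- The differentials of the Weyl function separate tangent vectors. -/
theorem eq_zero_of_fderiv_weyl (hx : x ∈ Jac n) {v : Coord n}
    (h : ∀ z : ℝ, (jacMatrix x).charpoly.eval z ≠ 0 → fderiv ℝ (weyl z) x v = 0) : v = 0 := by
  refine eq_zero_of_dAeval_eq_zero hx fun m => ?_
  have := linearMap_eq_zero_of_fractions (charpoly_jacMatrix_monic x) ∅
    (((ContinuousLinearMap.coeLM ℝ).comp (dSigma x)).flip v)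
    (fun h => ?_) (fun f z _ hz hf => ?_) (X ^ m)
  · exact this
  · change dSigma x _ v = 0
    rw [dSigma_sq_charpoly_mul]; rfl
  · change dSigma x _ v = 0
    rw [IsFraction.dSigma_eq hf, h z hz]

theorem span_fderiv_weyl (hx : x ∈ Jac n) :
    Submodule.span ℝ {α | ∃ z : ℝ, (jacMatrix x).charpoly.eval z ≠ 0 ∧ α = fderiv ℝ (weyl z) x} = ⊤ :=
  submodule_dual_eq_top fun _ hv => eq_zero_of_fderiv_weyl hx fun z hz =>
    hv _ (Submodule.subset_span ⟨z, hz, rfl⟩)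

/-- The pullback formula fixes the form on pairs dM(z), dM(z') of a spanning set; the missing case z
= z' is zero by skew symmetry. -/
theorem isWeylBracket_unique {k : ℕ} {w w' : BiField n} (hw : IsWeylBracket n k w)
    (hw' : IsWeylBracket n k w') (hx : x ∈ Jac n) : w' x = w x := by
  have hself : ∀ (w : BiField n), IsWeylBracket n k w → ∀ α, w x α α = 0 := by
    intro w hw α
    have := hw.skew x hx α α
    linarith
  refine LinearMap.ext_on (span_fderiv_weyl hx) ?_
  rintro _ ⟨z, hz, rfl⟩
  refine LinearMap.ext_on (span_fderiv_weyl hx) ?_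
  rintro _ ⟨z', hz', rfl⟩
  by_cases h : z = z'
  · rw [h, hself w hw, hself w' hw']
  · exact (hw'.pullback x hx z z' h hz hz').trans (hw.pullback x hx z z' h hz hz').symm

end

section

variable {n : ℕ} {x : Coord n}

/-! ### The numerators `z^k q mod p` -/

/-- The numerator of `(z^k M(z))_-`, in the form `(X^k adj(z - X))₀₀`. -/
def weylRem (k : ℕ) (x : Coord n) : ℝ[X] :=
  (((jacMatrix x) ^ k).map C * (jacMatrix x).charmatrix.adjugate) 0 0

theorem charmatrix_mul_adjugate (A : Matrix (Fin (n + 1)) (Fin (n + 1)) ℝ) :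
    A.map C * A.charmatrix.adjugate =
      (X : ℝ[X]) • A.charmatrix.adjugate - A.charpoly • (1 : Matrix _ _ ℝ[X]) := by
  have h := Matrix.mul_adjugate A.charmatrix
  have hc : A.charmatrix = (X : ℝ[X]) • (1 : Matrix _ _ ℝ[X]) - A.map C := by
    ext i j
    by_cases hij : i = j
    · subst hij; simp
    · simp [hij]
  nth_rewrite 1 [hc] at h
  rw [Matrix.sub_mul, Matrix.smul_mul, Matrix.one_mul] at h
  rw [Matrix.charpoly, ← h, sub_sub_cancel]

/-- Comparing coefficients in A·adj(z - A) = z·adj(z - A) - p(z) gives a downward recursion. It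
starts with zeros above a crude degree bound and first meets a non-zero term at degree n, from the
leading coefficient of p. -/
theorem coeff_adjugate_charmatrix (A : Matrix (Fin (n + 1)) (Fin (n + 1)) ℝ) :
    (∀ t, n < t → ∀ i j, (A.charmatrix.adjugate i j).coeff t = 0) ∧
      ∀ i j, (A.charmatrix.adjugate i j).coeff n = (1 : Matrix (Fin (n + 1)) (Fin (n + 1)) ℝ) i j := by
  set B := A.charmatrix.adjugate with hB
  have hrec : ∀ t i j, (B i j).coeff t = ∑ k, A i k * (B k j).coeff (t + 1) +
      A.charpoly.coeff (t + 1) * (1 : Matrix (Fin (n + 1)) (Fin (n + 1)) ℝ) i j := by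
    intro t i j
    have h := congrArg (fun q => q.coeff (t + 1)) (congrFun (congrFun (charmatrix_mul_adjugate A) i) j)
    simp only [Matrix.mul_apply, Matrix.map_apply, finsetSum_coeff, coeff_C_mul, Matrix.sub_apply,
      Matrix.smul_apply, smul_eq_mul, coeff_sub, coeff_X_mul, ← hB] at h
    rw [h, Matrix.one_apply, Matrix.one_apply]
    split_ifs <;> simp
  have hmon : A.charpoly.Monic := Matrix.charpoly_monic A
  have hdeg : A.charpoly.natDegree = n + 1 := by simp [Matrix.charpoly_natDegree_eq_dim]
  have hcoeff : A.charpoly.coeff (n + 1) = 1 := by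
    have := hmon.coeff_natDegree
    rwa [hdeg] at this
  have hbound : ∃ T, ∀ t, T ≤ t → ∀ i j, (B i j).coeff t = 0 := by
    refine ⟨(∑ i, ∑ j, (B i j).natDegree) + 1, fun t ht i j => coeff_eq_zero_of_natDegree_lt ?_⟩
    have h1 : (B i j).natDegree ≤ ∑ j, (B i j).natDegree :=
      Finset.single_le_sum (f := fun j => (B i j).natDegree) (fun _ _ => Nat.zero_le _)
        (Finset.mem_univ j)
    have h2 : ∑ j, (B i j).natDegree ≤ ∑ i, ∑ j, (B i j).natDegree :=
      Finset.single_le_sum (f := fun i => ∑ j, (B i j).natDegree) (fun _ _ => Nat.zero_le _)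
        (Finset.mem_univ i)
    omega
  have hhigh : ∀ t, n < t → ∀ i j, (B i j).coeff t = 0 := by
    obtain ⟨T, hT⟩ := hbound
    have key : ∀ d t, n < t → T ≤ t + d → ∀ i j, (B i j).coeff t = 0 := by
      intro d
      induction d with
      | zero => exact fun t _ h => hT t h
      | succ d ih =>
        intro t ht h i j
        rw [hrec, coeff_eq_zero_of_natDegree_lt (by omega), zero_mul, add_zero]
        exact Finset.sum_eq_zero fun k _ => by
          rw [ih (t + 1) (by omega) (by omega), mul_zero]
    exact fun t ht => key T t ht (by omega)
  refine ⟨hhigh, fun i j => ?_⟩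
  rw [hrec, Finset.sum_eq_zero fun k _ => by rw [hhigh (n + 1) (by omega), mul_zero],
    zero_add, hcoeff, one_mul]

theorem weylRem_coeff_of_lt (k : ℕ) (x : Coord n) {t : ℕ} (ht : n < t) :
    (weylRem k x).coeff t = 0 := by
  rw [weylRem, Matrix.mul_apply, finsetSum_coeff]
  exact Finset.sum_eq_zero fun i _ => by
    rw [Matrix.map_apply, coeff_C_mul, (coeff_adjugate_charmatrix _).1 t ht, mul_zero]

theorem weylNum_eq_weylRem (x : Coord n) : weylNum x = weylRem 0 x := by
  rw [weylRem, pow_zero, Matrix.map_one C C_0 C_1, Matrix.one_mul, weylNum]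

theorem weylNum_coeff (x : Coord n) : (weylNum x).coeff n = 1 := by
  rw [weylNum, (coeff_adjugate_charmatrix _).2, Matrix.one_apply_eq]

theorem weylRem_succ (k : ℕ) (x : Coord n) : weylRem (k + 1) x =
    X * weylRem k x - (jacMatrix x).charpoly * C ((jacMatrix x ^ k) 0 0) := by
  rw [weylRem, pow_succ, Matrix.map_mul, Matrix.mul_assoc, charmatrix_mul_adjugate, Matrix.mul_sub,
    Matrix.mul_smul, Matrix.mul_smul, Matrix.mul_one]
  rfl

theorem natDegree_charpoly_jacMatrix (x : Coord n) : (jacMatrix x).charpoly.natDegree = n + 1 := by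
  simp [Matrix.charpoly_natDegree_eq_dim]

/-- Modulo p, multiplying adj(z - X) by z is multiplying it by X, so z^k q ≡ (X^k adj(z - X))₀₀. The
latter has degree at most n and is therefore the remainder. -/
theorem modByMonic_eq_weylRem (k : ℕ) (x : Coord n) :
    (X ^ k * weylNum x) %ₘ (jacMatrix x).charpoly = weylRem k x := by
  have hmon := charpoly_jacMatrix_monic x
  have hdvd : ∀ k, (jacMatrix x).charpoly ∣ X ^ k * weylNum x - weylRem k x := by
    intro k
    induction k with
    | zero => simp [weylNum_eq_weylRem]
    | succ k ih =>
      obtain ⟨c, hc⟩ := ih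
      refine ⟨X * c + C ((jacMatrix x ^ k) 0 0), ?_⟩
      rw [weylRem_succ, pow_succ]
      linear_combination X * hc
  have h1 := (modByMonic_eq_zero_iff_dvd hmon).2 (hdvd k)
  rw [sub_modByMonic, sub_eq_zero] at h1
  rw [h1, modByMonic_eq_self_iff hmon, degree_eq_natDegree hmon.ne_zero,
    natDegree_charpoly_jacMatrix, degree_lt_iff_coeff_zero]
  exact fun t ht => weylRem_coeff_of_lt k x (by omega)

theorem eval_weylRem (k : ℕ) {z : ℝ} (hz : (jacMatrix x).charpoly.eval z ≠ 0) :
    (weylRem k x).eval z =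
      (jacMatrix x).charpoly.eval z * (jacMatrix x ^ k * resolvent z x) 0 0 := by
  have hadj : (jacMatrix x).charmatrix.adjugate.map (evalRingHom z) =
      (jacMatrix x).charpoly.eval z • resolvent z x := by
    have h1 : (jacMatrix x).charmatrix.map (evalRingHom z) =
        z • (1 : Matrix (Fin (n + 1)) (Fin (n + 1)) ℝ) - jacMatrix x := by
      ext i j
      by_cases h : i = j
      · subst h; simp
      · simp [h]
    have h2 := (evalRingHom z).map_adjugate (jacMatrix x).charmatrix
    rw [RingHom.mapMatrix_apply, RingHom.mapMatrix_apply, h1] at h2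
    rw [h2, resolvent, Matrix.inv_def, ← eval_charpoly_jacMatrix, Ring.inverse_eq_inv', smul_smul,
      mul_inv_cancel₀ hz, one_smul]
  rw [weylRem, Matrix.mul_apply, eval_finsetSum, Matrix.mul_apply, Finset.mul_sum]
  refine Finset.sum_congr rfl fun i _ => ?_
  have := congrFun (congrFun hadj i) 0
  simp only [Matrix.map_apply, coe_evalRingHom, Matrix.smul_apply, smul_eq_mul] at this
  rw [eval_mul, this, Matrix.map_apply, eval_C]
  ring

theorem weylProper_eq (k : ℕ) {z : ℝ} (hz : (jacMatrix x).charpoly.eval z ≠ 0) :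
    weylProper k z x = (jacMatrix x ^ k * resolvent z x) 0 0 := by
  rw [weylProper, modByMonic_eq_weylRem, eval_weylRem k hz, mul_div_cancel_left₀ _ hz]

theorem eval_weylNum {z : ℝ} (hz : (jacMatrix x).charpoly.eval z ≠ 0) :
    (weylNum x).eval z = (jacMatrix x).charpoly.eval z * weyl z x := by
  rw [weylNum_eq_weylRem, eval_weylRem 0 hz, pow_zero, Matrix.one_mul]; rfl

theorem smoothCoeffs_charmatrix (s : Set (Coord n)) (i j : Fin (n + 1)) :
    SmoothCoeffs (fun y : Coord n => (jacMatrix y).charmatrix i j) s := by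
  simp only [charmatrix_apply]
  exact (SmoothCoeffs.const _).sub (.of_C (smoothMat_jacMatrix s i j))

theorem smoothCoeffs_charpoly (s : Set (Coord n)) :
    SmoothCoeffs (fun y : Coord n => (jacMatrix y).charpoly) s :=
  SmoothCoeffs.det (smoothCoeffs_charmatrix s)

theorem smoothCoeffs_weylRem (k : ℕ) (s : Set (Coord n)) :
    SmoothCoeffs (fun y : Coord n => weylRem k y) s := by
  simp only [weylRem, Matrix.mul_apply, Matrix.map_apply, adjugate_apply]
  refine SmoothCoeffs.sum _ fun i _ =>
    (SmoothCoeffs.of_C ((smoothMat_jacMatrix s).pow k 0 i)).mul (SmoothCoeffs.det fun a b => ?_)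
  simp only [Matrix.updateRow_apply]
  split_ifs
  · exact .const _
  · exact smoothCoeffs_charmatrix s a b

theorem smoothCoeffs_weylNum (s : Set (Coord n)) :
    SmoothCoeffs (fun y : Coord n => weylNum y) s := by
  simp only [weylNum_eq_weylRem]
  exact smoothCoeffs_weylRem 0 s

/-! ### Divided differences -/

/-- The coefficient of `z ^ i` in `(f(z) - f(z')) / (z - z')`, as a polynomial in `z'`. -/
def divDiff (f : ℝ[X]) (i : ℕ) : ℝ[X] := divX^[i + 1] f

theorem coeff_iterate_divX (f : ℝ[X]) (i j : ℕ) : (divX^[i] f).coeff j = f.coeff (j + i) := by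
  induction i generalizing j with
  | zero => rfl
  | succ i ih => rw [Function.iterate_succ_apply', coeff_divX, ih]; congr 1; ring

theorem coeff_divDiff (f : ℝ[X]) (i j : ℕ) : (divDiff f i).coeff j = f.coeff (j + (i + 1)) :=
  coeff_iterate_divX f (i + 1) j

theorem sub_mul_sum_divDiff {f : ℝ[X]} {N : ℕ} (hf : f.natDegree ≤ N) (z z' : ℝ) :
    (z - z') * ∑ i ∈ Finset.range N, z ^ i * (divDiff f i).eval z' = f.eval z - f.eval z' := by
  have step : ∀ i, (divX^[i] f).eval z' = z' * (divX^[i + 1] f).eval z' + f.coeff i := by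
    intro i
    conv_lhs => rw [← divX_mul_X_add (divX^[i] f)]
    rw [eval_add, eval_mul, eval_X, eval_C, ← Function.iterate_succ_apply' divX, coeff_iterate_divX,
      zero_add, mul_comm]
  have key : ∀ N, (z - z') * ∑ i ∈ Finset.range N, z ^ i * (divDiff f i).eval z' =
      z ^ N * (divX^[N] f).eval z' + (∑ i ∈ Finset.range N, f.coeff i * z ^ i) - f.eval z' := by
    intro N
    induction N with
    | zero => simp
    | succ N ih =>
      rw [Finset.sum_range_succ, mul_add, ih, Finset.sum_range_succ, step N, divDiff]
      ring
  have htop : (divX^[N] f) = C (f.coeff N) := by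
    ext j
    rw [coeff_iterate_divX, coeff_C]
    split_ifs with h
    · rw [h, zero_add]
    · exact coeff_eq_zero_of_natDegree_lt (by omega)
  rw [key, htop, eval_C, eval_eq_sum_range' (Nat.lt_succ_of_le hf) z, Finset.sum_range_succ]
  ring

/-! ### The coefficients of the bracket -/

/-- `{p(z), q(z')}_k` as a polynomial in `z'`, coefficient of `z ^ i`. -/
def brkPoly (k : ℕ) (x : Coord n) (i : ℕ) : ℝ[X] :=
  divDiff (jacMatrix x).charpoly i * weylRem k x - divDiff (weylRem k x) i * (jacMatrix x).charpoly
    - C ((weylRem k x).coeff i) * weylNum x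

/-- As q is monic of degree n, {p(z), q(z')} must have degree below n in z'. Splitting p and r =
`weylRem k x` at degree i, the products of the two high parts cancel. This leaves degree at most n,
and the coefficient of z'^n is r_i - r_i. -/
theorem brkPoly_coeff_eq_zero (k : ℕ) (x : Coord n) {i j : ℕ} (hi : i ≤ n) (hj : n ≤ j) :
    (brkPoly k x i).coeff j = 0 := by
  set p := (jacMatrix x).charpoly with hp
  set r := weylRem k x with hr
  have hpn : p.natDegree = n + 1 := natDegree_charpoly_jacMatrix x
  have hpm : p.Monic := charpoly_jacMatrix_monic x
  have hP : ∀ f : ℝ[X], ∃ g : ℝ[X], f = divDiff f i * X ^ (i + 1) + g ∧ g.natDegree ≤ i ∧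
      g.coeff i = f.coeff i := by
    intro f
    refine ⟨f - divDiff f i * X ^ (i + 1), by ring, ?_, ?_⟩
    · refine natDegree_le_iff_coeff_eq_zero.2 fun t ht => ?_
      obtain ⟨t, rfl⟩ : ∃ s, t = s + (i + 1) := ⟨t - (i + 1), by omega⟩
      rw [coeff_sub, coeff_mul_X_pow, coeff_divDiff, sub_self]
    · rw [coeff_sub, coeff_mul_X_pow', if_neg (by omega), sub_zero]
  obtain ⟨pl, hpl, hpl1, -⟩ := hP p
  obtain ⟨rl, hrl, hrl1, hrl2⟩ := hP r
  have hred : brkPoly k x i = divDiff p i * rl - divDiff r i * pl - C (r.coeff i) * weylNum x := by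
    rw [brkPoly, ← hp, ← hr]
    linear_combination divDiff p i * hrl - divDiff r i * hpl
  have hdp : (divDiff p i).natDegree ≤ n - i := natDegree_le_iff_coeff_eq_zero.2 fun t ht => by
    rw [coeff_divDiff]; exact coeff_eq_zero_of_natDegree_lt (by omega)
  have hdr : ∀ t, n ≤ t + i → (divDiff r i).coeff t = 0 := fun t ht => by
    rw [coeff_divDiff]; exact weylRem_coeff_of_lt k x (by omega)
  have hdr' : (divDiff r i).natDegree ≤ n - i := natDegree_le_iff_coeff_eq_zero.2 fun t ht =>
    hdr t (by omega)
  have hq : (weylNum x).natDegree ≤ n := natDegree_le_iff_coeff_eq_zero.2 fun t ht => by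
    rw [weylNum_eq_weylRem]; exact weylRem_coeff_of_lt 0 x ht
  rw [hred, coeff_sub, coeff_sub, coeff_C_mul]
  rcases hj.eq_or_lt with h | h
  · subst h
    have e1 : (divDiff p i * rl).coeff (n - i + i) = (divDiff p i).coeff (n - i) * rl.coeff i :=
      coeff_mul_add_eq_of_natDegree_le hdp hrl1
    have e2 : (divDiff r i * pl).coeff (n - i + i) = (divDiff r i).coeff (n - i) * pl.coeff i :=
      coeff_mul_add_eq_of_natDegree_le hdr' hpl1
    rw [Nat.sub_add_cancel hi] at e1 e2
    rw [e1, e2, hdr _ (by omega), weylNum_coeff, hrl2, coeff_divDiff,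
      show n - i + (i + 1) = p.natDegree by omega, hpm.coeff_natDegree]
    ring
  · have d1 := natDegree_mul_le_of_le hdp hrl1
    have d2 := natDegree_mul_le_of_le hdr' hpl1
    rw [coeff_eq_zero_of_natDegree_lt (p := divDiff p i * rl) (by omega),
      coeff_eq_zero_of_natDegree_lt (p := divDiff r i * pl) (by omega),
      coeff_eq_zero_of_natDegree_lt (p := weylNum x) (by omega)]
    ring

/-- `{p(z), q(z')}_k`. -/
def brkEval (k : ℕ) (x : Coord n) (z z' : ℝ) : ℝ :=
  ∑ i : Fin (n + 1), ∑ j : Fin n, (brkPoly k x i).coeff j * (z ^ (i : ℕ) * z' ^ (j : ℕ))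

/-- This is {p(z), q(z')} = (p(z)r(z') - r(z)p(z'))/(z - z') - r(z)q(z') with r = `weylRem k x`.
Stopping at j < n in `brkEval` loses nothing by the previous lemma. -/
theorem sub_mul_brkEval (k : ℕ) (x : Coord n) (z z' : ℝ) : (z - z') * brkEval k x z z' =
    (jacMatrix x).charpoly.eval z * (weylRem k x).eval z'
      - (weylRem k x).eval z * (jacMatrix x).charpoly.eval z'
      - (z - z') * ((weylRem k x).eval z * (weylNum x).eval z') := by
  have h1 : brkEval k x z z' = ∑ i ∈ Finset.range (n + 1), z ^ i * (brkPoly k x i).eval z' := by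
    rw [brkEval, Fin.sum_univ_eq_sum_range (fun i => ∑ j : Fin n,
      (brkPoly k x i).coeff j * (z ^ i * z' ^ (j : ℕ)))]
    refine Finset.sum_congr rfl fun i hi => ?_
    have hi' := Finset.mem_range.1 hi
    rw [eval_eq_sum_range' (n := n + (brkPoly k x i).natDegree + 1) (by omega), Finset.mul_sum,
      Fin.sum_univ_eq_sum_range (fun j => (brkPoly k x i).coeff j * (z ^ i * z' ^ j))]
    symm
    rw [show n + (brkPoly k x i).natDegree + 1 = n + ((brkPoly k x i).natDegree + 1) by ring,
      Finset.sum_range_add, add_eq_left.2]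
    · exact Finset.sum_congr rfl fun j _ => by ring
    · refine Finset.sum_eq_zero fun j _ => ?_
      rw [brkPoly_coeff_eq_zero k x (by omega) (by omega)]; ring
  have hr : (weylRem k x).natDegree ≤ n + 1 := natDegree_le_iff_coeff_eq_zero.2 fun t ht =>
    weylRem_coeff_of_lt k x (by omega)
  have hr' : (weylRem k x).natDegree < n + 1 := lt_of_le_of_lt
    (natDegree_le_iff_coeff_eq_zero.2 fun t ht => weylRem_coeff_of_lt k x ht) (Nat.lt_succ_self n)
  have h2 := sub_mul_sum_divDiff (natDegree_charpoly_jacMatrix x).le z z'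
  have h3 := sub_mul_sum_divDiff hr z z'
  have h4 := eval_eq_sum_range' hr' z
  have h5 : ∑ i ∈ Finset.range (n + 1), z ^ i * (brkPoly k x i).eval z' =
      (∑ i ∈ Finset.range (n + 1), z ^ i * (divDiff (jacMatrix x).charpoly i).eval z')
        * (weylRem k x).eval z'
      - (∑ i ∈ Finset.range (n + 1), z ^ i * (divDiff (weylRem k x) i).eval z')
        * (jacMatrix x).charpoly.eval z'
      - (∑ i ∈ Finset.range (n + 1), (weylRem k x).coeff i * z ^ i) * (weylNum x).eval z' := by
    simp only [Finset.sum_mul, ← Finset.sum_sub_distrib]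
    refine Finset.sum_congr rfl fun i _ => ?_
    simp only [brkPoly, eval_sub, eval_mul, eval_C]
    ring
  rw [h1, h5, ← h4]
  linear_combination (weylRem k x).eval z' * h2 - (jacMatrix x).charpoly.eval z' * h3

/-! ### Coordinates given by the Weyl function -/

/-- The coefficients of the characteristic polynomial and of the numerator of the Weyl function. -/
def weylCoord (x : Coord n) : Coord n :=
  (fun i => (jacMatrix x).charpoly.coeff i, fun j => (weylNum x).coeff j)

theorem contDiff_weylCoord : ContDiff ℝ ∞ (weylCoord (n := n)) :=
  ContDiff.prodMk
    (contDiff_pi.2 fun i => contDiffOn_univ.1 (smoothCoeffs_charpoly Set.univ i))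
    (contDiff_pi.2 fun j => contDiffOn_univ.1 (smoothCoeffs_weylNum Set.univ j))

theorem differentiableAt_charpoly_coeff (i : ℕ) (x : Coord n) :
    DifferentiableAt ℝ (fun y : Coord n => (jacMatrix y).charpoly.coeff i) x :=
  (contDiffOn_univ.1 (smoothCoeffs_charpoly Set.univ i)).differentiable (by simp) x

theorem differentiableAt_weylNum_coeff (i : ℕ) (x : Coord n) :
    DifferentiableAt ℝ (fun y : Coord n => (weylNum y).coeff i) x :=
  (contDiffOn_univ.1 (smoothCoeffs_weylNum Set.univ i)).differentiable (by simp) x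

theorem fderiv_weylCoord_apply (x v : Coord n) : fderiv ℝ weylCoord x v =
    (fun i : Fin (n + 1) => fderiv ℝ (fun y : Coord n => (jacMatrix y).charpoly.coeff i) x v,
      fun j : Fin n => fderiv ℝ (fun y : Coord n => (weylNum y).coeff j) x v) := by
  have h1 : DifferentiableAt ℝ (fun y : Coord n =>
      (fun i : Fin (n + 1) => (jacMatrix y).charpoly.coeff i)) x :=
    differentiableAt_pi.2 fun i => differentiableAt_charpoly_coeff i x
  have h2 : DifferentiableAt ℝ (fun y : Coord n => (fun j : Fin n => (weylNum y).coeff j)) x :=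
    differentiableAt_pi.2 fun i => differentiableAt_weylNum_coeff i x
  have h3 := h1.fderiv_prodMk h2
  rw [show (weylCoord : Coord n → Coord n) = fun y =>
    (fun i : Fin (n + 1) => (jacMatrix y).charpoly.coeff i, fun j : Fin n => (weylNum y).coeff j)
    from rfl, h3]
  refine Prod.ext (funext fun i => ?_) (funext fun j => ?_)
  · simp only [ContinuousLinearMap.prod_apply]
    rw [fderiv_pi fun i : Fin (n + 1) => differentiableAt_charpoly_coeff (i : ℕ) x]
    rfl
  · simp only [ContinuousLinearMap.prod_apply]
    rw [fderiv_pi fun j : Fin n => differentiableAt_weylNum_coeff (j : ℕ) x]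
    rfl

theorem fderiv_eval_charpoly_eq_sum (z : ℝ) (x v : Coord n) :
    fderiv ℝ (fun y => (jacMatrix y).charpoly.eval z) x v =
      ∑ i : Fin (n + 1), (fderiv ℝ weylCoord x v).1 i * z ^ (i : ℕ) := by
  have hc (y : Coord n) : (jacMatrix y).charpoly.coeff (n + 1) = 1 := by
    have := (charpoly_jacMatrix_monic y).coeff_natDegree
    rwa [natDegree_charpoly_jacMatrix] at this
  have h : (fun y : Coord n => (jacMatrix y).charpoly.eval z) = fun y =>
      (∑ i : Fin (n + 1), (jacMatrix y).charpoly.coeff i * z ^ (i : ℕ)) + z ^ (n + 1) := by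
    ext y
    rw [eval_eq_sum_range, natDegree_charpoly_jacMatrix, Finset.sum_range_succ,
      Fin.sum_univ_eq_sum_range (fun i => (jacMatrix y).charpoly.coeff i * z ^ i), hc, one_mul]
  rw [h, fderiv_add_const, fderiv_fun_sum fun (i : Fin (n + 1)) _ =>
    (differentiableAt_charpoly_coeff (i : ℕ) x).mul_const _, fderiv_weylCoord_apply]
  simp only [_root_.sum_apply]
  refine Finset.sum_congr rfl fun i _ => ?_
  rw [fderiv_mul_const (differentiableAt_charpoly_coeff i x), _root_.smul_apply, smul_eq_mul,
    mul_comm]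

theorem eval_weylNum_eq_sum (z : ℝ) (y : Coord n) : (weylNum y).eval z =
      (∑ i : Fin n, (weylNum y).coeff i * z ^ (i : ℕ)) + z ^ n := by
  rw [eval_eq_sum_range' (n := n + 1), Finset.sum_range_succ,
    Fin.sum_univ_eq_sum_range (fun i => (weylNum y).coeff i * z ^ i), weylNum_coeff, one_mul]
  refine Nat.lt_succ_of_le (natDegree_le_iff_coeff_eq_zero.2 fun t ht => ?_)
  rw [weylNum_eq_weylRem]; exact weylRem_coeff_of_lt 0 y ht

theorem fderiv_eval_weylNum_eq_sum (z : ℝ) (x v : Coord n) :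
    fderiv ℝ (fun y => (weylNum y).eval z) x v =
      ∑ j : Fin n, (fderiv ℝ weylCoord x v).2 j * z ^ (j : ℕ) := by
  simp only [eval_weylNum_eq_sum]
  rw [fderiv_add_const, fderiv_fun_sum fun (i : Fin n) _ =>
    (differentiableAt_weylNum_coeff (i : ℕ) x).mul_const _, fderiv_weylCoord_apply]
  simp only [_root_.sum_apply]
  refine Finset.sum_congr rfl fun i _ => ?_
  rw [fderiv_mul_const (differentiableAt_weylNum_coeff i x), _root_.smul_apply, smul_eq_mul,
    mul_comm]

theorem differentiableAt_eval_charpoly (z : ℝ) (x : Coord n) :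
    DifferentiableAt ℝ (fun y : Coord n => (jacMatrix y).charpoly.eval z) x := by
  simp only [eval_charpoly_jacMatrix]
  exact ((smoothMat_shift z Set.univ).det.contDiffAt Filter.univ_mem).differentiableAt (by simp)

theorem eventually_eval_charpoly_ne_zero {z : ℝ} (hz : (jacMatrix x).charpoly.eval z ≠ 0) :
    ∀ᶠ y in nhds x, (jacMatrix y).charpoly.eval z ≠ 0 :=
  (differentiableAt_eval_charpoly z x).continuousAt.eventually_ne hz

/-- The differential of `M(z) = q(z) / p(z)`. -/
theorem fderiv_weyl_eq {z : ℝ} (hz : (jacMatrix x).charpoly.eval z ≠ 0) (v : Coord n) :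
    (jacMatrix x).charpoly.eval z * fderiv ℝ (weyl z) x v =
      fderiv ℝ (fun y => (weylNum y).eval z) x v -
        weyl z x * fderiv ℝ (fun y => (jacMatrix y).charpoly.eval z) x v := by
  have h : (fun y : Coord n => (weylNum y).eval z) =ᶠ[nhds x]
      fun y => (jacMatrix y).charpoly.eval z * weyl z y := by
    filter_upwards [eventually_eval_charpoly_ne_zero hz] with y hy
    exact eval_weylNum hy
  rw [h.fderiv_eq, fderiv_fun_mul (differentiableAt_eval_charpoly z x) (weyl_differentiableAt hz)]
  simp only [_root_.add_apply, _root_.smul_apply, smul_eq_mul]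
  ring

/-- A vector killed by dp and dq is killed by every dM(z) = (dq(z) - M(z) dp(z))/p(z), hence zero.
-/
theorem isInvertible_fderiv_weylCoord (hx : x ∈ Jac n) :
    (fderiv ℝ (weylCoord (n := n)) x).IsInvertible := by
  have hinj : Function.Injective (fderiv ℝ (weylCoord (n := n)) x : Coord n →ₗ[ℝ] Coord n) := by
    rw [← LinearMap.ker_eq_bot, LinearMap.ker_eq_bot']
    intro v hv
    have hv' : fderiv ℝ weylCoord x v = 0 := hv
    refine eq_zero_of_fderiv_weyl hx fun z hz => ?_
    have := fderiv_weyl_eq hz v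
    rw [fderiv_eval_weylNum_eq_sum, fderiv_eval_charpoly_eq_sum, hv'] at this
    simpa [hz] using this
  exact ⟨(LinearEquiv.ofInjectiveEndo _ hinj).toContinuousLinearEquiv, by ext1 <;> rfl⟩

/-- The vector field dual to the coordinate differentials of `weylCoord`. -/
def dualField (e : Coord n) (x : Coord n) : Coord n := (fderiv ℝ weylCoord x).inverse e

theorem fderiv_weylCoord_dualField (hx : x ∈ Jac n) (e : Coord n) :
    fderiv ℝ weylCoord x (dualField e x) = e :=
  (isInvertible_fderiv_weylCoord hx).self_apply_inverse e

theorem contDiffOn_dualField (e : Coord n) : ContDiffOn ℝ ∞ (dualField e) (Jac n) := by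
  intro y hy
  have h1 : ContDiffAt ℝ ∞ (fun y : Coord n => fderiv ℝ weylCoord y) y :=
    (contDiff_weylCoord.fderiv_right (m := ∞) (by simp)).contDiffAt
  have h2 := (isInvertible_fderiv_weylCoord hy).contDiffAt_map_inverse (n := ∞)
  exact ((h2.comp y h1).clm_apply contDiffAt_const).contDiffWithinAt

/-- The fields dual to the coefficients of `p`. -/
def chartP (i : Fin (n + 1)) : Coord n → Coord n := dualField (Pi.single i 1, 0)

/-- The fields dual to the coefficients of `q`. -/
def chartQ (j : Fin n) : Coord n → Coord n := dualField (0, Pi.single j 1)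

section Pairings

variable (hx : x ∈ Jac n) (z : ℝ)
include hx

theorem fderiv_eval_charpoly_chartP (i : Fin (n + 1)) :
    fderiv ℝ (fun y => (jacMatrix y).charpoly.eval z) x (chartP i x) = z ^ (i : ℕ) := by
  rw [fderiv_eval_charpoly_eq_sum, chartP, fderiv_weylCoord_dualField hx]
  simp [Pi.single_apply]

theorem fderiv_eval_charpoly_chartQ (j : Fin n) :
    fderiv ℝ (fun y => (jacMatrix y).charpoly.eval z) x (chartQ j x) = 0 := by
  rw [fderiv_eval_charpoly_eq_sum, chartQ, fderiv_weylCoord_dualField hx]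
  simp

theorem fderiv_weyl_chartP {z : ℝ} (hz : (jacMatrix x).charpoly.eval z ≠ 0) (i : Fin (n + 1)) :
    fderiv ℝ (weyl z) x (chartP i x) =
      -(weyl z x / (jacMatrix x).charpoly.eval z) * z ^ (i : ℕ) := by
  have := fderiv_weyl_eq hz (chartP i x)
  rw [fderiv_eval_charpoly_chartP hx, fderiv_eval_weylNum_eq_sum, chartP,
    fderiv_weylCoord_dualField hx] at this
  simp only [Pi.zero_apply, zero_mul, Finset.sum_const_zero, zero_sub] at this
  rw [chartP]
  field_simp
  linear_combination this

theorem fderiv_weyl_chartQ {z : ℝ} (hz : (jacMatrix x).charpoly.eval z ≠ 0) (j : Fin n) :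
    fderiv ℝ (weyl z) x (chartQ j x) = ((jacMatrix x).charpoly.eval z)⁻¹ * z ^ (j : ℕ) := by
  have := fderiv_weyl_eq hz (chartQ j x)
  rw [fderiv_eval_charpoly_chartQ hx, fderiv_eval_weylNum_eq_sum, chartQ,
    fderiv_weylCoord_dualField hx] at this
  simp only [Pi.single_apply, ite_mul, one_mul, zero_mul, Finset.sum_ite_eq', Finset.mem_univ,
    if_true, mul_zero, sub_zero] at this
  rw [chartQ]
  field_simp
  linear_combination this

end Pairings

/-! ### The brackets -/

/-- The `k`-th bracket on `Jac`. -/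
def weylBracket (n k : ℕ) : BiField n := fun x =>
  LinearMap.mk₂ ℝ (fun α β => ∑ i : Fin (n + 1), ∑ j : Fin n, (brkPoly k x i).coeff j *
      (α (chartP i x) * β (chartQ j x) - β (chartP i x) * α (chartQ j x)))
    (fun α α' β => by
      simp only [_root_.add_apply, ← Finset.sum_add_distrib]
      exact Finset.sum_congr rfl fun i _ => Finset.sum_congr rfl fun j _ => by ring)
    (fun c α β => by
      simp only [_root_.smul_apply, smul_eq_mul, Finset.mul_sum]
      exact Finset.sum_congr rfl fun i _ => Finset.sum_congr rfl fun j _ => by ring)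
    (fun α β β' => by
      simp only [_root_.add_apply, ← Finset.sum_add_distrib]
      exact Finset.sum_congr rfl fun i _ => Finset.sum_congr rfl fun j _ => by ring)
    (fun c α β => by
      simp only [_root_.smul_apply, smul_eq_mul, Finset.mul_sum]
      exact Finset.sum_congr rfl fun i _ => Finset.sum_congr rfl fun j _ => by ring)

theorem weylBracket_apply (k : ℕ) (x : Coord n) (α β : Coord n →L[ℝ] ℝ) :
    weylBracket n k x α β = ∑ i : Fin (n + 1), ∑ j : Fin n, (brkPoly k x i).coeff j *
      (α (chartP i x) * β (chartQ j x) - β (chartP i x) * α (chartQ j x)) := rfl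

theorem weylBracket_skew (k : ℕ) (x : Coord n) (α β : Coord n →L[ℝ] ℝ) :
    weylBracket n k x α β = -weylBracket n k x β α := by
  simp only [weylBracket_apply, ← Finset.sum_neg_distrib]
  exact Finset.sum_congr rfl fun i _ => Finset.sum_congr rfl fun j _ => by ring

theorem contDiffOn_brkPoly_coeff (k i j : ℕ) :
    ContDiffOn ℝ ∞ (fun y : Coord n => (brkPoly k y i).coeff j) (Jac n) := by
  have hd : ∀ P : Coord n → ℝ[X], SmoothCoeffs P (Jac n) →
      SmoothCoeffs (fun y => divDiff (P y) i) (Jac n) := fun P hP j => by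
    simp only [coeff_divDiff]; exact hP _
  have hp := smoothCoeffs_charpoly (Jac n)
  have hr := smoothCoeffs_weylRem k (Jac n)
  exact (((hd _ hp).mul hr).sub ((hd _ hr).mul hp)).sub
    ((SmoothCoeffs.of_C (hr i)).mul (smoothCoeffs_weylNum _)) j

/-- Expand dM = (dq - M dp)/p on both sides; only the p–q pairings survive. -/
theorem weylBracket_weyl (k : ℕ) (hx : x ∈ Jac n) {z z' : ℝ}
    (hz : (jacMatrix x).charpoly.eval z ≠ 0) (hz' : (jacMatrix x).charpoly.eval z' ≠ 0) :
    weylBracket n k x (fderiv ℝ (weyl z) x) (fderiv ℝ (weyl z') x) =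
      (weyl z' x * brkEval k x z' z - weyl z x * brkEval k x z z') /
        ((jacMatrix x).charpoly.eval z * (jacMatrix x).charpoly.eval z') := by
  rw [weylBracket_apply, brkEval, brkEval]
  simp only [fderiv_weyl_chartP hx hz, fderiv_weyl_chartP hx hz', fderiv_weyl_chartQ hx hz,
    fderiv_weyl_chartQ hx hz', Finset.mul_sum, ← Finset.sum_sub_distrib, Finset.sum_div]
  refine Finset.sum_congr rfl fun i _ => Finset.sum_congr rfl fun j _ => ?_
  field_simp
  ring

theorem weylBracket_charpoly_weyl (k : ℕ) (hx : x ∈ Jac n) (z : ℝ) {z' : ℝ}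
    (hz' : (jacMatrix x).charpoly.eval z' ≠ 0) :
    weylBracket n k x (fderiv ℝ (fun y => (jacMatrix y).charpoly.eval z) x)
      (fderiv ℝ (weyl z') x) = brkEval k x z z' / (jacMatrix x).charpoly.eval z' := by
  rw [weylBracket_apply, brkEval]
  simp only [fderiv_eval_charpoly_chartP hx, fderiv_eval_charpoly_chartQ hx,
    fderiv_weyl_chartQ hx hz', Finset.sum_div]
  refine Finset.sum_congr rfl fun i _ => Finset.sum_congr rfl fun j _ => ?_
  field_simp
  ring

theorem isWeylBracket_weylBracket (n k : ℕ) : IsWeylBracket n k (weylBracket n k) where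
  smooth α β := by
    simp only [weylBracket_apply]
    have h (α : Coord n →L[ℝ] ℝ) (e : Coord n) :
        ContDiffOn ℝ ∞ (fun y => α (dualField e y)) (Jac n) :=
      α.contDiff.comp_contDiffOn (contDiffOn_dualField e)
    exact ContDiffOn.sum fun i _ => ContDiffOn.sum fun j _ => (contDiffOn_brkPoly_coeff k i j).mul
      (((h α _).mul (h β _)).sub ((h β _).mul (h α _)))
  skew x _ α β := weylBracket_skew k x α β
  pullback x hx z z' hzz hz hz' := by
    have h0 : z - z' ≠ 0 := sub_ne_zero.2 hzz
    rw [brk, weylBracket_weyl k hx hz hz', weylProper, weylProper, modByMonic_eq_weylRem]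
    have h1 := sub_mul_brkEval k x z z'
    have h2 := sub_mul_brkEval k x z' z
    rw [eval_weylNum hz'] at h1
    rw [eval_weylNum hz] at h2
    field_simp
    linear_combination (-weyl z x) * h1 - weyl z' x * h2

end

section

/-! ### Polynomials in two variables

Elements of `ℝ[X][X]` are polynomials in `x` (the inner variable, `C f` is `f(x)`) and `y` (the
outer variable, `f.map C` is `f(y)`). -/

section TwoVariables

theorem induction_two {P : ℝ[X][X] → Prop} (hadd : ∀ Φ Ψ, P Φ → P Ψ → P (Φ + Ψ))
    (hmul : ∀ f g : ℝ[X], P (C f * g.map C)) (Φ : ℝ[X][X]) : P Φ := by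
  induction Φ using Polynomial.induction_on' with
  | add Φ Ψ h1 h2 => exact hadd Φ Ψ h1 h2
  | monomial j a =>
    have := hmul a (X ^ j)
    rwa [Polynomial.map_pow, map_X, C_mul_X_pow_eq_monomial] at this

/-- The ring is a domain, so identities between divided differences can be checked after
multiplication by x - y. -/
theorem C_X_sub_X_ne_zero : (C X - X : ℝ[X][X]) ≠ 0 := by
  intro h
  have := congrArg (fun q => q.coeff 1) h
  simp at this

/-- The divided difference `(f(x) - f(y)) / (x - y)`. -/
def divDiffTwo : ℝ[X] →ₗ[ℝ] ℝ[X][X] :=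
  Polynomial.lsum fun m => (LinearMap.toSpanSingleton ℝ ℝ[X][X]
    (∑ i ∈ Finset.range m, (C X : ℝ[X][X]) ^ i * X ^ (m - 1 - i)))

theorem mul_divDiffTwo (f : ℝ[X]) : (C X - X) * divDiffTwo f = C f - f.map C := by
  induction f using Polynomial.induction_on' with
  | add f g hf hg =>
    rw [map_add, mul_add, hf, hg, C_add, Polynomial.map_add]; ring
  | monomial m c =>
    have h1 : divDiffTwo (monomial m c) =
        C (C c) * ∑ i ∈ Finset.range m, (C X : ℝ[X][X]) ^ i * X ^ (m - 1 - i) := by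
      rw [divDiffTwo, Polynomial.lsum_apply, sum_monomial_index]
      · rw [LinearMap.toSpanSingleton_apply, Algebra.smul_def]; rfl
      · simp
    have h2 := (Commute.all (C X : ℝ[X][X]) X).mul_geom_sum₂ m
    rw [h1, ← C_mul_X_pow_eq_monomial, Polynomial.map_mul, Polynomial.map_pow, map_C, map_X, C_mul,
      C_pow]
    linear_combination (C (C c)) * h2

theorem divDiffTwo_mul (f g : ℝ[X]) :
    divDiffTwo (f * g) = divDiffTwo f * g.map C + C f * divDiffTwo g := by
  refine mul_left_cancel₀ C_X_sub_X_ne_zero ?_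
  rw [mul_divDiffTwo, C_mul, Polynomial.map_mul]
  linear_combination (-(g.map C)) * mul_divDiffTwo f - C f * mul_divDiffTwo g

theorem divDiffTwo_C (c : ℝ) : divDiffTwo (C c) = 0 := by
  refine mul_left_cancel₀ C_X_sub_X_ne_zero ?_
  rw [mul_divDiffTwo, map_C, sub_self, mul_zero]

theorem divDiffTwo_X : divDiffTwo X = 1 := by
  refine mul_left_cancel₀ C_X_sub_X_ne_zero ?_
  rw [mul_divDiffTwo, map_X, mul_one]

/-- The kernel `(f(y) g(x) - f(x) g(y)) / (x - y)`. -/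
def kern (f g : ℝ[X]) : ℝ[X][X] := f.map C * divDiffTwo g - g.map C * divDiffTwo f

theorem mul_kern (f g : ℝ[X]) : (C X - X) * kern f g = f.map C * C g - g.map C * C f := by
  rw [kern]
  linear_combination f.map C * mul_divDiffTwo g - g.map C * mul_divDiffTwo f

theorem kern_skew (f g : ℝ[X]) : kern f g = -kern g f := by
  rw [kern, kern]; ring

theorem kern_add_left (f f' g : ℝ[X]) : kern (f + f') g = kern f g + kern f' g := by
  simp only [kern, map_add, Polynomial.map_add]; ring

theorem kern_smul_left (c : ℝ) (f g : ℝ[X]) : kern (c • f) g = c • kern f g := by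
  have h : (c • f).map (C : ℝ →+* ℝ[X]) = c • f.map C := by
    rw [smul_eq_C_mul, Polynomial.map_mul, map_C, Algebra.smul_def]; rfl
  rw [kern, kern, map_smul, h, smul_mul_assoc, mul_smul_comm, smul_sub]

theorem kern_add_right (f g g' : ℝ[X]) : kern f (g + g') = kern f g + kern f g' := by
  rw [kern_skew, kern_add_left, kern_skew g, kern_skew g']; ring

theorem kern_smul_right (c : ℝ) (f g : ℝ[X]) : kern f (c • g) = c • kern f g := by
  rw [kern_skew, kern_smul_left, kern_skew g, smul_neg, neg_neg]

theorem kern_one_left (g : ℝ[X]) : kern 1 g = divDiffTwo g := by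
  rw [kern, ← C_1, divDiffTwo_C, map_C]; simp

/-- The derivation `x^{l+1} ∂_x + y^{l+1} ∂_y`. -/
def eulerTwo (l : ℕ) : ℝ[X][X] →ₗ[ℝ] ℝ[X][X] :=
  Polynomial.lsum fun j =>
    ((monomial j).restrictScalars ℝ).comp ((LinearMap.mulLeft ℝ (X ^ (l + 1))).comp derivative)
      + (j : ℝ) • (monomial (j + l)).restrictScalars ℝ

theorem eulerTwo_monomial (l j : ℕ) (a : ℝ[X]) : eulerTwo l (monomial j a) =
    monomial j (X ^ (l + 1) * derivative a) + monomial (j + l) ((j : ℝ[X]) * a) := by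
  rw [eulerTwo, Polynomial.lsum_apply, sum_monomial_index]
  · simp only [LinearMap.add_apply, LinearMap.comp_apply, LinearMap.restrictScalars_apply,
      LinearMap.mulLeft_apply, LinearMap.smul_apply]
    rw [smul_monomial, Nat.cast_smul_eq_nsmul, nsmul_eq_mul]
  · simp

theorem eulerTwo_mul (l : ℕ) (Φ Ψ : ℝ[X][X]) :
    eulerTwo l (Φ * Ψ) = eulerTwo l Φ * Ψ + Φ * eulerTwo l Ψ := by
  induction Φ using Polynomial.induction_on' with
  | add Φ Φ' h1 h2 => rw [add_mul, map_add, h1, h2, map_add]; ring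
  | monomial i a =>
    induction Ψ using Polynomial.induction_on' with
    | add Ψ Ψ' h1 h2 => rw [mul_add, map_add, h1, h2, map_add]; ring
    | monomial j b =>
      rw [monomial_mul_monomial, eulerTwo_monomial, eulerTwo_monomial, eulerTwo_monomial,
        derivative_mul]
      simp only [← C_mul_X_pow_eq_monomial, C_mul, C_add, Nat.cast_add, pow_add, C_pow]
      ring

theorem eulerTwo_C (l : ℕ) (f : ℝ[X]) : eulerTwo l (C f) = C (X ^ (l + 1) * derivative f) := by
  rw [← monomial_zero_left, eulerTwo_monomial]; simp

theorem eulerTwo_X (l : ℕ) : eulerTwo l X = X ^ (l + 1) := by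
  rw [← monomial_one_one_eq_X, eulerTwo_monomial, ← C_mul_X_pow_eq_monomial]
  simp [add_comm]

theorem eulerTwo_map (l : ℕ) (f : ℝ[X]) :
    eulerTwo l (f.map C) = (X ^ (l + 1) * derivative f).map C := by
  induction f using Polynomial.induction_on' with
  | add f g hf hg => rw [Polynomial.map_add, map_add, hf, hg]; simp [mul_add]
  | monomial j c =>
    rw [map_monomial, eulerTwo_monomial, derivative_monomial, derivative_C]
    simp only [mul_zero, map_zero, zero_add, Polynomial.map_mul, Polynomial.map_pow, map_X,
      ← C_mul_X_pow_eq_monomial, C_mul]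
    rcases j with _ | j
    · simp
    · rw [Nat.add_sub_cancel]
      simp only [map_natCast, map_C, Polynomial.map_natCast]
      ring

/-- `∑_{i ≤ l} x^i y^{l-i}`. -/
def fullSum (l : ℕ) : ℝ[X][X] := ∑ i ∈ Finset.range (l + 1), (C X : ℝ[X][X]) ^ i * X ^ (l - i)

theorem mul_fullSum (l : ℕ) : (C X - X) * fullSum l = (C X : ℝ[X][X]) ^ (l + 1) - X ^ (l + 1) :=
  (Commute.all (C X : ℝ[X][X]) X).mul_geom_sum₂ (l + 1)

/-- The derivation sends the denominator x - y to x^{l+1} - y^{l+1}, that is, to (x - y) `fullSum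
l`, whence the last term. -/
theorem eulerTwo_kern (l : ℕ) (f g : ℝ[X]) : eulerTwo l (kern f g) =
    kern (X ^ (l + 1) * derivative f) g + kern f (X ^ (l + 1) * derivative g)
      - fullSum l * kern f g := by
  refine mul_left_cancel₀ C_X_sub_X_ne_zero ?_
  have h := congrArg (eulerTwo l) (mul_kern f g)
  rw [eulerTwo_mul, map_sub, map_sub, eulerTwo_C, eulerTwo_X, eulerTwo_mul, eulerTwo_mul,
    eulerTwo_map, eulerTwo_map, eulerTwo_C, eulerTwo_C, derivative_X, mul_one, C_pow] at h
  have h1 := mul_kern (X ^ (l + 1) * derivative f) g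
  have h2 := mul_kern f (X ^ (l + 1) * derivative g)
  linear_combination h - h1 - h2 + kern f g * mul_fullSum l

theorem eulerTwo_pow_mul_kern (l k : ℕ) (f g : ℝ[X]) : eulerTwo l (C (X ^ k) * kern f g) =
    C (X ^ k) * (kern (X ^ (l + 1) * derivative f) g + kern f (X ^ (l + 1) * derivative g))
      + ((k : ℝ[X][X]) * C (X ^ (k + l)) - C (X ^ k) * fullSum l) * kern f g := by
  have hk : eulerTwo l (C (X ^ k)) = (k : ℝ[X][X]) * C (X ^ (k + l)) := by
    rw [eulerTwo_C, derivative_X_pow]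
    rcases k with _ | k
    · simp
    · rw [Nat.add_sub_cancel]
      simp only [C_mul, C_pow, map_natCast]
      ring
  rw [eulerTwo_mul, hk, eulerTwo_kern]
  ring

/-- It matches the corrections with factor Tr X^β in the derivative of a bracket with those in the
brackets of the derivatives. -/
theorem pow_add_pow_mul_kern (c : ℕ) (f g : ℝ[X]) :
    (C (X ^ c) + X ^ c) * kern f g = kern (X ^ c * f) g + kern f (X ^ c * g) := by
  refine mul_left_cancel₀ C_X_sub_X_ne_zero ?_
  have h1 := mul_kern (X ^ c * f) g
  have h2 := mul_kern f (X ^ c * g)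
  simp only [Polynomial.map_mul, Polynomial.map_pow, map_X, C_mul] at h1 h2
  linear_combination (C (X ^ c) + X ^ c) * mul_kern f g - h1 - h2

/-- This is the derivative in a of (a - b) ∑ a^i b^{l-i} = a^{l+1} - b^{l+1}. -/
theorem sub_mul_sum_weighted_pow {R : Type*} [CommRing R] (a b : R) (l : ℕ) :
    (a - b) * ∑ β ∈ Finset.Icc 1 l, (β : R) * (a ^ (β - 1) * b ^ (l - β)) =
      ((l : R) + 1) * a ^ l - ∑ i ∈ Finset.range (l + 1), a ^ i * b ^ (l - i) := by
  induction l with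
  | zero => simp
  | succ l ih =>
    have h1 : ∑ β ∈ Finset.Icc 1 (l + 1), (β : R) * (a ^ (β - 1) * b ^ (l + 1 - β)) =
        b * (∑ β ∈ Finset.Icc 1 l, (β : R) * (a ^ (β - 1) * b ^ (l - β)))
          + ((l : R) + 1) * a ^ l := by
      rw [Finset.sum_Icc_succ_top (by omega), Finset.mul_sum]
      congr 1
      · refine Finset.sum_congr rfl fun β hβ => ?_
        have := (Finset.mem_Icc.1 hβ).2
        rw [show l + 1 - β = (l - β) + 1 by omega, pow_succ]
        ring
      · simp
    have h2 : ∑ i ∈ Finset.range (l + 1 + 1), a ^ i * b ^ (l + 1 - i) =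
        b * ∑ i ∈ Finset.range (l + 1), a ^ i * b ^ (l - i) + a ^ (l + 1) := by
      rw [Finset.sum_range_succ, Finset.mul_sum]
      congr 1
      · refine Finset.sum_congr rfl fun i hi => ?_
        have := Finset.mem_range.1 hi
        rw [show l + 1 - i = (l - i) + 1 by omega, pow_succ]
        ring
      · simp
    rw [h1, mul_add, h2]
    push_cast
    linear_combination b * ih

/-- The sum arises from the differentials β tr(X^{β-1} dX) of Tr X^β. It supplies the -(l+1) of the
final constant and cancels the `fullSum` of `eulerTwo_kern`. -/
theorem sum_weighted_kern (l k : ℕ) (f g : ℝ[X]) :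
    ∑ β ∈ Finset.Icc 1 l, (β : ℝ[X][X]) * (C (X ^ (k + β - 1) * f) * (X ^ (l - β) * g).map C
        - C (X ^ (k + β - 1) * g) * (X ^ (l - β) * f).map C) =
      -(C (X ^ k) * kern f g * (((l : ℝ[X][X]) + 1) * C X ^ l - fullSum l)) := by
  rw [fullSum, ← sub_mul_sum_weighted_pow, Finset.mul_sum, Finset.mul_sum, ← Finset.sum_neg_distrib]
  refine Finset.sum_congr rfl fun β hβ => ?_
  have hβ' := (Finset.mem_Icc.1 hβ).1
  rw [show k + β - 1 = k + (β - 1) by omega, pow_add]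
  simp only [C_mul, C_pow, Polynomial.map_mul, Polynomial.map_pow, map_X]
  linear_combination (C X ^ k * β * C X ^ (β - 1) * X ^ (l - β)) * mul_kern f g

end TwoVariables

end

section

/-! ### The functional `σ ⊗ σ` -/

variable {n : ℕ} {x : Coord n}

theorem sigma_add (f g : ℝ[X]) (x : Coord n) : sigma (f + g) x = sigma f x + sigma g x :=
  map_add (sigmaLin x) f g

theorem sigma_sub (f g : ℝ[X]) (x : Coord n) : sigma (f - g) x = sigma f x - sigma g x :=
  map_sub (sigmaLin x) f g

theorem sigma_C_mul (c : ℝ) (f : ℝ[X]) (x : Coord n) : sigma (C c * f) x = c * sigma f x := by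
  rw [← smul_eq_C_mul]; exact map_smul (sigmaLin x) c f

theorem sigma_smul (c : ℝ) (f : ℝ[X]) (x : Coord n) : sigma (c • f) x = c * sigma f x :=
  map_smul (sigmaLin x) c f

theorem sigma_C (c : ℝ) (x : Coord n) : sigma (C c) x = c := by
  simp [sigma, Algebra.algebraMap_eq_smul_one]

/-- `σ` applied in both variables. -/
def sigmaTwo (x : Coord n) : ℝ[X][X] →ₗ[ℝ] ℝ :=
  Polynomial.lsum fun j => sigma (X ^ j) x • sigmaLin x

theorem sigmaTwo_mul (f g : ℝ[X]) (x : Coord n) :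
    sigmaTwo x (C f * g.map C) = sigma f x * sigma g x := by
  induction g using Polynomial.induction_on' with
  | add g g' h1 h2 => rw [Polynomial.map_add, mul_add, map_add, h1, h2, sigma_add, mul_add]
  | monomial j c =>
    rw [map_monomial, C_mul_monomial, sigmaTwo, Polynomial.lsum_apply, sum_monomial_index]
    · rw [LinearMap.smul_apply, sigmaLin_apply, ← C_mul_X_pow_eq_monomial, mul_comm f, sigma_C_mul,
        sigma_C_mul, smul_eq_mul]
      ring
    · rw [map_zero]

theorem sigma_eq_zero_of_aeval {f : ℝ[X]} (hf : aeval (jacMatrix x) f = 0) (g : ℝ[X]) :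
    sigma (g * f) x = 0 := by
  rw [sigma, map_mul, hf, mul_zero]; rfl

theorem sigmaTwo_C_mul_eq_zero {f : ℝ[X]} (hf : aeval (jacMatrix x) f = 0) (Φ : ℝ[X][X]) :
    sigmaTwo x (C f * Φ) = 0 := by
  induction Φ using induction_two with
  | hadd Φ Ψ h1 h2 => rw [mul_add, map_add, h1, h2, add_zero]
  | hmul a b =>
    rw [← mul_assoc, ← C_mul, sigmaTwo_mul, mul_comm f, sigma_eq_zero_of_aeval hf, zero_mul]

theorem sigmaTwo_map_mul_eq_zero {f : ℝ[X]} (hf : aeval (jacMatrix x) f = 0) (Φ : ℝ[X][X]) :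
    sigmaTwo x (f.map C * Φ) = 0 := by
  induction Φ using induction_two with
  | hadd Φ Ψ h1 h2 => rw [mul_add, map_add, h1, h2, add_zero]
  | hmul a b =>
    rw [mul_left_comm, ← Polynomial.map_mul, sigmaTwo_mul, mul_comm f, sigma_eq_zero_of_aeval hf,
      mul_zero]

/-- The value of the `k`-th bracket on `σ(f)` and `σ(g)`. -/
def sigmaBrk (k : ℕ) (x : Coord n) : ℝ[X] →ₗ[ℝ] ℝ[X] →ₗ[ℝ] ℝ :=
  LinearMap.mk₂ ℝ (fun f g => sigmaTwo x (C (X ^ k) * kern f g)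
      - sigma f x * sigmaTwo x (C (X ^ k) * kern 1 g) - sigma g x * sigmaTwo x (C (X ^ k) * kern f 1))
    (fun f f' g => by
      simp only [kern_add_left, mul_add, map_add, sigma_add]; ring)
    (fun c f g => by
      simp only [kern_smul_left, mul_smul_comm, map_smul, sigma_smul, smul_eq_mul]
      ring)
    (fun f g g' => by
      simp only [kern_add_right, mul_add, map_add, sigma_add]; ring)
    (fun c f g => by
      simp only [kern_smul_right, mul_smul_comm, map_smul, sigma_smul, smul_eq_mul]
      ring)

theorem sigmaBrk_apply (k : ℕ) (x : Coord n) (f g : ℝ[X]) : sigmaBrk k x f g =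
    sigmaTwo x (C (X ^ k) * kern f g) - sigma f x * sigmaTwo x (C (X ^ k) * kern 1 g)
      - sigma g x * sigmaTwo x (C (X ^ k) * kern f 1) := rfl

theorem sigmaTwo_kern_skew (k : ℕ) (x : Coord n) (f g : ℝ[X]) :
    sigmaTwo x (C (X ^ k) * kern f g) = -sigmaTwo x (C (X ^ k) * kern g f) := by
  have : C (X ^ k) * kern f g = -(C (X ^ k) * kern g f) := by rw [kern_skew f g]; ring
  rw [this, map_neg]

theorem sigmaBrk_skew (k : ℕ) (x : Coord n) (f g : ℝ[X]) : sigmaBrk k x f g = -sigmaBrk k x g f := by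
  rw [sigmaBrk_apply, sigmaBrk_apply, sigmaTwo_kern_skew k x f g, sigmaTwo_kern_skew k x 1 g,
    sigmaTwo_kern_skew k x f 1]
  ring

/-- By Cayley–Hamilton σ ⊗ σ kills multiples of p(x) and of p(y). A divided difference of p · (ph)
keeps a factor p in one of the variables, by the Leibniz rule. -/
theorem sigmaTwo_kern_sq_charpoly (k : ℕ) (x : Coord n) (h g : ℝ[X]) :
    sigmaTwo x (C (X ^ k) * kern ((jacMatrix x).charpoly ^ 2 * h) g) = 0 := by
  set p := (jacMatrix x).charpoly with hp
  have hp0 : aeval (jacMatrix x) p = 0 := Matrix.aeval_self_charpoly _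
  have : C (X ^ k) * kern (p ^ 2 * h) g =
      p.map C * (C (X ^ k) * ((p * h).map C * divDiffTwo g - g.map C * divDiffTwo p * h.map C))
      - C p * (C (X ^ k) * g.map C * divDiffTwo (p * h)) := by
    rw [kern, pow_two, mul_assoc, divDiffTwo_mul]
    simp only [Polynomial.map_mul]
    ring
  rw [this, map_sub, sigmaTwo_map_mul_eq_zero hp0, sigmaTwo_C_mul_eq_zero hp0, sub_zero]

theorem sigmaBrk_sq_charpoly (k : ℕ) (x : Coord n) (h g : ℝ[X]) :
    sigmaBrk k x ((jacMatrix x).charpoly ^ 2 * h) g = 0 := by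
  have h0 : sigma ((jacMatrix x).charpoly ^ 2 * h) x = 0 := by
    rw [sigma, aeval_sq_charpoly_mul]; rfl
  rw [sigmaBrk_apply, h0, sigmaTwo_kern_sq_charpoly, sigmaTwo_kern_sq_charpoly]
  ring

/-- The divided difference of 1/(z - x) is 1/((z - x)(z - y)), here modulo p(x) and p(y). -/
theorem IsFraction.divDiffTwo_eq {z : ℝ} {f : ℝ[X]} (hf : IsFraction x z f) :
    ∃ A B : ℝ[X][X], divDiffTwo f = C f * f.map C + C (jacMatrix x).charpoly * A
      + (jacMatrix x).charpoly.map C * B := by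
  obtain ⟨h, hh⟩ := hf
  set p := (jacMatrix x).charpoly
  have e1 : (C z - X) * f = p * (p * h) + C 1 := by rw [C_1]; linear_combination hh
  have e2 := congrArg divDiffTwo e1
  rw [divDiffTwo_mul, map_sub, divDiffTwo_C, divDiffTwo_X, map_add, divDiffTwo_C, divDiffTwo_mul] at e2
  have e3 := congrArg (C : ℝ[X] → ℝ[X][X]) hh
  simp only [C_mul, C_sub, C_pow, C_1, Polynomial.map_mul] at e2 e3
  refine ⟨C f * divDiffTwo (p * h) - C p * C h * divDiffTwo f, C f * divDiffTwo p * h.map C, ?_⟩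
  linear_combination C f * e2 - divDiffTwo f * e3

theorem sigma_X_pow_mul_fraction {z : ℝ} {f : ℝ[X]} (hf : IsFraction x z f) (k : ℕ) :
    sigma (X ^ k * f) x = weylProper k z x := by
  rw [weylProper_eq k hf.eval_charpoly_ne_zero, sigma, map_mul, hf.aeval_eq]
  simp

/-- The resolvent identity, applied to e₀ after multiplication by X^k. -/
theorem sigma_mul_fraction {z z' : ℝ} {f g : ℝ[X]} (hf : IsFraction x z f)
    (hg : IsFraction x z' g) (k : ℕ) :
    (z - z') * sigma (X ^ k * (f * g)) x = weylProper k z' x - weylProper k z x := by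
  rw [← sigma_X_pow_mul_fraction hf, ← sigma_X_pow_mul_fraction hg, ← sigma_C_mul, ← sigma_sub]
  obtain ⟨a, ha⟩ := hf
  obtain ⟨b, hb⟩ := hg
  have : C (z - z') * (X ^ k * (f * g)) = (X ^ k * g - X ^ k * f)
      + ((jacMatrix x).charpoly ^ 2 * (X ^ k * (g * a - f * b))) := by
    rw [C_sub]
    linear_combination X ^ k * g * ha - X ^ k * f * hb
  rw [this, sigma_add, sigma, sigma, aeval_sq_charpoly_mul]
  simp

theorem sigmaBrk_fraction {z z' : ℝ} {f g : ℝ[X]} (hf : IsFraction x z f)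
    (hg : IsFraction x z' g) (k : ℕ) : sigmaBrk k x f g =
      (weylProper k z x - weylProper k z' x) * (weyl z x * weyl z' x - sigma (f * g) x) := by
  have hp0 : aeval (jacMatrix x) (jacMatrix x).charpoly = 0 := Matrix.aeval_self_charpoly _
  have key : ∀ {z : ℝ} {f : ℝ[X]} (hf : IsFraction x z f) (a : ℝ[X]),
      sigmaTwo x (C (X ^ k) * (a.map C * divDiffTwo f)) =
        weylProper k z x * sigma (a * f) x := by
    intro z f hf a
    obtain ⟨A, B, hAB⟩ := hf.divDiffTwo_eq
    have : C (X ^ k) * (a.map C * divDiffTwo f) = C (X ^ k * f) * (a * f).map C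
        + C (jacMatrix x).charpoly * (C (X ^ k) * a.map C * A)
        + (jacMatrix x).charpoly.map C * (C (X ^ k) * a.map C * B) := by
      rw [hAB, Polynomial.map_mul, C_mul]; ring
    rw [this, map_add, map_add, sigmaTwo_mul, sigmaTwo_C_mul_eq_zero hp0,
      sigmaTwo_map_mul_eq_zero hp0, sigma_X_pow_mul_fraction hf, add_zero, add_zero]
  have key1 : ∀ {z : ℝ} {f : ℝ[X]} (hf : IsFraction x z f),
      sigmaTwo x (C (X ^ k) * divDiffTwo f) = weylProper k z x * weyl z x := by
    intro z f hf
    have := key hf 1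
    rwa [Polynomial.map_one, one_mul, one_mul, hf.sigma_eq] at this
  rw [sigmaBrk_apply, sigmaTwo_kern_skew k x f 1, kern_one_left, kern_one_left, key1 hf,
    key1 hg, hf.sigma_eq, hg.sigma_eq, kern, mul_sub, map_sub, key hg, key hf, mul_comm g f]
  ring

/-- The formula for the `k`-th bracket on the functions `σ(f)`. -/
theorem weylBracket_dSigma (k : ℕ) (hx : x ∈ Jac n) (f g : ℝ[X]) :
    weylBracket n k x (dSigma x f) (dSigma x g) = sigmaBrk k x f g := by
  set D : ℝ[X] →ₗ[ℝ] ℝ[X] →ₗ[ℝ] ℝ :=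
    (weylBracket n k x).compl₁₂ (dSigma x) (dSigma x) - sigmaBrk k x with hD
  have hDa : ∀ f g, D f g = weylBracket n k x (dSigma x f) (dSigma x g) - sigmaBrk k x f g :=
    fun _ _ => rfl
  have hskew : ∀ f g, D f g = -D g f := by
    intro f g
    rw [hDa, hDa, weylBracket_skew, sigmaBrk_skew]; ring
  have hsq : ∀ h g, D ((jacMatrix x).charpoly ^ 2 * h) g = 0 := by
    intro h g
    rw [hDa, dSigma_sq_charpoly_mul, sigmaBrk_sq_charpoly, map_zero]; simp
  have hfr : ∀ f z g z', IsFraction x z f → IsFraction x z' g → z ≠ z' → D f g = 0 := by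
    intro f z g z' hf hg hz
    have h0 : z - z' ≠ 0 := sub_ne_zero.2 hz
    have h1 := (isWeylBracket_weylBracket n k).pullback x hx z z' hz hf.eval_charpoly_ne_zero
      hg.eval_charpoly_ne_zero
    have h2 := sigma_mul_fraction hf hg 0
    rw [pow_zero, one_mul, ← sigma_X_pow_mul_fraction hf, ← sigma_X_pow_mul_fraction hg, pow_zero,
      one_mul, one_mul, hf.sigma_eq, hg.sigma_eq] at h2
    have h3 : sigma (f * g) x = -((weyl z x - weyl z' x) / (z - z')) := by
      field_simp
      linear_combination h2
    rw [hDa, hf.dSigma_eq, hg.dSigma_eq, sigmaBrk_fraction hf hg, h3]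
    rw [brk] at h1
    rw [h1]
    ring
  -- The pullback formula needs z ≠ z', so z' is made the exceptional set; the second application
  -- needs none.
  have hfr1 : ∀ f g z', IsFraction x z' g → D f g = 0 := by
    intro f g z' hg
    exact linearMap_eq_zero_of_fractions (charpoly_jacMatrix_monic x) {z'} (D.flip g)
      (fun h => hsq h g)
      (fun f z hz hz0 hf => hfr f z g z' hf hg (by simpa using hz)) f
  have hall : D f g = 0 :=
    linearMap_eq_zero_of_fractions (charpoly_jacMatrix_monic x) ∅ (D f)
      (fun h => by rw [hskew, hsq, neg_zero]) (fun g z _ _ hg => hfr1 f g z hg) g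
  rw [hDa] at hall
  exact sub_eq_zero.1 hall

/-! ### The differentials `tr (f(X) dX)` -/

theorem tangentMatrix_add (v w : Coord n) :
    tangentMatrix (v + w) = tangentMatrix v + tangentMatrix w := by
  rw [← matDeriv_jacMatrix 0, ← matDeriv_jacMatrix 0, ← matDeriv_jacMatrix 0]
  ext i j
  simp [matDeriv]

theorem tangentMatrix_smul (c : ℝ) (v : Coord n) :
    tangentMatrix (c • v) = c • tangentMatrix v := by
  rw [← matDeriv_jacMatrix 0, ← matDeriv_jacMatrix 0]
  ext i j
  simp [matDeriv]

/-- The differential form `tr (f(X) dX)`. -/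
def traceForm (x : Coord n) : ℝ[X] →ₗ[ℝ] (Coord n →L[ℝ] ℝ) where
  toFun f := LinearMap.toContinuousLinearMap
    { toFun := fun v => (aeval (jacMatrix x) f * tangentMatrix v).trace
      map_add' := fun v w => by rw [tangentMatrix_add, Matrix.mul_add, trace_add]
      map_smul' := fun c v => by rw [tangentMatrix_smul, Matrix.mul_smul, trace_smul]; rfl }
  map_add' f g := ContinuousLinearMap.ext fun v => by
    change (aeval (jacMatrix x) (f + g) * tangentMatrix v).trace = _ + _
    rw [map_add, Matrix.add_mul, trace_add]; rfl
  map_smul' c f := ContinuousLinearMap.ext fun v => by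
    change (aeval (jacMatrix x) (c • f) * tangentMatrix v).trace = c • _
    rw [map_smul, Matrix.smul_mul, trace_smul]; rfl

theorem traceForm_apply (f : ℝ[X]) (x v : Coord n) :
    traceForm x f v = (aeval (jacMatrix x) f * tangentMatrix v).trace := rfl

theorem hasFDerivAt_trace_pow (β : ℕ) (x : Coord n) :
    HasFDerivAt (fun y : Coord n => (jacMatrix y ^ β).trace)
      ((β : ℝ) • traceForm x (X ^ (β - 1))) x := by
  have hd := diffMatAt_aeval_jacMatrix (X ^ β) x
  have hdt : DifferentiableAt ℝ (fun y : Coord n => (aeval (jacMatrix y) (X ^ β : ℝ[X])).trace) x :=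
    DifferentiableAt.fun_sum fun i _ => hd i i
  have he : fderiv ℝ (fun y : Coord n => (aeval (jacMatrix y) (X ^ β : ℝ[X])).trace) x =
      (β : ℝ) • traceForm x (X ^ (β - 1)) := by
    refine ContinuousLinearMap.ext fun v => ?_
    rw [fderiv_trace hd]
    change (dAeval x v (X ^ β)).trace = _
    have := trace_mul_dAeval (x := x) (v := v) 1 (X ^ β)
    rw [map_one, Matrix.one_mul, one_mul, derivative_X_pow, map_mul, aeval_C, ← Algebra.smul_def,
      Matrix.smul_mul, trace_smul] at this
    rw [this]; rfl
  rw [← he]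
  simpa using hdt.hasFDerivAt

theorem IsFraction.traceForm_eq {z : ℝ} {f : ℝ[X]} (hf : IsFraction x z f) :
    fderiv ℝ (fun y => (jacMatrix y).charpoly.eval z) x =
      -((jacMatrix x).charpoly.eval z) • traceForm x f := by
  refine ContinuousLinearMap.ext fun v => ?_
  rw [fderiv_eval_charpoly hf.eval_charpoly_ne_zero, _root_.smul_apply, traceForm_apply,
    hf.aeval_eq, smul_eq_mul, neg_mul]

/-- The formula for the `k`-th bracket of a spectral invariant and `σ(g)`. -/
theorem weylBracket_traceForm (k : ℕ) (hx : x ∈ Jac n) (f g : ℝ[X]) :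
    weylBracket n k x (traceForm x f) (dSigma x g) =
      sigma (X ^ k * f) x * sigma g x - sigma (X ^ k * (f * g)) x := by
  set D : ℝ[X] →ₗ[ℝ] ℝ[X] →ₗ[ℝ] ℝ :=
    (weylBracket n k x).compl₁₂ (traceForm x) (dSigma x) -
      LinearMap.mk₂ ℝ (fun f g => sigma (X ^ k * f) x * sigma g x - sigma (X ^ k * (f * g)) x)
        (fun f f' g => by simp only [add_mul, mul_add, sigma_add]; ring)
        (fun c f g => by
          simp only [smul_mul_assoc, mul_smul_comm, sigma_smul]; ring)
        (fun f g g' => by simp only [mul_add, sigma_add]; ring)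
        (fun c f g => by
          simp only [mul_smul_comm, sigma_smul]; ring) with hD
  have hDa : ∀ f g, D f g = weylBracket n k x (traceForm x f) (dSigma x g) -
      (sigma (X ^ k * f) x * sigma g x - sigma (X ^ k * (f * g)) x) := fun _ _ => rfl
  have hs0 : ∀ h, sigma ((jacMatrix x).charpoly ^ 2 * h) x = 0 := fun h => by
    rw [sigma, aeval_sq_charpoly_mul]; rfl
  have hsq1 : ∀ h g, D ((jacMatrix x).charpoly ^ 2 * h) g = 0 := by
    intro h g
    have ht : traceForm x ((jacMatrix x).charpoly ^ 2 * h) = 0 :=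
      ContinuousLinearMap.ext fun v => by
        rw [traceForm_apply, aeval_sq_charpoly_mul, Matrix.zero_mul, trace_zero]; rfl
    rw [hDa, ht, mul_left_comm, hs0, mul_assoc, mul_left_comm, hs0, map_zero]; simp
  have hsq2 : ∀ f h, D f ((jacMatrix x).charpoly ^ 2 * h) = 0 := by
    intro f h
    rw [hDa, dSigma_sq_charpoly_mul, hs0, mul_left_comm f, mul_left_comm, hs0, map_zero]; simp
  have hfr : ∀ f z g z', IsFraction x z f → IsFraction x z' g → z ≠ z' → D f g = 0 := by
    intro f z g z' hf hg hz
    have h0 : z - z' ≠ 0 := sub_ne_zero.2 hz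
    have hz0 := hf.eval_charpoly_ne_zero
    have hz0' := hg.eval_charpoly_ne_zero
    -- For a fraction `f` the form tr(f(X) dX) is -dp(z)/p(z), so its bracket is read off from
    -- {p(z), M(z')}.
    have h1 := weylBracket_charpoly_weyl k hx z hz0'
    rw [hf.traceForm_eq, map_smul, LinearMap.smul_apply, smul_eq_mul, ← hg.dSigma_eq] at h1
    have h2 := sub_mul_brkEval k x z z'
    rw [eval_weylRem k hz0, eval_weylRem k hz0', eval_weylNum hz0', ← weylProper_eq k hz0,
      ← weylProper_eq k hz0'] at h2
    have h3 := sigma_mul_fraction hf hg k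
    rw [hDa, sigma_X_pow_mul_fraction hf, hg.sigma_eq]
    have h4 : (z - z') * ((jacMatrix x).charpoly.eval z * (jacMatrix x).charpoly.eval z') ≠ 0 :=
      mul_ne_zero h0 (mul_ne_zero hz0 hz0')
    refine (mul_eq_zero.1 (?_ : (z - z') * ((jacMatrix x).charpoly.eval z *
      (jacMatrix x).charpoly.eval z') * _ = 0)).resolve_left h4
    have h5 : (jacMatrix x).charpoly.eval z * (jacMatrix x).charpoly.eval z' *
        weylBracket n k x (traceForm x f) (dSigma x g) = -brkEval k x z z' := by
      rw [eq_div_iff hz0'] at h1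
      linear_combination -h1
    linear_combination (z - z') * h5 - h2 +
      (jacMatrix x).charpoly.eval z * (jacMatrix x).charpoly.eval z' * h3
  have hfr1 : ∀ f g z', IsFraction x z' g → D f g = 0 := by
    intro f g z' hg
    exact linearMap_eq_zero_of_fractions (charpoly_jacMatrix_monic x) {z'} (D.flip g)
      (fun h => hsq1 h g)
      (fun f z hz hz0 hf => hfr f z g z' hf hg (by simpa using hz)) f
  have hall : D f g = 0 :=
    linearMap_eq_zero_of_fractions (charpoly_jacMatrix_monic x) ∅ (D f)
      (fun h => hsq2 f h) (fun g z _ _ hg => hfr1 f g z hg) g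
  rw [hDa] at hall
  exact sub_eq_zero.1 hall

end

section

/-! ### Derivatives along the master fields -/

section LieDerivatives

variable {E : Type*} [NormedAddCommGroup E] [NormedSpace ℝ E] {x : E}

theorem hasFDerivAt_fderiv_apply {f : E → ℝ} (hf : ContDiffAt ℝ 2 f x) {P : E → E}
    (hP : DifferentiableAt ℝ P x) : HasFDerivAt (fun y => fderiv ℝ f y (P y))
      ((fderiv ℝ f x).comp (fderiv ℝ P x) + (fderiv ℝ (fderiv ℝ f) x).flip (P x)) x := by
  have h1 : DifferentiableAt ℝ (fderiv ℝ f) x :=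
    (hf.fderiv_right (m := 1) (by norm_num)).differentiableAt (by norm_num)
  exact h1.hasFDerivAt.clm_apply hP.hasFDerivAt

/-- Y(Pf) = P(Yf) + [Y, P]f by symmetry of the second derivative. It trades second derivatives of f
for the differential of Yf. -/
theorem fderiv_fderiv_apply_comm {f : E → ℝ} (hf : ContDiffAt ℝ 2 f x) {P Y : E → E}
    (hP : DifferentiableAt ℝ P x) (hY : DifferentiableAt ℝ Y x) :
    fderiv ℝ (fun y => fderiv ℝ f y (P y)) x (Y x) =
      fderiv ℝ (fun y => fderiv ℝ f y (Y y)) x (P x)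
        + fderiv ℝ f x (VectorField.lieBracket ℝ Y P x) := by
  rw [(hasFDerivAt_fderiv_apply hf hP).fderiv, (hasFDerivAt_fderiv_apply hf hY).fderiv,
    VectorField.lieBracket_eq]
  have hs := hf.isSymmSndFDerivAt (by simp) (P x) (Y x)
  simp only [_root_.add_apply, ContinuousLinearMap.comp_apply, ContinuousLinearMap.flip_apply,
    map_sub]
  linear_combination -hs

end LieDerivatives

variable {n : ℕ} {x : Coord n}

/-- The Lie derivative of the `k`-th bracket at a point depends only on the differentials. -/
theorem exists_lieDeriv_weylBracket (k : ℕ) (hx : x ∈ Jac n) {Y : Coord n → Coord n}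
    (hY : DifferentiableAt ℝ Y x) : ∃ τ : (Coord n →L[ℝ] ℝ) → (Coord n →L[ℝ] ℝ) → ℝ,
      ∀ f g : Coord n → ℝ, ContDiffAt ℝ 2 f x → ContDiffAt ℝ 2 g x →
        lieDeriv Y (brk (weylBracket n k) f g) x - brk (weylBracket n k) (lieDeriv Y f) g x
          - brk (weylBracket n k) f (lieDeriv Y g) x = τ (fderiv ℝ f x) (fderiv ℝ g x) := by
  set c : Fin (n + 1) → Fin n → Coord n → ℝ := fun i j y => (brkPoly k y i).coeff j with hc
  have hcd : ∀ i j, DifferentiableAt ℝ (c i j) x := fun i j =>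
    ((contDiffOn_brkPoly_coeff k i j).contDiffAt ((isOpen_jac n).mem_nhds hx)).differentiableAt
      (by simp)
  have hd : ∀ e, DifferentiableAt ℝ (dualField e : Coord n → Coord n) x := fun e =>
    ((contDiffOn_dualField e).contDiffAt ((isOpen_jac n).mem_nhds hx)).differentiableAt (by simp)
  have hP : ∀ i, DifferentiableAt ℝ (chartP i : Coord n → Coord n) x := fun i => hd _
  have hQ : ∀ j, DifferentiableAt ℝ (chartQ j : Coord n → Coord n) x := fun j => hd _
  -- The Lie derivative of the bivector ∑ c_{ij} P_i ∧ Q_j: Y acts on the coefficients and, by Lie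
  -- brackets, on P_i and Q_j.
  refine ⟨fun α β => ∑ i : Fin (n + 1), ∑ j : Fin n,
    (fderiv ℝ (c i j) x (Y x) * (α (chartP i x) * β (chartQ j x) - β (chartP i x) * α (chartQ j x))
      + c i j x * (α (VectorField.lieBracket ℝ Y (chartP i) x) * β (chartQ j x)
        + α (chartP i x) * β (VectorField.lieBracket ℝ Y (chartQ j) x)
        - β (VectorField.lieBracket ℝ Y (chartP i) x) * α (chartQ j x)
        - β (chartP i x) * α (VectorField.lieBracket ℝ Y (chartQ j) x))), fun f g hf hg => ?_⟩
  have hd1 : ∀ {f : Coord n → ℝ} (_ : ContDiffAt ℝ 2 f x) {P : Coord n → Coord n}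
      (_ : DifferentiableAt ℝ P x), DifferentiableAt ℝ (fun y => fderiv ℝ f y (P y)) x :=
    fun hf _ hP => (hasFDerivAt_fderiv_apply hf hP).differentiableAt
  have hsum : fderiv ℝ (brk (weylBracket n k) f g) x (Y x) = ∑ i : Fin (n + 1), ∑ j : Fin n,
      (fderiv ℝ (c i j) x (Y x) * (fderiv ℝ f x (chartP i x) * fderiv ℝ g x (chartQ j x)
          - fderiv ℝ g x (chartP i x) * fderiv ℝ f x (chartQ j x))
        + c i j x * (fderiv ℝ (fun y => fderiv ℝ f y (chartP i y)) x (Y x) * fderiv ℝ g x (chartQ j x)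
          + fderiv ℝ f x (chartP i x) * fderiv ℝ (fun y => fderiv ℝ g y (chartQ j y)) x (Y x)
          - fderiv ℝ (fun y => fderiv ℝ g y (chartP i y)) x (Y x) * fderiv ℝ f x (chartQ j x)
          - fderiv ℝ g x (chartP i x) * fderiv ℝ (fun y => fderiv ℝ f y (chartQ j y)) x (Y x))) := by
    have hh : HasFDerivAt (fun y => ∑ i : Fin (n + 1), ∑ j : Fin n, c i j y *
        (fderiv ℝ f y (chartP i y) * fderiv ℝ g y (chartQ j y)
          - fderiv ℝ g y (chartP i y) * fderiv ℝ f y (chartQ j y))) _ x :=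
      HasFDerivAt.fun_sum fun i _ => HasFDerivAt.fun_sum fun j _ => (hcd i j).hasFDerivAt.mul
        (((hd1 hf (hP i)).hasFDerivAt.mul (hd1 hg (hQ j)).hasFDerivAt).sub
          ((hd1 hg (hP i)).hasFDerivAt.mul (hd1 hf (hQ j)).hasFDerivAt))
    have he : brk (weylBracket n k) f g = fun y => ∑ i : Fin (n + 1), ∑ j : Fin n, c i j y *
        (fderiv ℝ f y (chartP i y) * fderiv ℝ g y (chartQ j y)
          - fderiv ℝ g y (chartP i y) * fderiv ℝ f y (chartQ j y)) := rfl
    rw [he, hh.fderiv]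
    simp only [_root_.sum_apply]
    refine Finset.sum_congr rfl fun i _ => Finset.sum_congr rfl fun j _ => ?_
    simp only [_root_.add_apply, _root_.sub_apply, _root_.smul_apply, smul_eq_mul]
    ring
  rw [lieDeriv, hsum, brk, brk, weylBracket_apply, weylBracket_apply, ← Finset.sum_sub_distrib,
    ← Finset.sum_sub_distrib]
  refine Finset.sum_congr rfl fun i _ => ?_
  rw [← Finset.sum_sub_distrib, ← Finset.sum_sub_distrib]
  refine Finset.sum_congr rfl fun j _ => ?_
  rw [fderiv_fderiv_apply_comm hf (hP i) hY, fderiv_fderiv_apply_comm hg (hP i) hY,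
    fderiv_fderiv_apply_comm hf (hQ j) hY, fderiv_fderiv_apply_comm hg (hQ j) hY]
  have e1 : lieDeriv Y f = fun y => fderiv ℝ f y (Y y) := rfl
  have e2 : lieDeriv Y g = fun y => fderiv ℝ g y (Y y) := rfl
  rw [e1, e2]
  simp only [hc]
  ring

/-- The (0, 0) entry of [f(X), B_l] uses only the first column and the first row of B_l, which come
from `powerSum` alone. -/
theorem lieDeriv_masterField_sigma (hx : x ∈ Jac n) (l : ℕ) (f : ℝ[X]) :
    lieDeriv (masterField l) (sigma f) x = sigma (X ^ (l + 1) * derivative f) x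
      - ∑ β ∈ Finset.Icc 1 l, (jacMatrix x ^ β).trace *
          (sigma (X ^ (l - β) * f) x - sigma (X ^ (l - β)) x * sigma f x) := by
  rw [lieDeriv, fderiv_sigma, dAeval_masterField hx, Matrix.add_apply, Matrix.sub_apply]
  have h1 : (aeval (jacMatrix x) f * bMat l x) 0 0 = -(aeval (jacMatrix x) f * powerSum l x) 0 0 := by
    simp only [Matrix.mul_apply, bMat_apply_zero_right, _root_.mul_neg, Finset.sum_neg_distrib]
  have h2 : (bMat l x * aeval (jacMatrix x) f) 0 0 = -(powerSum l x 0 0 * sigma f x) := by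
    rw [Matrix.mul_apply, Finset.sum_eq_single 0]
    · rw [bMat_zero_apply hx, if_pos rfl, sigma]; ring
    · intro j _ hj
      rw [bMat_zero_apply hx, if_neg hj, zero_mul]
    · simp
  have h3 : (aeval (jacMatrix x) f * powerSum l x) 0 0 =
      ∑ β ∈ Finset.Icc 1 l, (jacMatrix x ^ β).trace * sigma (X ^ (l - β) * f) x := by
    rw [powerSum, Finset.mul_sum, Matrix.sum_apply]
    refine Finset.sum_congr rfl fun β hβ => ?_
    rw [natCast_mul_ham (Finset.mem_Icc.1 hβ).1, Matrix.mul_smul, Matrix.smul_apply, smul_eq_mul,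
      mul_comm (X ^ (l - β)), sigma, map_mul, map_pow, aeval_X]
  have h4 : powerSum l x 0 0 =
      ∑ β ∈ Finset.Icc 1 l, (jacMatrix x ^ β).trace * sigma (X ^ (l - β)) x := by
    rw [powerSum, Matrix.sum_apply]
    refine Finset.sum_congr rfl fun β hβ => ?_
    rw [natCast_mul_ham (Finset.mem_Icc.1 hβ).1, Matrix.smul_apply, smul_eq_mul, sigma, map_pow,
      aeval_X]
  rw [h1, h2, h3, h4, Finset.sum_mul]
  change sigma _ x + _ = _
  simp only [mul_sub, Finset.sum_sub_distrib, mul_assoc]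
  ring

theorem differentiableAt_sigmaTwo (Φ : ℝ[X][X]) (x : Coord n) :
    DifferentiableAt ℝ (fun y => sigmaTwo y Φ) x := by
  induction Φ using induction_two with
  | hadd Φ Ψ h1 h2 => simp only [map_add]; exact h1.fun_add h2
  | hmul f g =>
    simp only [sigmaTwo_mul]
    exact (differentiableAt_sigma f x).fun_mul (differentiableAt_sigma g x)

/-- The product rule for σ(f)σ(g), extended by linearity from Φ = f(x)g(y). -/
theorem lieDeriv_masterField_sigmaTwo (hx : x ∈ Jac n) (l : ℕ) (Φ : ℝ[X][X]) :
    lieDeriv (masterField l) (fun y => sigmaTwo y Φ) x = sigmaTwo x (eulerTwo l Φ)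
      - ∑ β ∈ Finset.Icc 1 l, (jacMatrix x ^ β).trace *
          (sigmaTwo x ((C (X ^ (l - β)) + X ^ (l - β)) * Φ)
            - 2 * sigma (X ^ (l - β)) x * sigmaTwo x Φ) := by
  induction Φ using induction_two with
  | hadd Φ Ψ h1 h2 =>
    have : lieDeriv (masterField l) (fun y => sigmaTwo y (Φ + Ψ)) x =
        lieDeriv (masterField l) (fun y => sigmaTwo y Φ) x
          + lieDeriv (masterField l) (fun y => sigmaTwo y Ψ) x := by
      simp only [lieDeriv, map_add]
      rw [fderiv_fun_add (differentiableAt_sigmaTwo Φ x) (differentiableAt_sigmaTwo Ψ x)]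
      rfl
    rw [this, h1, h2]
    simp only [map_add, mul_add, mul_sub, Finset.sum_add_distrib, Finset.sum_sub_distrib]
    ring
  | hmul f g =>
    have h1 : lieDeriv (masterField l) (fun y => sigmaTwo y (C f * g.map C)) x =
        sigma f x * lieDeriv (masterField l) (sigma g) x
          + sigma g x * lieDeriv (masterField l) (sigma f) x := by
      simp only [lieDeriv, sigmaTwo_mul]
      rw [fderiv_fun_mul (differentiableAt_sigma f x) (differentiableAt_sigma g x)]
      simp only [_root_.add_apply, _root_.smul_apply, smul_eq_mul]
    have h2 : sigmaTwo x (eulerTwo l (C f * g.map C)) =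
        sigma (X ^ (l + 1) * derivative f) x * sigma g x
          + sigma f x * sigma (X ^ (l + 1) * derivative g) x := by
      rw [eulerTwo_mul, eulerTwo_C, eulerTwo_map, map_add, sigmaTwo_mul, sigmaTwo_mul]
    have h3 : ∀ c : ℕ, sigmaTwo x ((C (X ^ c) + X ^ c) * (C f * g.map C)) =
        sigma (X ^ c * f) x * sigma g x + sigma f x * sigma (X ^ c * g) x := by
      intro c
      have : (C (X ^ c) + X ^ c) * (C f * g.map C) =
          C (X ^ c * f) * g.map C + C f * (X ^ c * g).map C := by
        simp only [C_mul, Polynomial.map_mul, Polynomial.map_pow, map_X]; ring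
      rw [this, map_add, sigmaTwo_mul, sigmaTwo_mul]
    rw [h1, h2, lieDeriv_masterField_sigma hx, lieDeriv_masterField_sigma hx, mul_sub, mul_sub,
      Finset.mul_sum, Finset.mul_sum]
    have h4 : ∑ β ∈ Finset.Icc 1 l, (jacMatrix x ^ β).trace *
          (sigmaTwo x ((C (X ^ (l - β)) + X ^ (l - β)) * (C f * g.map C))
            - 2 * sigma (X ^ (l - β)) x * sigmaTwo x (C f * g.map C)) =
        (∑ β ∈ Finset.Icc 1 l, sigma f x * ((jacMatrix x ^ β).trace *
          (sigma (X ^ (l - β) * g) x - sigma (X ^ (l - β)) x * sigma g x)))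
        + ∑ β ∈ Finset.Icc 1 l, sigma g x * ((jacMatrix x ^ β).trace *
          (sigma (X ^ (l - β) * f) x - sigma (X ^ (l - β)) x * sigma f x)) := by
      rw [← Finset.sum_add_distrib]
      refine Finset.sum_congr rfl fun β _ => ?_
      rw [h3, sigmaTwo_mul]; ring
    rw [h4]
    ring

end

/-! ### Property (ii) for moments that vanish at the point, and the reduction to them -/

section

variable {n : ℕ} {x : Coord n}

/-- The traces are differentiated too, which brings in `traceForm`. The vanishing of σ(f) at the
point removes the terms where it multiplies another differential. -/
theorem fderiv_lieDeriv_sigma (hx : x ∈ Jac n) (l : ℕ) {f : ℝ[X]} (hf : sigma f x = 0) :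
    fderiv ℝ (lieDeriv (masterField l) (sigma f)) x = dSigma x (X ^ (l + 1) * derivative f)
      - ∑ β ∈ Finset.Icc 1 l,
        ((jacMatrix x ^ β).trace • (dSigma x (X ^ (l - β) * f) - sigma (X ^ (l - β)) x • dSigma x f)
          + sigma (X ^ (l - β) * f) x • ((β : ℝ) • traceForm x (X ^ (β - 1)))) := by
  have he : lieDeriv (masterField l) (sigma f) =ᶠ[nhds x] fun y =>
      sigma (X ^ (l + 1) * derivative f) y - ∑ β ∈ Finset.Icc 1 l, (jacMatrix y ^ β).trace *
          (sigma (X ^ (l - β) * f) y - sigma (X ^ (l - β)) y * sigma f y) := by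
    filter_upwards [(isOpen_jac n).mem_nhds hx] with y hy
    exact lieDeriv_masterField_sigma hy l f
  have hs : ∀ g, HasFDerivAt (sigma g) (dSigma x g) x := fun g =>
    (differentiableAt_sigma g x).hasFDerivAt
  have hh := (hs (X ^ (l + 1) * derivative f)).fun_sub (HasFDerivAt.fun_sum
    (u := Finset.Icc 1 l) fun β _ => (hasFDerivAt_trace_pow β x).fun_mul
      ((hs (X ^ (l - β) * f)).fun_sub ((hs (X ^ (l - β))).fun_mul (hs f))))
  rw [he.fderiv_eq, hh.fderiv]
  congr 1
  refine Finset.sum_congr rfl fun β _ => ?_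
  rw [hf, zero_smul, add_zero, mul_zero, sub_zero]

theorem weylBracket_lieDeriv_sigma (hx : x ∈ Jac n) (l k : ℕ) {f g : ℝ[X]} (hf : sigma f x = 0)
    (hg : sigma g x = 0) :
    brk (weylBracket n k) (lieDeriv (masterField l) (sigma f)) (sigma g) x =
      sigmaTwo x (C (X ^ k) * kern (X ^ (l + 1) * derivative f) g)
        - lieDeriv (masterField l) (sigma f) x * sigmaTwo x (C (X ^ k) * kern 1 g)
        - ∑ β ∈ Finset.Icc 1 l, ((jacMatrix x ^ β).trace *
            (sigmaTwo x (C (X ^ k) * kern (X ^ (l - β) * f) g)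
              - sigma (X ^ (l - β)) x * sigmaTwo x (C (X ^ k) * kern f g))
          - β * (sigma (X ^ (l - β) * f) x * sigma (X ^ (k + β - 1) * g) x)) := by
  rw [brk, fderiv_lieDeriv_sigma hx l hf, ← dSigma_eq_fderiv, map_sub, map_sum, LinearMap.sub_apply,
    LinearMap.sum_apply, weylBracket_dSigma k hx, lieDeriv_masterField_sigma hx, sigmaBrk_apply, hg]
  have h : ∀ β ∈ Finset.Icc 1 l, weylBracket n k x
      ((jacMatrix x ^ β).trace • (dSigma x (X ^ (l - β) * f) - sigma (X ^ (l - β)) x • dSigma x f)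
          + sigma (X ^ (l - β) * f) x • ((β : ℝ) • traceForm x (X ^ (β - 1)))) (dSigma x g) =
      (jacMatrix x ^ β).trace * (sigmaTwo x (C (X ^ k) * kern (X ^ (l - β) * f) g)
              - sigma (X ^ (l - β)) x * sigmaTwo x (C (X ^ k) * kern f g))
          - β * (sigma (X ^ (l - β) * f) x * sigma (X ^ (k + β - 1) * g) x)
        - (jacMatrix x ^ β).trace * sigma (X ^ (l - β) * f) x *
          sigmaTwo x (C (X ^ k) * kern 1 g) := by
    intro β hβ
    have hβ' := (Finset.mem_Icc.1 hβ).1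
    simp only [map_add, map_sub, map_smul, LinearMap.add_apply, LinearMap.sub_apply,
      LinearMap.smul_apply, smul_eq_mul, weylBracket_dSigma k hx, weylBracket_traceForm k hx]
    have hp : X ^ k * (X ^ (β - 1) * g) = X ^ (k + β - 1) * g := by
      rw [← mul_assoc, ← pow_add, show k + (β - 1) = k + β - 1 by omega]
    rw [sigmaBrk_apply, sigmaBrk_apply, hg, hf, hp]
    ring
  rw [Finset.sum_congr rfl h, Finset.sum_sub_distrib, sub_mul, Finset.sum_mul]
  simp only [hf, mul_zero, sub_zero]
  ring

theorem lieDeriv_brk_sigma (hx : x ∈ Jac n) (l k : ℕ) {f g : ℝ[X]} (hf : sigma f x = 0)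
    (hg : sigma g x = 0) :
    lieDeriv (masterField l) (brk (weylBracket n k) (sigma f) (sigma g)) x =
      sigmaTwo x (eulerTwo l (C (X ^ k) * kern f g))
        - ∑ β ∈ Finset.Icc 1 l, (jacMatrix x ^ β).trace *
          (sigmaTwo x (C (X ^ k) * kern (X ^ (l - β) * f) g)
            + sigmaTwo x (C (X ^ k) * kern f (X ^ (l - β) * g))
            - 2 * sigma (X ^ (l - β)) x * sigmaTwo x (C (X ^ k) * kern f g))
        - lieDeriv (masterField l) (sigma f) x * sigmaTwo x (C (X ^ k) * kern 1 g)
        - lieDeriv (masterField l) (sigma g) x * sigmaTwo x (C (X ^ k) * kern f 1) := by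
  -- σ(f) and σ(g) vanish at `x` only, so the terms with these factors stay until after
  -- differentiation.
  have he : brk (weylBracket n k) (sigma f) (sigma g) =ᶠ[nhds x] fun y =>
      sigmaTwo y (C (X ^ k) * kern f g) - sigma f y * sigmaTwo y (C (X ^ k) * kern 1 g)
        - sigma g y * sigmaTwo y (C (X ^ k) * kern f 1) := by
    filter_upwards [(isOpen_jac n).mem_nhds hx] with y hy
    exact weylBracket_dSigma k hy f g
  have hs : ∀ g, HasFDerivAt (sigma g) (fderiv ℝ (sigma g) x) x := fun g =>
    (differentiableAt_sigma g x).hasFDerivAt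
  have ht : ∀ Φ, HasFDerivAt (fun y => sigmaTwo y Φ) (fderiv ℝ (fun y => sigmaTwo y Φ) x) x :=
    fun Φ => (differentiableAt_sigmaTwo Φ x).hasFDerivAt
  have hh := ((ht (C (X ^ k) * kern f g)).fun_sub
    ((hs f).fun_mul (ht (C (X ^ k) * kern 1 g)))).fun_sub
      ((hs g).fun_mul (ht (C (X ^ k) * kern f 1)))
  have h0 := lieDeriv_masterField_sigmaTwo hx l (C (X ^ k) * kern f g)
  have h1 : ∀ c : ℕ, sigmaTwo x ((C (X ^ c) + X ^ c) * (C (X ^ k) * kern f g)) =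
      sigmaTwo x (C (X ^ k) * kern (X ^ c * f) g) + sigmaTwo x (C (X ^ k) * kern f (X ^ c * g)) := by
    intro c
    rw [mul_left_comm, pow_add_pow_mul_kern, mul_add, map_add]
  simp only [h1] at h0
  rw [lieDeriv, he.fderiv_eq, hh.fderiv, ← h0]
  simp only [hf, hg, zero_smul, zero_add, _root_.sub_apply, _root_.smul_apply, smul_eq_mul, lieDeriv]
  ring

theorem sigmaTwo_sum_weighted_kern (l k : ℕ) (f g : ℝ[X]) (x : Coord n) :
    ∑ β ∈ Finset.Icc 1 l, (β : ℝ) * (sigma (X ^ (k + β - 1) * f) x * sigma (X ^ (l - β) * g) x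
        - sigma (X ^ (k + β - 1) * g) x * sigma (X ^ (l - β) * f) x) =
      sigmaTwo x (C (X ^ k) * fullSum l * kern f g)
        - ((l : ℝ) + 1) * sigmaTwo x (C (X ^ (k + l)) * kern f g) := by
  have hn : ∀ (m : ℕ) (Φ : ℝ[X][X]), sigmaTwo x ((m : ℝ[X][X]) * Φ) = m * sigmaTwo x Φ := by
    intro m Φ
    rw [← nsmul_eq_mul, map_nsmul, nsmul_eq_mul]
  have h := congrArg (sigmaTwo x) (sum_weighted_kern l k f g)
  simp only [map_sum, hn, map_sub, sigmaTwo_mul] at h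
  rw [h]
  have h2 : -(C (X ^ k) * kern f g * (((l : ℝ[X][X]) + 1) * C X ^ l - fullSum l)) =
      C (X ^ k) * fullSum l * kern f g - ((l + 1 : ℕ) : ℝ[X][X]) * (C (X ^ (k + l)) * kern f g) := by
    simp only [C_pow, pow_add, C_mul]; push_cast; ring
  rw [h2, map_sub, hn]
  push_cast; ring

/-- The terms with Y_lσ(f), Y_lσ(g) and Tr X^β cancel between the three brackets. The rest is k
x^{k+l} - x^k `fullSum` from the derivation plus x^k `fullSum` - (l+1) x^{k+l} from the traces,
times the kernel. -/
theorem lieDeriv_weylBracket_sigma (hx : x ∈ Jac n) (l k : ℕ) {f g : ℝ[X]} (hf : sigma f x = 0)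
    (hg : sigma g x = 0) :
    lieDeriv (masterField l) (brk (weylBracket n k) (sigma f) (sigma g)) x
        - brk (weylBracket n k) (lieDeriv (masterField l) (sigma f)) (sigma g) x
        - brk (weylBracket n k) (sigma f) (lieDeriv (masterField l) (sigma g)) x
      = ((k : ℝ) - l - 1) * brk (weylBracket n (k + l)) (sigma f) (sigma g) x := by
  have h1 : brk (weylBracket n k) (sigma f) (lieDeriv (masterField l) (sigma g)) x =
      -brk (weylBracket n k) (lieDeriv (masterField l) (sigma g)) (sigma f) x :=
    weylBracket_skew k x _ _
  have h2 : brk (weylBracket n (k + l)) (sigma f) (sigma g) x =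
      sigmaTwo x (C (X ^ (k + l)) * kern f g) := by
    rw [brk, ← dSigma_eq_fderiv, ← dSigma_eq_fderiv, weylBracket_dSigma (k + l) hx, sigmaBrk_apply,
      hf, hg]
    ring
  have hk : ∀ Φ : ℝ[X][X], sigmaTwo x ((k : ℝ[X][X]) * Φ) = k * sigmaTwo x Φ := by
    intro Φ
    rw [← nsmul_eq_mul, map_nsmul, nsmul_eq_mul]
  have h3 : sigmaTwo x (eulerTwo l (C (X ^ k) * kern f g)) =
      sigmaTwo x (C (X ^ k) * kern (X ^ (l + 1) * derivative f) g)
        + sigmaTwo x (C (X ^ k) * kern f (X ^ (l + 1) * derivative g))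
        + k * sigmaTwo x (C (X ^ (k + l)) * kern f g)
        - sigmaTwo x (C (X ^ k) * fullSum l * kern f g) := by
    rw [eulerTwo_pow_mul_kern, mul_add, sub_mul, mul_assoc (k : ℝ[X][X]), map_add, map_add, map_sub,
      hk]
    ring
  have h4 := sigmaTwo_sum_weighted_kern l k f g x
  rw [h1, h2, lieDeriv_brk_sigma hx l k hf hg, weylBracket_lieDeriv_sigma hx l k hf hg,
    weylBracket_lieDeriv_sigma hx l k hg hf, h3, sigmaTwo_kern_skew k x g f,
    sigmaTwo_kern_skew k x (X ^ (l + 1) * derivative g) f, sigmaTwo_kern_skew k x 1 f]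
  have h5 : ∀ c : ℕ, sigmaTwo x (C (X ^ k) * kern (X ^ c * g) f) =
      -sigmaTwo x (C (X ^ k) * kern f (X ^ c * g)) := fun c => sigmaTwo_kern_skew k x _ _
  simp only [h5]
  have h6 : ∑ β ∈ Finset.Icc 1 l, (jacMatrix x ^ β).trace *
          (sigmaTwo x (C (X ^ k) * kern (X ^ (l - β) * f) g)
            + sigmaTwo x (C (X ^ k) * kern f (X ^ (l - β) * g))
            - 2 * sigma (X ^ (l - β)) x * sigmaTwo x (C (X ^ k) * kern f g)) =
      (∑ β ∈ Finset.Icc 1 l, ((jacMatrix x ^ β).trace *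
            (sigmaTwo x (C (X ^ k) * kern (X ^ (l - β) * f) g)
              - sigma (X ^ (l - β)) x * sigmaTwo x (C (X ^ k) * kern f g))
          - β * (sigma (X ^ (l - β) * f) x * sigma (X ^ (k + β - 1) * g) x)))
      - (∑ β ∈ Finset.Icc 1 l, ((jacMatrix x ^ β).trace *
            (-sigmaTwo x (C (X ^ k) * kern f (X ^ (l - β) * g))
              - sigma (X ^ (l - β)) x * -sigmaTwo x (C (X ^ k) * kern f g))
          - β * (sigma (X ^ (l - β) * g) x * sigma (X ^ (k + β - 1) * f) x)))
      - ∑ β ∈ Finset.Icc 1 l, (β : ℝ) * (sigma (X ^ (k + β - 1) * f) x * sigma (X ^ (l - β) * g) x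
        - sigma (X ^ (k + β - 1) * g) x * sigma (X ^ (l - β) * f) x) := by
    rw [← Finset.sum_sub_distrib, ← Finset.sum_sub_distrib]
    exact Finset.sum_congr rfl fun β _ => by ring
  rw [h6, h4]
  ring

/-- Every covector at a point of `Jac` is the differential of some `σ(f)` that vanishes there. -/
theorem exists_sigma_eq_zero (hx : x ∈ Jac n) (α : Coord n →L[ℝ] ℝ) :
    ∃ f : ℝ[X], sigma f x = 0 ∧ fderiv ℝ (sigma f) x = α := by
  obtain ⟨f, hf⟩ := dSigma_surjective hx α
  refine ⟨f - C (sigma f x), by rw [sigma_sub, sigma_C, sub_self], ?_⟩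
  rw [← dSigma_eq_fderiv, map_sub, hf, ← mul_one (C _), ← smul_eq_C_mul, map_smul, dSigma_one,
    smul_zero, sub_zero]

/-- Both sides depend only on the differentials at the point, and every covector there is the
differential of a moment vanishing at it. -/
theorem lieDeriv_weylBracket (hx : x ∈ Jac n) (l k : ℕ) {f g : Coord n → ℝ}
    (hf : ContDiffAt ℝ 2 f x) (hg : ContDiffAt ℝ 2 g x) :
    lieDeriv (masterField l) (brk (weylBracket n k) f g) x
        - brk (weylBracket n k) (lieDeriv (masterField l) f) g x
        - brk (weylBracket n k) f (lieDeriv (masterField l) g) x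
      = ((k : ℝ) - l - 1) * brk (weylBracket n (k + l)) f g x := by
  obtain ⟨τ, hτ⟩ := exists_lieDeriv_weylBracket k hx (Y := masterField l)
    (((contDiffOn_masterField l).contDiffAt ((isOpen_jac n).mem_nhds hx)).differentiableAt (by simp))
  obtain ⟨F, hF, hF'⟩ := exists_sigma_eq_zero hx (fderiv ℝ f x)
  obtain ⟨G, hG, hG'⟩ := exists_sigma_eq_zero hx (fderiv ℝ g x)
  have hs : ∀ F, ContDiffAt ℝ 2 (sigma F) x := fun F =>
    (contDiff_infty.1 (contDiff_sigma F) 2).contDiffAt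
  rw [hτ f g hf hg, ← hF', ← hG', ← hτ _ _ (hs F) (hs G), lieDeriv_weylBracket_sigma hx l k hF hG,
    brk, brk, hF', hG']

end

end TodaJac

end

open TodaJac in
theorem theorem4p3 (n : ℕ) :
    -- the right-hand side is tangent to `Jac`, and `Y_l` is a smooth vector field on `Jac`
    (∀ l : ℕ, 1 ≤ l →
      (∀ x ∈ Jac n, tangentMatrix (masterField l x) = masterRhs l x) ∧
      ContDiffOn ℝ ∞ (masterField (n := n) l) (Jac n)) ∧
    -- (i)
    (∀ l : ℕ, 1 ≤ l → ∀ j : ℤ, ∀ x ∈ Jac n, (0 < j ∨ (jacMatrix x).det ≠ 0) →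
      DifferentiableAt ℝ (ham (n := n) j) x ∧
      (j ≠ -(l : ℤ) →
        lieDeriv (masterField l) (ham j) x = ((l : ℝ) + (j : ℝ)) * ham ((l : ℤ) + j) x) ∧
      (j = -(l : ℤ) → lieDeriv (masterField l) (ham j) x = (n : ℝ) + 1)) ∧
    -- (ii), with the existence and the uniqueness of the brackets
    (∃ w : ℕ → BiField n,
      (∀ k, IsWeylBracket n k (w k)) ∧
      (∀ k, ∀ w' : BiField n, IsWeylBracket n k w' → ∀ x ∈ Jac n, w' x = w k x) ∧
      (∀ l : ℕ, 1 ≤ l → ∀ k : ℕ, ∀ x ∈ Jac n, ∀ f g : Coord n → ℝ,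
        ContDiffAt ℝ 2 f x → ContDiffAt ℝ 2 g x →
        lieDeriv (masterField l) (brk (w k) f g) x
            - brk (w k) (lieDeriv (masterField l) f) g x
            - brk (w k) f (lieDeriv (masterField l) g) x
          = ((k : ℝ) - (l : ℝ) - 1) * brk (w (k + l)) f g x)) := by
  refine ⟨fun l _ => ⟨fun x hx => tangentMatrix_masterField hx l, contDiffOn_masterField l⟩,
    fun l _ j x hx hj => lieDeriv_ham hx l j hj, weylBracket n, isWeylBracket_weylBracket n,
    fun k w' hw' x hx => isWeylBracket_unique (isWeylBracket_weylBracket n k) hw' hx,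
    fun l _ k x hx f g hf hg => lieDeriv_weylBracket hx l k hf hg⟩
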